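/- **Setting.** Let $AP$ be a countably infinite set of atomic propositions. A trace is an infinite sequence of subsets of $AP$. A finite Kripke structure $\mathcal K=\langle S,S_{init},\delta,L\rangle$ consists of a finite set $S$ of states, a set $S_{init}\subseteq S$ of initial states, a relation $\delta\subseteq S\times S$ under which every state has a successor, and a labelling of the states by finite subsets of $AP$; its traces are the label sequences of its infinite paths that start in $S_{init}$. Formulas of asynchronous HyperLTL (A-HyperLTL) are given by $\varphi::=\exists\pi.\varphi\mid\forall\pi.\varphi\mid\mathsf E\psi\mid\mathsf A\psi$ and $\psi::=a_\pi\mid\neg\psi\mid\psi\vee\psi\mid\bigcirc\psi\mid\psi\,\mathcal U\,\psi$, where $a\in AP$ and $\pi$ is a trace variable; they are required to be closed, and no variable is quantified twice. A trace assignment $\Pi$ is a finite partial map from trace variables to pairs (trace, position). A trajectory over a set $V$ of variables is an infinite sequence $t(0)t(1)\cdots$ of non-empty subsets of $V$; it is fair if every $\pi\in V$ lies in infinitely many $t(j)$. The successor $(\Pi,t)+1$ advances by one the positions of the variables in $t(0)$ and removes $t(0)$ from $t$. Trace quantifiers range over the traces of $\mathcal K$, starting at position $0$; $\Pi\models\mathsf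 E\psi$ (respectively $\mathsf A\psi$) iff $(\Pi,t)\models\psi$ for some (respectively every) trajectory $t$ over the domain of $\Pi$; $(\Pi,t)\models a_\pi$ iff $a$ holds at the current position of $\Pi(\pi)$; $\bigcirc$ and $\mathcal U$ are interpreted along $(\Pi,t),(\Pi,t)+1,(\Pi,t)+2,\dots$. In the *fair semantics*, $\mathsf E$ and $\mathsf A$ range over fair trajectories only. **Theorem.** 1. The problem of deciding, given a finite Kripke structure $\mathcal K$ and an A-HyperLTL formula $\varphi$, whether $\mathcal K\models\varphi$, is undecidable, both when $\mathsf E,\mathsf A$ range over all trajectories and in the fair semantics. 2. In both semantics this holds already for the formulas $\forall\pi.\forall\pi'.\mathsf E.(\Box\psi_1\wedge\Diamond\psi_2)$ in which $\psi_1,\psi_2$ are Boolean combinations of atoms $a_\pi,a_{\pi'}$. 3. There is a computable map that sends each instance $I$ of Post's correspondence problem (a finite list of dominos $(w_1,v_1),\dots,(w_k,v_k)$, each a pair of finite words) to a finite Kripke structure $\mathcal K_I$ together with the formula $$\varphi_{\overline{pcp}}=\forall\pi_w.\forall\pi_v.\mathsf E.\big(\varphi_{type}\to(\varphi_{domino}\vee\varphi_{word})\big),$$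 such that, in the fair semantics, $\mathcal K_I\models\varphi_{\overline{pcp}}$ if and only if $I$ has no solution, that is, there is no non-empty sequence $i_1,\dots,i_n$ of indices with $w_{i_1}\cdots w_{i_n}=v_{i_1}\cdots v_{i_n}$. Here $$\varphi_{type}=\big((w_{\pi_w}\wedge\neg v_{\pi_w})\,\mathcal U\,end_{\pi_w}\big)\wedge\big((\neg w_{\pi_v}\wedge v_{\pi_v})\,\mathcal U\,end_{\pi_v}\big),$$ $$\varphi_{domino}=\Box(dom_{\pi_w}\leftrightarrow dom_{\pi_v})\wedge\Diamond\bigvee_{i=1}^k(dom^i_{\pi_w}\not\leftrightarrow dom^i_{\pi_v}),\qquad dom_\pi=\bigvee_{i=1}^k dom^i_\pi,$$ $$\varphi_{word}=\Box(lc_{\pi_w}\leftrightarrow lc_{\pi_v})\wedge\Diamond\bigvee_{l}(l_{\pi_w}\not\leftrightarrow l_{\pi_v}),$$ where $w,v,end,lc,dom^i$ and the letters $l$ are pairwise distinct atomic propositions and the last disjunction runs over the letters that occur on the dominos. -/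

import Mathlib

namespace AHLTL

/-! ### Syntax. Atomic propositions and trace variables are natural numbers. -/

/-- The temporal formulas `ψ ::= a_π | ¬ψ | ψ ∨ ψ | ○ψ | ψ U ψ`. -/
inductive Psi : Type
  /-- `atom a x` is the atom `a_x`: proposition `a` on trace variable `x`. -/
  | atom (a x : ℕ) : Psi
  | neg (p : Psi) : Psi
  | next (p : Psi) : Psi
  | or (p q : Psi) : Psi
  | unt (p q : Psi) : Psi

/-- The formulas `φ ::= E ψ | A ψ | ∃π. φ | ∀π. φ`. -/
inductive Formula : Type
  | someTraj (p : Psi) : Formula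
  | allTraj (p : Psi) : Formula
  | ex (x : ℕ) (f : Formula) : Formula
  | all (x : ℕ) (f : Formula) : Formula

namespace Psi

/-- Syntactic sugar. `tru` is `a_π ∨ ¬a_π` for one fixed atom, on trace variable `0`. -/
def tru : Psi := or (atom 0 0) (neg (atom 0 0))
def fls : Psi := neg tru
def and (p q : Psi) : Psi := neg (or (neg p) (neg q))
def imp (p q : Psi) : Psi := or (neg p) q
def iff (p q : Psi) : Psi := and (imp p q) (imp q p)
/-- `◇ p` -/
def ev (p : Psi) : Psi := unt tru p
/-- `□ p` -/
def alw (p : Psi) : Psi := neg (ev (neg p))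
/-- Finite disjunction. -/
def bigOr : List Psi → Psi
  | [] => fls
  | p :: l => or p (bigOr l)

/-- The trace variables that occur in a temporal formula. -/
def vars : Psi → Set ℕ
  | atom _ x => {x}
  | neg p => p.vars
  | next p => p.vars
  | or p q => p.vars ∪ q.vars
  | unt p q => p.vars ∪ q.vars

/-- State formulas: Boolean combinations of atoms (no temporal operator). -/
def IsState : Psi → Prop
  | atom _ _ => True
  | neg p => p.IsState
  | next _ => False
  | or p q => p.IsState ∧ q.IsState
  | unt _ _ => False

/-- Gödel numbering of temporal formulas. -/
def enc : Psi → ℕ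
  | atom a x => 5 * Nat.pair a x
  | neg p => 5 * p.enc + 1
  | next p => 5 * p.enc + 2
  | or p q => 5 * Nat.pair p.enc q.enc + 3
  | unt p q => 5 * Nat.pair p.enc q.enc + 4

/-- The inverse of the Gödel numbering. -/
def dec (n : ℕ) : Psi :=
  if n % 5 = 0 then atom (n / 5).unpair.1 (n / 5).unpair.2
  else if n % 5 = 1 then neg (dec (n / 5))
  else if n % 5 = 2 then next (dec (n / 5))
  else if n % 5 = 3 then or (dec (n / 5).unpair.1) (dec (n / 5).unpair.2)
  else unt (dec (n / 5).unpair.1) (dec (n / 5).unpair.2)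
termination_by n
decreasing_by
  all_goals
    have h1 := Nat.unpair_left_le (n / 5)
    have h2 := Nat.unpair_right_le (n / 5)
    omega

theorem dec_enc (p : Psi) : dec p.enc = p := by
  induction p with
  | atom a x => rw [dec]; simp [enc]
  | neg p ih =>
    have h : (5 * p.enc + 1) % 5 = 1 := by omega
    have h' : (5 * p.enc + 1) / 5 = p.enc := by omega
    rw [enc, dec]; simp [h, h', ih]
  | next p ih =>
    have h : (5 * p.enc + 2) % 5 = 2 := by omega
    have h' : (5 * p.enc + 2) / 5 = p.enc := by omega
    rw [enc, dec]; simp [h, h', ih]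
  | or p q ihp ihq =>
    have h : (5 * Nat.pair p.enc q.enc + 3) % 5 = 3 := by omega
    have h' : (5 * Nat.pair p.enc q.enc + 3) / 5 = Nat.pair p.enc q.enc := by omega
    rw [enc, dec]; simp [h, h', ihp, ihq]
  | unt p q ihp ihq =>
    have h : (5 * Nat.pair p.enc q.enc + 4) % 5 = 4 := by omega
    have h' : (5 * Nat.pair p.enc q.enc + 4) / 5 = Nat.pair p.enc q.enc := by omega
    rw [enc, dec]; simp [h, h', ihp, ihq]

theorem enc_dec (n : ℕ) : (dec n).enc = n := by
  induction n using Nat.strong_induction_on with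
  | _ n ih =>
    have h1 := Nat.unpair_left_le (n / 5)
    have h2 := Nat.unpair_right_le (n / 5)
    rw [dec]
    split_ifs with h0 ha hb hc
    · simp only [enc, Nat.pair_unpair]; omega
    · rw [enc, ih (n / 5) (by omega)]; omega
    · rw [enc, ih (n / 5) (by omega)]; omega
    · rw [enc, ih _ (by omega), ih _ (by omega), Nat.pair_unpair]; omega
    · rw [enc, ih _ (by omega), ih _ (by omega), Nat.pair_unpair]; omega

/-- Through this bijection with `ℕ` computability of functions on formulas is understood. -/
instance : Denumerable Psi := Denumerable.mk' ⟨enc, dec, dec_enc, enc_dec⟩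

end Psi

namespace Formula

/-- Gödel numbering of formulas. -/
def enc : Formula → ℕ
  | someTraj p => 4 * p.enc
  | allTraj p => 4 * p.enc + 1
  | ex x f => 4 * Nat.pair x f.enc + 2
  | all x f => 4 * Nat.pair x f.enc + 3

/-- The inverse of the Gödel numbering. -/
def dec (n : ℕ) : Formula :=
  if n % 4 = 0 then someTraj (Psi.dec (n / 4))
  else if n % 4 = 1 then allTraj (Psi.dec (n / 4))
  else if n % 4 = 2 then ex (n / 4).unpair.1 (dec (n / 4).unpair.2)
  else all (n / 4).unpair.1 (dec (n / 4).unpair.2)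
termination_by n
decreasing_by
  all_goals
    have h2 := Nat.unpair_right_le (n / 4)
    omega

theorem dec_enc (f : Formula) : dec f.enc = f := by
  induction f with
  | someTraj p => rw [enc, dec]; simp [Psi.dec_enc]
  | allTraj p =>
    have h : (4 * p.enc + 1) % 4 = 1 := by omega
    have h' : (4 * p.enc + 1) / 4 = p.enc := by omega
    rw [enc, dec]; simp [h, h', Psi.dec_enc]
  | ex x f ih =>
    have h : (4 * Nat.pair x f.enc + 2) % 4 = 2 := by omega
    have h' : (4 * Nat.pair x f.enc + 2) / 4 = Nat.pair x f.enc := by omega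
    rw [enc, dec]; simp [h, h', ih]
  | all x f ih =>
    have h : (4 * Nat.pair x f.enc + 3) % 4 = 3 := by omega
    have h' : (4 * Nat.pair x f.enc + 3) / 4 = Nat.pair x f.enc := by omega
    rw [enc, dec]; simp [h, h', ih]

theorem enc_dec (n : ℕ) : (dec n).enc = n := by
  induction n using Nat.strong_induction_on with
  | _ n ih =>
    have h2 := Nat.unpair_right_le (n / 4)
    rw [dec]
    split_ifs with h0 ha hb
    · rw [enc, Psi.enc_dec]; omega
    · rw [enc, Psi.enc_dec]; omega
    · rw [enc, ih _ (by omega), Nat.pair_unpair]; omega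
    · rw [enc, ih _ (by omega), Nat.pair_unpair]; omega

instance : Denumerable Formula := Denumerable.mk' ⟨enc, dec, dec_enc, enc_dec⟩

/-- Well-formedness below quantifiers that bind the variables in `B`: every trace variable of an
atom is quantified, and no trace variable is quantified twice. -/
def WellFormedIn : List ℕ → Formula → Prop
  | B, someTraj p => ∀ x ∈ p.vars, x ∈ B
  | B, allTraj p => ∀ x ∈ p.vars, x ∈ B
  | B, ex x f => x ∉ B ∧ WellFormedIn (x :: B) f
  | B, all x f => x ∉ B ∧ WellFormedIn (x :: B) f

/-- Well-formed closed formulas. -/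
def WellFormed (f : Formula) : Prop := WellFormedIn [] f

end Formula

/-! ### Semantics -/

/-- A trace: an infinite sequence of letters (sets of atomic propositions). -/
abbrev Trace : Type := ℕ → Set ℕ

/-- A trace assignment: a partial map from trace variables to pointed traces. -/
abbrev Assignment : Type := ℕ → Option (Trace × ℕ)

/-- An infinite sequence of sets of trace variables. -/
abbrev Trajectory : Type := ℕ → Set ℕ

/-- The assignment with empty domain. -/
def Assignment.empty : Assignment := fun _ => none

/-- The domain of an assignment. -/
def Assignment.dom (P : Assignment) : Set ℕ := {x | (P x).isSome = true}

/-- `P[x ↦ (s, 0)]` -/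
def Assignment.bind (P : Assignment) (x : ℕ) (s : Trace) : Assignment :=
  fun y => if y = x then some (s, 0) else P y

open Classical in
/-- The `I`-successor: the pointers of the variables in `I` move by one. -/
noncomputable def Assignment.advance (P : Assignment) (I : Set ℕ) : Assignment :=
  fun x => if x ∈ I then (P x).map (fun q => (q.1, q.2 + 1)) else P x

/-- The trajectories over `V`: sequences of non-empty subsets of `V`. -/
def trajectories (V : Set ℕ) : Set Trajectory :=
  {t | ∀ n, (t n).Nonempty ∧ t n ⊆ V}

/-- The fair trajectories over `V`: every variable of `V` moves infinitely often. -/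
def fairTrajectories (V : Set ℕ) : Set Trajectory :=
  {t | t ∈ trajectories V ∧ ∀ x ∈ V, ∀ n, ∃ m, n ≤ m ∧ x ∈ t m}

/-- The successor `(P, t) + 1`; `(P, t) + k` is its `k`-th iterate. -/
noncomputable def succ (c : Assignment × Trajectory) : Assignment × Trajectory :=
  (c.1.advance (c.2 0), fun n => c.2 (n + 1))

/-- `(P, t) ⊨ ψ` -/
def Psi.Sat : Psi → Assignment × Trajectory → Prop
  | .atom a x, c => ∃ q : Trace × ℕ, c.1 x = some q ∧ a ∈ q.1 q.2
  | .neg p, c => ¬ p.Sat c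
  | .next p, c => p.Sat (succ c)
  | .or p q, c => p.Sat c ∨ q.Sat c
  | .unt p q, c => ∃ i, q.Sat (succ^[i] c) ∧ ∀ j < i, p.Sat (succ^[j] c)

/-- `P ⊨_T φ`, where the trajectory modalities range over the class `TRJ` of trajectories
(over the domain of the assignment). -/
def Formula.Sat (TRJ : Set ℕ → Set Trajectory) (T : Set Trace) : Formula → Assignment → Prop
  | .someTraj p, P => ∃ t ∈ TRJ P.dom, p.Sat (P, t)
  | .allTraj p, P => ∀ t ∈ TRJ P.dom, p.Sat (P, t)
  | .ex x f, P => ∃ s ∈ T, f.Sat TRJ T (P.bind x s)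
  | .all x f, P => ∀ s ∈ T, f.Sat TRJ T (P.bind x s)

/-- Kripke structures with state set `S`. -/
structure Kripke (S : Type) where
  init : Set S
  trans : S → S → Prop
  label : S → Set ℕ
  total : ∀ s, ∃ s', trans s s'

/-- The traces of the paths that start in an initial state. -/
def Kripke.traces {S : Type} (K : Kripke S) : Set Trace :=
  {s | ∃ r : ℕ → S, r 0 ∈ K.init ∧ (∀ i, K.trans (r i) (r (i + 1))) ∧ ∀ i, s i = K.label (r i)}

/-- `K ⊨ φ` -/
def Kripke.Models {S : Type} (TRJ : Set ℕ → Set Trajectory) (K : Kripke S) (f : Formula) : Prop :=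
  f.Sat TRJ K.traces Assignment.empty

/-! ### Decision problems -/

/-- A finite Kripke structure as finite data: entry `i` of the list describes state `i` by a bit
(whether it is initial), the list of its successors and the list of its propositions. -/
abbrev KripkeCode : Type := List (Bool × List ℕ × List ℕ)

/-- Every state has a successor. -/
def KripkeCode.Total (c : KripkeCode) : Prop :=
  ∀ s : Fin c.length, ∃ s' : Fin c.length, (s' : ℕ) ∈ (c.get s).2.1

/-- The Kripke structure that a code describes. -/
def KripkeCode.toKripke (c : KripkeCode) (h : KripkeCode.Total c) : Kripke (Fin c.length) where
  init := {s | (c.get s).1 = true}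
  trans s s' := (s' : ℕ) ∈ (c.get s).2.1
  label s := {a | a ∈ (c.get s).2.2}
  total := h

/-- The code describes a Kripke structure, and that structure satisfies the formula. -/
def KripkeCode.Models (TRJ : Set ℕ → Set Trajectory) (c : KripkeCode) (f : Formula) : Prop :=
  ∃ h : KripkeCode.Total c, (KripkeCode.toKripke c h).Models TRJ f

/-- The problem `P` is decidable on the instances in `D`: some total computable function answers
correctly on all of them (its answers on other inputs do not matter). -/
def DecidableOn {α : Type} [Primcodable α] (D P : α → Prop) : Prop :=
  ∃ f : α → Bool, Computable f ∧ ∀ a, D a → (f a = true ↔ P a)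

/-- `∀π₀. ∀π₁. E. (□ ψ₁ ∧ ◇ ψ₂)` -/
def shape (p q : Psi) : Formula :=
  .all 0 (.all 1 (.someTraj ((Psi.alw p).and (Psi.ev q))))

/-! ### Post's correspondence problem -/

/-- An instance: a finite list of dominos, each with an upper and a lower word. -/
abbrev PCP : Type := List (List ℕ × List ℕ)

/-- Some non-empty sequence of dominos, repetitions allowed, spells the same word above and
below. -/
def PCP.Solvable (I : PCP) : Prop :=
  ∃ s : List (List ℕ × List ℕ), s ≠ [] ∧ (∀ d ∈ s, d ∈ I) ∧
    s.flatMap Prod.fst = s.flatMap Prod.snd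

/-- The atomic propositions `w`, `v`, `end`, `lc`, `dom i` and the letters, which are pairwise
distinct. -/
def apW : ℕ := 0
def apV : ℕ := 1
def apEnd : ℕ := 2
def apLc : ℕ := 3
def apDom (i : ℕ) : ℕ := 4 + 2 * i
def apLetter (l : ℕ) : ℕ := 5 + 2 * l

/-- Trace variable `0` is `π_w` and trace variable `1` is `π_v`. -/
def phiType : Psi :=
  (Psi.unt ((Psi.atom apW 0).and (Psi.neg (Psi.atom apV 0))) (Psi.atom apEnd 0)).and
    (Psi.unt ((Psi.neg (Psi.atom apW 1)).and (Psi.atom apV 1)) (Psi.atom apEnd 1))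

/-- `dom_x`, the disjunction of the `dom^i_x`. -/
def domAt (I : PCP) (x : ℕ) : Psi :=
  Psi.bigOr ((List.range I.length).map fun i => Psi.atom (apDom i) x)

def phiDomino (I : PCP) : Psi :=
  (Psi.alw ((domAt I 0).iff (domAt I 1))).and
    (Psi.ev (Psi.bigOr ((List.range I.length).map fun i =>
      Psi.neg ((Psi.atom (apDom i) 0).iff (Psi.atom (apDom i) 1)))))

/-- The letters that occur on the dominos. -/
def PCP.letters (I : PCP) : List ℕ := I.flatMap fun d => d.1 ++ d.2

def phiWord (I : PCP) : Psi :=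
  (Psi.alw ((Psi.atom apLc 0).iff (Psi.atom apLc 1))).and
    (Psi.ev (Psi.bigOr ((PCP.letters I).map fun l =>
      Psi.neg ((Psi.atom (apLetter l) 0).iff (Psi.atom (apLetter l) 1)))))

/-- `∀π_w. ∀π_v. E. (φ_type → φ_domino ∨ φ_word)` -/
def phiPCP (I : PCP) : Formula :=
  .all 0 (.all 1 (.someTraj (phiType.imp ((phiDomino I).or (phiWord I)))))

end AHLTL

/-! ### Trajectories of two traces as paths in the grid -/

namespace AHLTL

/-! ### Two-trace evaluation -/

/-! A trajectory for two traces amounts to a path in the grid `ℕ × ℕ` that advances one or both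
coordinates in each step; fairness says that both coordinates are unbounded
(`succ_iterate_pairAssignment`, `IsGridPath.exists_trajectory`). Both reductions analyse which pairs
of positions such paths can visit.

Undecidability comes from the halting problem of a fixed machine (`exists_undecidable_machine`). A
run of the Kripke structure is a sequence of guessed rows: the input row, then one row per
configuration, where a state stores a cell with its two neighbours. The node `bot` is entered only
from a halting cell. The formula asks that every pair of runs be exposed by a path on which all
pairs of labels are `Allowed` and one is `Wrong`. Positions are counted modulo 6, and the allowed
distances are 0, 2 and 4. They have the same parity, so once the first trace has left its start both
traces must move together: a path chooses a delay and keeps it. Delay 0 exposes two runs with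
different labels; delay `N`, the row length, which is 2 modulo 6, exposes a row that does not follow
from its predecessor; delay 4 exposes a run that never reaches `bot`. If the machine does not halt,
every pair of runs has one of these faults (`exists_path_of_not_halted`). If it halts, the correct
computation paired with itself has none (`exists_run_of_halted`). The first argument yields fair
paths and the second excludes all paths, which settles both semantics. Labels depend on the machine
only, so the two state formulas are fixed and the input enters through the structure alone.

For Post's problem, a trace shows domino indices and letters at odd positions, separated by gaps.
Marked positions are never adjacent, so a path that sees the marks of both traces simultaneously
matches the k-th mark with the k-th mark (`IsSynced.count_eq`), and a fair path of this kind exists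
(`exists_isSynced`). Hence some fair path satisfies `phiDomino` iff the index sequences differ, and
some fair path satisfies `phiWord` iff the spelled words differ; the infinitely many marks after the
end make differences in length visible. Without a solution, two terminated traces of opposite types
always differ in one of the two. With a single domino its index mark cannot be told from the end
label, so instances with at most one domino are mapped to a one-state structure that carries the
answer. -/

open Classical in
/-- The number of moves of `x` among the first `n` steps of the trajectory `t`. -/
noncomputable def Trajectory.count (t : Trajectory) (x : ℕ) : ℕ → ℕ
  | 0 => 0
  | n + 1 => t.count x n + if x ∈ t n then 1 else 0

/-- The assignment of `s₀` at position `i` to variable `0` and of `s₁` at position `j` to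
variable `1`. -/
def pairAssignment (s₀ s₁ : Trace) (i j : ℕ) : Assignment :=
  fun x => if x = 1 then some (s₁, j) else if x = 0 then some (s₀, i) else none

theorem bind_bind_empty (s₀ s₁ : Trace) :
    (Assignment.empty.bind 0 s₀).bind 1 s₁ = pairAssignment s₀ s₁ 0 0 := rfl

theorem dom_pairAssignment (s₀ s₁ : Trace) (i j : ℕ) :
    (pairAssignment s₀ s₁ i j).dom = {0, 1} := by
  ext x
  by_cases h1 : x = 1
  · simp [Assignment.dom, pairAssignment, h1]
  · by_cases h0 : x = 0 <;> simp [Assignment.dom, pairAssignment, h1, h0]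

/-- The pointers depend only on how often each variable has moved, so temporal formulas along a
trajectory become statements about its two counting functions. -/
theorem succ_iterate_pairAssignment (s₀ s₁ : Trace) (t : Trajectory) (n : ℕ) :
    succ^[n] (pairAssignment s₀ s₁ 0 0, t) =
      (pairAssignment s₀ s₁ (t.count 0 n) (t.count 1 n), fun k => t (k + n)) := by
  induction n with
  | zero => rfl
  | succ n ih =>
    rw [Function.iterate_succ_apply', ih, succ]
    refine Prod.ext ?_ ?_
    · funext x
      simp only [Assignment.advance, pairAssignment, Trajectory.count, zero_add]
      by_cases h1 : x = 1
      · subst h1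
        by_cases h : 1 ∈ t n <;> simp [h]
      · by_cases h0 : x = 0
        · subst h0
          by_cases h : 0 ∈ t n <;> simp [h]
        · simp [h0, h1]
    · funext k
      simp only
      congr 1
      omega

namespace Psi

theorem sat_atom_zero {a i j : ℕ} {s₀ s₁ : Trace} {t : Trajectory} :
    (atom a 0).Sat (pairAssignment s₀ s₁ i j, t) ↔ a ∈ s₀ i := by
  simp [Sat, pairAssignment]

theorem sat_atom_one {a i j : ℕ} {s₀ s₁ : Trace} {t : Trajectory} :
    (atom a 1).Sat (pairAssignment s₀ s₁ i j, t) ↔ a ∈ s₁ j := by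
  simp [Sat, pairAssignment]

theorem sat_neg {p : Psi} {c} : (neg p).Sat c ↔ ¬ p.Sat c := Iff.rfl

theorem sat_or {p q : Psi} {c} : (or p q).Sat c ↔ p.Sat c ∨ q.Sat c := Iff.rfl

theorem sat_and {p q : Psi} {c} : (and p q).Sat c ↔ p.Sat c ∧ q.Sat c := by
  simp [and, Sat]

theorem sat_imp {p q : Psi} {c} : (imp p q).Sat c ↔ (p.Sat c → q.Sat c) := by
  simp [imp, Sat, imp_iff_not_or]

theorem sat_iff {p q : Psi} {c} : (iff p q).Sat c ↔ (p.Sat c ↔ q.Sat c) := by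
  rw [iff, sat_and, sat_imp, sat_imp]
  exact iff_iff_implies_and_implies.symm

theorem sat_tru {c} : tru.Sat c := Classical.em _

theorem not_sat_fls {c} : ¬ fls.Sat c := not_not_intro sat_tru

theorem sat_ev {p : Psi} {c} : (ev p).Sat c ↔ ∃ n, p.Sat (succ^[n] c) :=
  exists_congr fun _ => and_iff_left fun _ _ => sat_tru

theorem sat_alw {p : Psi} {c} : (alw p).Sat c ↔ ∀ n, p.Sat (succ^[n] c) := by
  rw [alw, sat_neg, sat_ev]
  simp [sat_neg]

theorem sat_bigOr {l : List Psi} {c} : (bigOr l).Sat c ↔ ∃ p ∈ l, p.Sat c := by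
  induction l with
  | nil => simpa [bigOr] using not_sat_fls
  | cons p l ih => simp [bigOr, sat_or, ih]

/-- The hypothesis `0 ∈ V` pays for the empty disjunction: `fls` contains an atom on variable `0`.
-/
theorem vars_bigOr {l : List Psi} {V : Set ℕ} (h0 : 0 ∈ V) (h : ∀ p ∈ l, p.vars ⊆ V) :
    (bigOr l).vars ⊆ V := by
  induction l with
  | nil => simpa [bigOr, fls, tru, vars] using h0
  | cons p l ih =>
    exact Set.union_subset (h p (by simp)) (ih fun q hq => h q (by simp [hq]))

theorem isState_bigOr {l : List Psi} (h : ∀ p ∈ l, p.IsState) : (bigOr l).IsState := by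
  induction l with
  | nil => exact ⟨trivial, trivial⟩
  | cons p l ih => exact ⟨h p (by simp), ih fun q hq => h q (by simp [hq])⟩

end Psi

/-! ### Paths in the grid -/

/-- `(p n, q n)` is a path in the grid `ℕ × ℕ` that starts at the origin and in each step
increases one or both of the coordinates by one. -/
structure IsGridPath (p q : ℕ → ℕ) : Prop where
  fst_zero : p 0 = 0
  snd_zero : q 0 = 0
  step : ∀ n, (p (n + 1) = p n + 1 ∧ q (n + 1) = q n) ∨ (p (n + 1) = p n ∧ q (n + 1) = q n + 1) ∨
    (p (n + 1) = p n + 1 ∧ q (n + 1) = q n + 1)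

/-- The coordinates of a grid path are unbounded. -/
def IsFairPath (p q : ℕ → ℕ) : Prop := ∀ m, (∃ n, m ≤ p n) ∧ ∃ n, m ≤ q n

theorem isGridPath_count {t : Trajectory} (ht : t ∈ trajectories {0, 1}) :
    IsGridPath (t.count 0) (t.count 1) := by
  refine ⟨rfl, rfl, fun n => ?_⟩
  obtain ⟨⟨x, hx⟩, hsub⟩ := ht n
  simp only [Trajectory.count]
  by_cases h0 : 0 ∈ t n <;> by_cases h1 : 1 ∈ t n
  · simp [h0, h1]
  · simp [h0, h1]
  · simp [h0, h1]
  · rcases hsub hx with rfl | rfl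
    · exact absurd hx h0
    · exact absurd hx h1

theorem Trajectory.exists_le_count {t : Trajectory} {x : ℕ}
    (h : ∀ n, ∃ m, n ≤ m ∧ x ∈ t m) (k : ℕ) : ∃ n, k ≤ t.count x n := by
  induction k with
  | zero => exact ⟨0, le_rfl⟩
  | succ k ih =>
    obtain ⟨n, hn⟩ := ih
    obtain ⟨m, hm, hx⟩ := h n
    have mono : Monotone (t.count x) := monotone_nat_of_le_succ fun i => by
      simp [Trajectory.count]
    refine ⟨m + 1, ?_⟩
    have := mono hm
    simp only [Trajectory.count, hx, if_true]
    omega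

theorem isFairPath_count {t : Trajectory} (ht : t ∈ fairTrajectories {0, 1}) :
    IsFairPath (t.count 0) (t.count 1) := fun m =>
  ⟨Trajectory.exists_le_count (ht.2 0 (by simp)) m,
    Trajectory.exists_le_count (ht.2 1 (by simp)) m⟩

/-- The trajectory is read off from the increments of the path. Existence of trajectories is
therefore always shown by drawing a path. -/
theorem IsGridPath.exists_trajectory {p q : ℕ → ℕ} (h : IsGridPath p q) :
    ∃ t ∈ trajectories {0, 1}, t.count 0 = p ∧ t.count 1 = q ∧
      (IsFairPath p q → t ∈ fairTrajectories {0, 1}) := by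
  let t : Trajectory := fun n =>
    {x | (x = 0 ∧ p (n + 1) = p n + 1) ∨ (x = 1 ∧ q (n + 1) = q n + 1)}
  have ht : t ∈ trajectories {0, 1} := by
    intro n
    constructor
    · rcases h.step n with h | h | h
      · exact ⟨0, Or.inl ⟨rfl, h.1⟩⟩
      · exact ⟨1, Or.inr ⟨rfl, h.2⟩⟩
      · exact ⟨0, Or.inl ⟨rfl, h.1⟩⟩
    · rintro x (hx | hx) <;> simp [hx.1]
  have hp : t.count 0 = p := by
    funext n
    induction n with
    | zero => exact h.fst_zero.symm
    | succ n ih =>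
      have h0 : (0 ∈ t n) ↔ p (n + 1) = p n + 1 := by simp [t]
      rw [Trajectory.count, ih]
      split_ifs with hm
      · exact (h0.1 hm).symm
      · rcases h.step n with h' | h' | h'
        · exact absurd (h0.2 h'.1) hm
        · exact h'.1.symm
        · exact absurd (h0.2 h'.1) hm
  have hq : t.count 1 = q := by
    funext n
    induction n with
    | zero => exact h.snd_zero.symm
    | succ n ih =>
      have h0 : (1 ∈ t n) ↔ q (n + 1) = q n + 1 := by simp [t]
      rw [Trajectory.count, ih]
      split_ifs with hm
      · exact (h0.1 hm).symm
      · rcases h.step n with h' | h' | h'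
        · exact h'.2.symm
        · exact absurd (h0.2 h'.2) hm
        · exact absurd (h0.2 h'.2) hm
  refine ⟨t, ht, hp, hq, fun hf => ⟨ht, ?_⟩⟩
  -- A variable that no longer moves after time `n` has a constant count from then on, against
  -- unboundedness.
  have key : ∀ x n, (∀ m, ∃ k, m ≤ t.count x k) → ∃ m, n ≤ m ∧ x ∈ t m := by
    intro x n hx
    by_contra! hc
    obtain ⟨k, hk⟩ := hx (t.count x n + 1)
    have hconst : ∀ i, t.count x (n + i) = t.count x n := by
      intro i
      induction i with
      | zero => rfl
      | succ i ih =>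
        rw [← add_assoc, Trajectory.count, ih, if_neg (hc _ (by omega))]
        rfl
    have mono : Monotone (t.count x) := monotone_nat_of_le_succ fun i => by
      simp [Trajectory.count]
    have := mono (show k ≤ n + k by omega)
    rw [hconst] at this
    omega
  rintro x (rfl | rfl) n
  · exact key 0 n fun m => by simpa only [hp] using (hf m).1
  · exact key 1 n fun m => by simpa only [hq] using (hf m).2

/-- Increment by at most one in each step and unboundedness give surjectivity. -/
theorem exists_eq_of_step {p : ℕ → ℕ} (h0 : p 0 = 0) (hs : ∀ n, p (n + 1) ≤ p n + 1)
    (hu : ∀ m, ∃ n, m ≤ p n) (m : ℕ) : ∃ n, p n = m := by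
  classical
  have hex := hu m
  refine ⟨Nat.find hex, ?_⟩
  have h1 := Nat.find_spec hex
  rcases Nat.eq_zero_or_pos (Nat.find hex) with hz | hpos
  · rw [hz] at h1 ⊢
    omega
  -- Just before the first time with value at least `m` the value is below `m`, so a step of at most
  -- one lands on `m` exactly.
  · have h2 := Nat.find_min hex (Nat.sub_lt hpos one_pos)
    have h3 := hs (Nat.find hex - 1)
    rw [Nat.sub_add_cancel hpos] at h3
    omega

theorem IsGridPath.fst_le {p q : ℕ → ℕ} (h : IsGridPath p q) (n : ℕ) : p (n + 1) ≤ p n + 1 := by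
  rcases h.step n with h | h | h <;> omega

theorem IsGridPath.snd_le {p q : ℕ → ℕ} (h : IsGridPath p q) (n : ℕ) : q (n + 1) ≤ q n + 1 := by
  rcases h.step n with h | h | h <;> omega

end AHLTL

/-! ### Finite Kripke structures from successor lists; computability of the syntax -/

namespace AHLTL

/-! ### Kripke structures given by successor lists -/

/-- The code of the Kripke structure with state list `st`, initial states `ini`, successors `suc`
and labels `lab`. -/
def KripkeCode.ofGraph {σ : Type} [DecidableEq σ] (st : List σ) (ini : σ → Bool)
    (suc : σ → List σ) (lab : σ → List ℕ) : KripkeCode :=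
  st.map fun s => (ini s, (suc s).map fun s' => st.idxOf s', lab s)

section ofGraph

variable {σ : Type} [DecidableEq σ] {st : List σ} {ini : σ → Bool} {suc : σ → List σ}
  {lab : σ → List ℕ}

theorem KripkeCode.get_ofGraph (i : Fin (KripkeCode.ofGraph st ini suc lab).length)
    (hi : (i : ℕ) < st.length) : (KripkeCode.ofGraph st ini suc lab).get i =
      (ini st[(i : ℕ)], (suc st[(i : ℕ)]).map fun s' => st.idxOf s', lab st[(i : ℕ)]) := by
  exact List.getElem_map _

theorem KripkeCode.total_ofGraph (hc : ∀ s ∈ st, ∀ s' ∈ suc s, s' ∈ st)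
    (ht : ∀ s ∈ st, suc s ≠ []) : KripkeCode.Total (KripkeCode.ofGraph st ini suc lab) := by
  intro s
  have hs : (s : ℕ) < st.length := by simpa [KripkeCode.ofGraph] using s.2
  have hmem : st[(s : ℕ)] ∈ st := List.getElem_mem hs
  obtain ⟨s', hs'⟩ := List.exists_mem_of_ne_nil _ (ht _ hmem)
  refine ⟨⟨st.idxOf s', ?_⟩, ?_⟩
  · simpa [KripkeCode.ofGraph] using List.idxOf_lt_length_of_mem (hc _ hmem _ hs')
  · rw [KripkeCode.get_ofGraph _ hs]
    exact List.mem_map_of_mem hs'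

/-- Repetitions in `st` are harmless: edges lead to first occurrences only, and a repeated entry
carries the same data. Closure under successors makes `idxOf` invertible along paths. -/
theorem KripkeCode.traces_ofGraph (hc : ∀ s ∈ st, ∀ s' ∈ suc s, s' ∈ st)
    (h : KripkeCode.Total (KripkeCode.ofGraph st ini suc lab)) :
    (KripkeCode.toKripke _ h).traces =
      {τ | ∃ r : ℕ → σ, (r 0 ∈ st ∧ ini (r 0) = true) ∧ (∀ i, r (i + 1) ∈ suc (r i)) ∧
        ∀ i, τ i = {a | a ∈ lab (r i)}} := by
  have hlen : (KripkeCode.ofGraph st ini suc lab).length = st.length := by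
    simp [KripkeCode.ofGraph]
  ext τ
  constructor
  · rintro ⟨r, h0, hr, hl⟩
    have hlt : ∀ i, (r i : ℕ) < st.length := fun i => hlen ▸ (r i).2
    refine ⟨fun i => st[(r i : ℕ)]'(hlt i), ⟨List.getElem_mem _, ?_⟩, fun i => ?_, fun i => ?_⟩
    · have h1 : (List.get _ (r 0)).1 = true := h0
      rwa [KripkeCode.get_ofGraph _ (hlt 0)] at h1
    · have h1 : (r (i + 1) : ℕ) ∈ (List.get _ (r i)).2.1 := hr i
      rw [KripkeCode.get_ofGraph _ (hlt i), List.mem_map] at h1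
      obtain ⟨s', hs', he⟩ := h1
      have h2 : st[st.idxOf s']'(he ▸ hlt (i + 1)) = s' := List.getElem_idxOf _
      simp only [← he, h2]
      exact hs'
    · rw [hl]
      simp [KripkeCode.toKripke, KripkeCode.ofGraph]
  · rintro ⟨r, ⟨h0, h0'⟩, hr, hl⟩
    have hm : ∀ i, r i ∈ st := by
      intro i
      induction i with
      | zero => exact h0
      | succ i ih => exact hc _ ih _ (hr i)
    have hget : ∀ i, st[st.idxOf (r i)]'(List.idxOf_lt_length_of_mem (hm i)) = r i := fun i =>
      List.getElem_idxOf _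
    refine ⟨fun i => ⟨st.idxOf (r i), hlen ▸ List.idxOf_lt_length_of_mem (hm i)⟩, ?_, fun i => ?_,
      fun i => ?_⟩
    · change (List.get (KripkeCode.ofGraph st ini suc lab) _).1 = true
      rwa [KripkeCode.get_ofGraph _ (List.idxOf_lt_length_of_mem (hm 0)), hget]
    · change _ ∈ (List.get (KripkeCode.ofGraph st ini suc lab) _).2.1
      rw [KripkeCode.get_ofGraph _ (List.idxOf_lt_length_of_mem (hm i)), hget]
      exact List.mem_map_of_mem (hr i)
    · rw [hl]
      simp [KripkeCode.toKripke, KripkeCode.ofGraph, hget]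

end ofGraph

theorem KripkeCode.primrec_ofGraph {α σ : Type} [Primcodable α] [Primcodable σ] [DecidableEq σ]
    {st : α → List σ} {ini : α → σ → Bool} {suc : α → σ → List σ} {lab : α → σ → List ℕ}
    (hst : Primrec st) (hini : Primrec₂ ini) (hsuc : Primrec₂ suc) (hlab : Primrec₂ lab) :
    Primrec fun a => KripkeCode.ofGraph (st a) (ini a) (suc a) (lab a) := by
  refine Primrec.list_map hst ?_
  refine Primrec.pair hini (Primrec.pair (Primrec.list_map hsuc ?_) hlab)
  exact Primrec.list_idxOf.comp Primrec.snd (hst.comp (Primrec.fst.comp Primrec.fst))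

/-- Satisfaction of a formula `∀π₀. ∀π₁. E ψ` in terms of the two traces. -/
theorem KripkeCode.models_all_all {TRJ : Set ℕ → Set Trajectory} {c : KripkeCode}
    (h : KripkeCode.Total c) {p : Psi} :
    c.Models TRJ (.all 0 (.all 1 (.someTraj p))) ↔
      ∀ s₀ ∈ (KripkeCode.toKripke c h).traces, ∀ s₁ ∈ (KripkeCode.toKripke c h).traces,
        ∃ t ∈ TRJ {0, 1}, p.Sat (pairAssignment s₀ s₁ 0 0, t) := by
  simp only [KripkeCode.Models, h, Kripke.Models, Formula.Sat, bind_bind_empty,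
    dom_pairAssignment, exists_true_left]

/-! ### Computability of the syntax -/

namespace Psi

theorem primrec_of_enc {α : Type} [Primcodable α] {f : α → Psi}
    (h : Primrec fun a => (f a).enc) : Primrec f :=
  Primrec.encode_iff.1 h

theorem primrec_enc : Primrec Psi.enc := Primrec.encode

theorem primrec_five_mul : Primrec fun n : ℕ => 5 * n :=
  Primrec.nat_mul.comp (Primrec.const 5) Primrec.id

theorem primrec_atom : Primrec₂ atom :=
  primrec_of_enc (primrec_five_mul.comp (Primrec₂.natPair.comp Primrec.fst Primrec.snd))

theorem primrec_neg : Primrec neg :=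
  primrec_of_enc (Primrec.nat_add.comp (primrec_five_mul.comp primrec_enc) (Primrec.const 1))

theorem primrec_or : Primrec₂ or :=
  primrec_of_enc (Primrec.nat_add.comp (primrec_five_mul.comp
    (Primrec₂.natPair.comp (primrec_enc.comp Primrec.fst) (primrec_enc.comp Primrec.snd)))
    (Primrec.const 3))

theorem primrec_unt : Primrec₂ unt :=
  primrec_of_enc (Primrec.nat_add.comp (primrec_five_mul.comp
    (Primrec₂.natPair.comp (primrec_enc.comp Primrec.fst) (primrec_enc.comp Primrec.snd)))
    (Primrec.const 4))

theorem primrec_and : Primrec₂ and :=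
  primrec_neg.comp (primrec_or.comp (primrec_neg.comp Primrec.fst) (primrec_neg.comp Primrec.snd))

theorem primrec_imp : Primrec₂ imp :=
  primrec_or.comp (primrec_neg.comp Primrec.fst) Primrec.snd

theorem primrec_iff : Primrec₂ iff :=
  primrec_and.comp (primrec_imp.comp Primrec.fst Primrec.snd)
    (primrec_imp.comp Primrec.snd Primrec.fst)

theorem primrec_ev : Primrec ev := primrec_unt.comp (Primrec.const _) Primrec.id

theorem primrec_alw : Primrec alw := primrec_neg.comp (primrec_ev.comp primrec_neg)

theorem primrec_bigOr : Primrec bigOr := by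
  have h : Primrec fun l : List Psi => l.foldr (fun p q => or p q) fls :=
    Primrec.list_foldr Primrec.id (Primrec.const fls)
      (primrec_or.comp (Primrec.fst.comp Primrec.snd) (Primrec.snd.comp Primrec.snd)).to₂
  refine h.of_eq fun l => ?_
  induction l with
  | nil => rfl
  | cons p l ih => simp [bigOr, ← ih]

end Psi

namespace Formula

theorem primrec_of_enc {α : Type} [Primcodable α] {f : α → Formula}
    (h : Primrec fun a => (f a).enc) : Primrec f :=
  Primrec.encode_iff.1 h

theorem primrec_enc : Primrec Formula.enc := Primrec.encode

theorem primrec_someTraj : Primrec someTraj :=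
  primrec_of_enc (Primrec.nat_mul.comp (Primrec.const 4) Psi.primrec_enc)

theorem primrec_all : Primrec₂ all :=
  primrec_of_enc (Primrec.nat_add.comp (Primrec.nat_mul.comp (Primrec.const 4)
    (Primrec₂.natPair.comp Primrec.fst (primrec_enc.comp Primrec.snd))) (Primrec.const 3))

theorem primrec_all_all_someTraj : Primrec fun p => all 0 (all 1 (someTraj p)) :=
  primrec_all.comp (Primrec.const 0) (primrec_all.comp (Primrec.const 1) primrec_someTraj)

end Formula

theorem primrec_shape : Primrec₂ shape :=
  Formula.primrec_all_all_someTraj.comp (Psi.primrec_and.comp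
    (Psi.primrec_alw.comp Primrec.fst) (Psi.primrec_ev.comp Primrec.snd))

theorem wellFormed_shape {p q : Psi} (hp : p.vars ⊆ {0, 1}) (hq : q.vars ⊆ {0, 1}) :
    (shape p q).WellFormed := by
  refine ⟨by simp, by simp, fun x hx => ?_⟩
  have hp' := @hp x
  have hq' := @hq x
  simp only [Psi.and, Psi.alw, Psi.ev, Psi.tru, Psi.vars, Set.mem_union, Set.mem_singleton_iff,
    Set.mem_insert_iff, List.mem_cons, List.not_mem_nil] at *
  tauto

end AHLTL

/-! ### A finite one-tape machine with undecidable halting -/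

namespace AHLTL

/-! ### A Turing machine with an undecidable halting problem -/

/-- Binary increment, least significant bit first. -/
def incrBits : List Bool → List Bool
  | [] => [true]
  | false :: l => true :: l
  | true :: l => false :: incrBits l

theorem primrec_incrBits : Primrec incrBits := by
  have h : Primrec fun l : List Bool => (List.recOn l [true]
      fun b l ih => cond b (false :: ih) (true :: l) : List Bool) :=
    Primrec.list_rec (h := fun _ x => cond x.1 (false :: x.2.2) (true :: x.2.1))
      Primrec.id (Primrec.const _)
      (Primrec.cond (Primrec.fst.comp Primrec.snd)
        (Primrec.list_cons.comp (Primrec.const _)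
          (Primrec.snd.comp (Primrec.snd.comp Primrec.snd)))
        (Primrec.list_cons.comp (Primrec.const _)
          (Primrec.fst.comp (Primrec.snd.comp Primrec.snd)))).to₂
  refine h.of_eq fun l => ?_
  induction l with
  | nil => rfl
  | cons b l ih => cases b <;> simp_all [incrBits]

/-- The binary digits of a number, least significant bit first. -/
def bitList (n : ℕ) : List Bool := n.rec [] fun _ l => incrBits l

theorem primrec_bitList : Primrec bitList :=
  Primrec.nat_rec₁ _ (primrec_incrBits.comp Primrec.snd).to₂

open Turing Turing.PartrecToTM2

/-- A binary digit as a symbol of the stack alphabet of `PartrecToTM2`. -/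
def bitSymbol (b : Bool) : Turing.PartrecToTM2.Γ' := cond b Γ'.bit1 Γ'.bit0

/-- `trNat` passes through binary numerals; repeated increment of a bit list gives the same digits
in a visibly primitive recursive way. -/
theorem trNat_eq_map_bitList (n : ℕ) : trNat n = (bitList n).map bitSymbol := by
  -- Carry propagation for positive numerals; zero has no digits and is treated apart.
  have hpos : ∀ (p : PosNum) (l : List Bool), trPosNum p = l.map bitSymbol →
      trPosNum p.succ = (incrBits l).map bitSymbol := by
    intro p
    induction p with
    | one =>
      rintro (_ | ⟨b, l⟩) h
      · simp [trPosNum] at h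
      · cases b <;> cases l <;> simp_all [trPosNum, PosNum.succ, incrBits, bitSymbol]
    | bit0 p ih =>
      rintro (_ | ⟨b, l⟩) h
      · simp [trPosNum] at h
      · cases b <;> simp_all [trPosNum, PosNum.succ, incrBits, bitSymbol]
    | bit1 p ih =>
      rintro (_ | ⟨b, l⟩) h
      · simp [trPosNum] at h
      · cases b
        · simp [trPosNum, bitSymbol] at h
        · simp only [trPosNum, bitSymbol, List.map_cons, List.cons.injEq] at h
          simp [trPosNum, PosNum.succ, incrBits, bitSymbol, ih l h.2]
  induction n with
  | zero => simp [bitList]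
  | succ n ih =>
    rw [trNat, Nat.cast_succ, Num.add_one]
    rw [trNat] at ih
    change _ = (incrBits (bitList n)).map bitSymbol
    revert ih
    generalize (n : Num) = k
    intro ih
    cases k with
    | zero =>
      have : bitList n = [] := by simpa [trNum] using ih.symm
      rw [this]
      rfl
    | pos p => exact hpos p _ ih

/-- A cell in which only stack `k` has a symbol; `b` tells whether it is the bottom cell. -/
def stackCell {K : Type} [DecidableEq K] {Γ : K → Type} (b : Bool) (k : K) (a : Γ k) :
    TM2to1.Γ' K Γ :=
  (b, Function.update (fun _ => none) k (some a))

theorem trInit_of_reverse_eq {K : Type} [DecidableEq K] {Γ : K → Type} (k : K) {L r : List (Γ k)}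
    {a : Γ k} (h : L.reverse = a :: r) :
    TM2to1.trInit k L = stackCell true k a :: r.map (stackCell false k) := by
  unfold TM2to1.trInit
  rw [h]
  rfl

/-- The blank symbol is `default`, so a renaming of the alphabet has to preserve it; composing with
a transposition achieves this. -/
theorem exists_equiv_fin_default (Γ : Type) [Finite Γ] [Inhabited Γ] :
    ∃ (g : ℕ) (e : Γ ≃ Fin (g + 1)), e default = default := by
  obtain ⟨n, ⟨e⟩⟩ := Finite.exists_equiv_fin Γ
  obtain ⟨g, rfl⟩ : ∃ g, n = g + 1 :=
    Nat.exists_eq_succ_of_ne_zero fun h => by subst h; exact (e default).elim0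
  exact ⟨g, e.trans (Equiv.swap (e default) default), by simp⟩

/-- The state type of the compiled machine need not be finite, but its computations stay in a finite
support, so a left inverse on that support is enough. -/
theorem exists_equiv_fin_on {Λ : Type} [Inhabited Λ] (S : Finset Λ) (h : default ∈ S) :
    ∃ (s : ℕ) (f : Λ → Fin (s + 1)) (f' : Fin (s + 1) → Λ), f default = default ∧
      ∀ q ∈ S, f' (f q) = q := by
  classical
  let _ : Inhabited S := ⟨⟨default, h⟩⟩
  obtain ⟨s, e, he⟩ := exists_equiv_fin_default S
  refine ⟨s, fun q => if hq : q ∈ S then e ⟨q, hq⟩ else default, fun i => e.symm i, ?_, ?_⟩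
  · exact (dif_pos h).trans he
  · intro q hq
    simp [hq]

/-- Some finite Turing machine has an undecidable halting problem, for inputs that are computed
from natural numbers. -/
theorem exists_undecidable_machine :
    ∃ (g s : ℕ) (M : TM0.Machine (Fin (g + 1)) (Fin (s + 1))) (inp : ℕ → List (Fin (g + 1))),
      Primrec inp ∧
      ¬ ComputablePred fun m => (StateTransition.eval (TM0.step M) (TM0.init (inp m))).Dom := by
  classical
  -- The program with number `m` is run on the fixed input `0`; the machine for `c` is thus
  -- universal and receives `m` on its tape.
  have hpart : Partrec fun m => (Denumerable.ofNat Nat.Partrec.Code m).eval 0 :=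
    Nat.Partrec.Code.eval_part.comp (Computable.ofNat _) (Computable.const 0)
  obtain ⟨c, hc⟩ := ToPartrec.Code.exists_code (Nat.Partrec'.part_iff₁.2 hpart)
  -- Machines start in the default state, so the entry point of `c` is declared to be the default.
  let _ : Inhabited Turing.PartrecToTM2.Λ' := ⟨trNormal c Cont'.halt⟩
  let M₁ := TM2to1.tr PartrecToTM2.tr
  let M₀ := TM1to0.tr M₁
  have ss := TM1to0.tr_supports M₁ (TM2to1.tr_supports _ (PartrecToTM2.tr_supports c Cont'.halt))
  have : Finite (TM2to1.Γ' K' (fun _ => Turing.PartrecToTM2.Γ')) :=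
    let _ : Fintype K' := ⟨{K'.main, K'.rev, K'.aux, K'.stack}, fun k => by cases k <;> simp⟩
    @Finite.of_fintype _ TM2to1.Γ'.fintype
  obtain ⟨g, e, he⟩ := exists_equiv_fin_default (TM2to1.Γ' K' (fun _ => Turing.PartrecToTM2.Γ'))
  obtain ⟨s, f, f', hf, hf'⟩ := exists_equiv_fin_on _ (Finset.mem_coe.1 ss.1)
  let e₁ : PointedMap (TM2to1.Γ' K' (fun _ => Turing.PartrecToTM2.Γ')) (Fin (g + 1)) := ⟨e, he⟩
  let e₂ : PointedMap (Fin (g + 1)) (TM2to1.Γ' K' (fun _ => Turing.PartrecToTM2.Γ')) :=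
    ⟨e.symm, by rw [← he, e.symm_apply_apply]⟩
  let inp₀ : ℕ → List (TM2to1.Γ' K' (fun _ => Turing.PartrecToTM2.Γ')) := fun m =>
    TM2to1.trInit K'.main (trList [m])
  refine ⟨g, s, M₀.map e₁ e₂ f f', fun m => (inp₀ m).map e₁, ?_, ?_⟩
  · obtain ⟨a, b, hab⟩ : ∃ (a : Fin (g + 1)) (b : Bool → Fin (g + 1)),
        ∀ m, (inp₀ m).map e₁ = a :: (bitList m).reverse.map b := by
      refine ⟨e₁ (stackCell true K'.main Γ'.cons),
        fun x => e₁ (stackCell false K'.main (bitSymbol x)), fun m => ?_⟩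
      have h : (trList [m]).reverse = Γ'.cons :: (bitList m).reverse.map bitSymbol := by
        simp [trNat_eq_map_bitList]
      simp only [inp₀]
      rw [trInit_of_reverse_eq K'.main h, List.map_cons, List.map_map, List.map_map]
      rfl
    exact (Primrec.list_cons.comp (Primrec.const a) (Primrec.list_map
      (Primrec.list_reverse.comp primrec_bitList) ((Primrec.dom_finite b).comp
        Primrec.snd).to₂)).of_eq
      fun m => (hab m).symm
  · intro hcomp
    apply ComputablePred.halting_problem 0
    -- Halting is transported through the simulations: renamed machine, `TM0`, `TM1`, `TM2`, and the
    -- partial recursive code.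
    have key : ∀ m, (StateTransition.eval (TM0.step (M₀.map e₁ e₂ f f'))
        (TM0.init ((inp₀ m).map e₁))).Dom ↔
        ((Denumerable.ofNat Nat.Partrec.Code m).eval 0).Dom := by
      intro m
      have h1 := TM0.Machine.map_respects M₀ e₁ e₂ ⟨f, hf⟩ f' ss e.left_inv hf'
      have h2 := StateTransition.tr_eval_dom h1 (a₁ := TM0.init (inp₀ m)) ⟨ss.1, rfl⟩
      rw [TM0.map_init] at h2
      have h3 : (TM0.eval M₀ (inp₀ m)).Dom ↔ (TM1.eval M₁ (inp₀ m)).Dom := by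
        rw [TM1to0.tr_eval]
      have h4 := TM2to1.tr_eval_dom PartrecToTM2.tr K'.main (trList [m])
      have h5 : TM2.init K'.main (trList [m]) = PartrecToTM2.init c [m] := by
        have : Function.update (fun _ => []) K'.main (trList [m]) =
            K'.elim (trList [m]) [] [] [] := by
          funext k
          cases k <;> rfl
        rw [TM2.init, this]
        rfl
      have h6 := PartrecToTM2.tr_eval c [m]
      have h7 := hc (m ::ᵥ List.Vector.nil)
      rw [← h5] at h6
      have h8 : (TM2.eval PartrecToTM2.tr K'.main (trList [m])).Dom ↔
          (StateTransition.eval (TM2.step PartrecToTM2.tr)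
            (TM2.init K'.main (trList [m]))).Dom := Iff.rfl
      have h9 : ((List.Vector.cons m List.Vector.nil).1) = [m] := rfl
      rw [h9] at h7
      refine h2.trans (h3.trans (h4.trans (h8.trans ?_)))
      rw [h6, h7]
      rfl
    refine ComputablePred.computable_of_manyOneReducible
      ⟨Encodable.encode, Computable.encode, fun c => ?_⟩ (hcomp.of_eq key)
    rw [Denumerable.ofNat_encode]

end AHLTL

/-! ### Configurations at absolute tape positions and the three-cell update rule -/

namespace AHLTL

/-! ### Turing machines on absolute tapes -/

open Turing

/-- A configuration of a Turing machine with a head at an absolute position of the tape. -/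
structure AbsCfg (Γ Λ : Type) where
  q : Λ
  pos : ℤ
  tape : ℤ → Γ

namespace AbsCfg

variable {Γ Λ : Type} [Inhabited Λ] (M : TM0.Machine Γ Λ)

def Halted (c : AbsCfg Γ Λ) : Prop := M c.q (c.tape c.pos) = none

/-- One step; halted configurations do not change. -/
def step (c : AbsCfg Γ Λ) : AbsCfg Γ Λ :=
  match M c.q (c.tape c.pos) with
  | none => c
  | some (q', TM0.Stmt.move Dir.left) => ⟨q', c.pos - 1, c.tape⟩
  | some (q', TM0.Stmt.move Dir.right) => ⟨q', c.pos + 1, c.tape⟩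
  | some (q', TM0.Stmt.write a) => ⟨q', c.pos, Function.update c.tape c.pos a⟩

variable {M} in
theorem step_pos (c : AbsCfg Γ Λ) : (step M c).pos = c.pos ∨ (step M c).pos = c.pos - 1 ∨
    (step M c).pos = c.pos + 1 := by
  unfold step
  rcases hM : M c.q (c.tape c.pos) with _ | ⟨q', (_ | _) | a⟩ <;> simp

section init

variable [Inhabited Γ]

/-- The initial configuration on input `l`. -/
def init (l : List Γ) : AbsCfg Γ Λ :=
  ⟨default, 0, fun z => if 0 ≤ z then l.getI z.toNat else default⟩

/-- The configuration after `n` steps on input `l`. -/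
def run (l : List Γ) (n : ℕ) : AbsCfg Γ Λ := (step M)^[n] (init l)

theorem run_succ (l : List Γ) (n : ℕ) : run M l (n + 1) = step M (run M l n) :=
  Function.iterate_succ_apply' _ _ _

/-- Agreement with a configuration whose tape is relative to the head. -/
def Agrees (c : AbsCfg Γ Λ) (d : TM0.Cfg Γ Λ) : Prop :=
  d.q = c.q ∧ ∀ i, d.Tape.nth i = c.tape (c.pos + i)

theorem agrees_init (l : List Γ) : Agrees (init l : AbsCfg Γ Λ) (TM0.init l) := by
  refine ⟨rfl, fun i => ?_⟩
  rcases i with n | n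
  · simp [TM0.init, init, Tape.mk₁, Tape.mk₂, ListBlank.nth_mk]
  · simp [TM0.init, init, Tape.mk₁, Tape.mk₂, Tape.mk', Tape.nth, ListBlank.nth_mk]

variable {M}

theorem Agrees.step_eq_none {c : AbsCfg Γ Λ} {d : TM0.Cfg Γ Λ} (h : Agrees c d) :
    TM0.step M d = none ↔ c.Halted M := by
  have h0 : d.Tape.head = c.tape c.pos := by simpa using h.2 0
  obtain ⟨q, T⟩ := d
  have hq : q = c.q := h.1
  simp [TM0.step, Halted, ← hq, ← h0]

theorem Agrees.step_some {c : AbsCfg Γ Λ} {d d' : TM0.Cfg Γ Λ} (h : Agrees c d)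
    (hd : TM0.step M d = some d') : Agrees (step M c) d' := by
  have h0 : d.Tape.head = c.tape c.pos := by simpa using h.2 0
  obtain ⟨q, T⟩ := d
  have hq : q = c.q := h.1
  have hT : ∀ i, T.nth i = c.tape (c.pos + i) := h.2
  simp only [TM0.step] at hd
  simp only at h0
  rw [hq, h0] at hd
  unfold step
  rcases hM : M c.q (c.tape c.pos) with _ | ⟨q', (_ | _) | a⟩
  · simp [hM] at hd
  · simp only [hM, Option.map_some, Option.some.injEq] at hd
    subst hd
    refine ⟨rfl, fun i => ?_⟩
    simp only [Tape.move_left_nth, hT]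
    congr 1
    ring
  · simp only [hM, Option.map_some, Option.some.injEq] at hd
    subst hd
    refine ⟨rfl, fun i => ?_⟩
    simp only [Tape.move_right_nth, hT]
    congr 1
    ring
  · simp only [hM, Option.map_some, Option.some.injEq] at hd
    subst hd
    refine ⟨rfl, fun i => ?_⟩
    simp only [Tape.write_nth, hT, Function.update_apply]
    by_cases hi : i = 0 <;> simp [hi]

/-- The tape of `TM0` shifts under a fixed head; absolute positions are needed so that the same
column of consecutive rows means the same tape cell. -/
theorem eval_dom_iff (l : List Γ) :
    (StateTransition.eval (TM0.step M) (TM0.init l)).Dom ↔ ∃ n, (run M l n).Halted M := by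
  constructor
  · intro h
    obtain ⟨hr, hn⟩ := StateTransition.mem_eval.1 (Part.get_mem h)
    have : ∀ d, StateTransition.Reaches (TM0.step M) (TM0.init l) d →
        ∃ n, Agrees (run M l n) d := by
      intro d hd
      induction hd with
      | refl => exact ⟨0, agrees_init l⟩
      | tail _ hs ih =>
        obtain ⟨n, hn⟩ := ih
        exact ⟨n + 1, run_succ M l n ▸ hn.step_some hs⟩
    obtain ⟨n, hn'⟩ := this _ hr
    exact ⟨n, hn'.step_eq_none.1 hn⟩
  · rintro ⟨n, hn⟩
    -- `run` idles after halting whereas the `TM0` computation stops, hence the alternative that it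
    -- already stopped at some `m`.
    have : ∀ n, ∃ m d, StateTransition.Reaches (TM0.step M) (TM0.init l) d ∧
        Agrees (run M l m) d ∧ (m = n ∨ TM0.step M d = none) := by
      intro n
      induction n with
      | zero => exact ⟨0, _, Relation.ReflTransGen.refl, agrees_init l, Or.inl rfl⟩
      | succ n ih =>
        obtain ⟨m, d, hr, ha, rfl | hs⟩ := ih
        · rcases hs : TM0.step M d with _ | d'
          · exact ⟨m, d, hr, ha, Or.inr hs⟩
          · exact ⟨m + 1, d', hr.tail hs, run_succ M l m ▸ ha.step_some hs, Or.inl rfl⟩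
        · exact ⟨m, d, hr, ha, Or.inr hs⟩
    obtain ⟨m, d, hr, ha, hm⟩ := this n
    have hs : TM0.step M d = none := by
      rcases hm with rfl | hm
      · exact ha.step_eq_none.2 hn
      · exact hm
    exact Part.dom_iff_mem.2 ⟨d, StateTransition.mem_eval.2 ⟨hr, hs⟩⟩

theorem abs_run_pos_le (l : List Γ) (n : ℕ) : |(run M l n).pos| ≤ n := by
  induction n with
  | zero => simp [run, init]
  | succ n ih =>
    rw [run_succ]
    rw [abs_le] at *
    push_cast
    rcases step_pos (M := M) (run M l n) with h | h | h <;> rw [h] <;> constructor <;> linarith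

end init

/-! ### The local rule -/

/-- A tape cell: its symbol, and the state of the machine if the head is there. -/
abbrev Cell (Γ Λ : Type) : Type := Γ × Option Λ

/-- The content of the cell at `z`. -/
def cell (c : AbsCfg Γ Λ) (z : ℤ) : Cell Γ Λ := (c.tape z, if z = c.pos then some c.q else none)

/-- The state in which the head leaves the cell `a` in direction `d`, if it does. -/
def leaving (d : Dir) : Option (Cell Γ Λ) → Option Λ
  | some (γ, some q) =>
    match M q γ with
    | some (q', TM0.Stmt.move d') => if d' = d then some q' else none
    | _ => none
  | _ => none

/-- The content of a cell after a step, from the contents of the cell and its neighbours, where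
`none` is the border of the tape segment; the result is `none` if the head moves to the border. -/
def nextCell (a b c : Option (Cell Γ Λ)) : Option (Option (Cell Γ Λ)) :=
  match b with
  | none => some none
  | some (γ, none) =>
    some (some (γ, (leaving M Dir.right a).or (leaving M Dir.left c)))
  | some (γ, some q) =>
    match M q γ with
    | none => some (some (γ, some q))
    | some (q', TM0.Stmt.write γ') => some (some (γ', some q'))
    | some (_, TM0.Stmt.move Dir.left) => if a = none then none else some (some (γ, none))
    | some (_, TM0.Stmt.move Dir.right) => if c = none then none else some (some (γ, none))

variable {M}

theorem leaving_cell {c : AbsCfg Γ Λ} {z : ℤ} {d : Dir} {a : Option (Cell Γ Λ)}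
    (ha : a = some (c.cell z) ∨ a = none ∧ c.pos ≠ z) (q' : Λ) :
    leaving M d a = some q' ↔ c.pos = z ∧ M c.q (c.tape c.pos) = some (q', TM0.Stmt.move d) := by
  by_cases hz : z = c.pos
  · obtain rfl | h := ha
    · subst hz
      simp only [cell, leaving, if_true, true_and]
      rcases M c.q (c.tape c.pos) with _ | ⟨q'', d' | a⟩
      · simp
      · by_cases hd : d' = d <;> simp [hd]
      · simp
    · exact absurd hz.symm h.2
  · have : leaving M d a = none := by
      rcases ha with rfl | ⟨rfl, -⟩
      · simp [cell, hz, leaving]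
      · rfl
    simp [this, Ne.symm hz]

/-- A step changes only the cell under the head and possibly the neighbour that the head enters, so
three cells decide the new content. A missing neighbour does no harm unless the head moves there,
the only case without a result. -/
theorem nextCell_cell {c : AbsCfg Γ Λ} {z : ℤ} {a b : Option (Cell Γ Λ)}
    (ha : a = some (c.cell (z - 1)) ∨ a = none ∧ c.pos ≠ z - 1)
    (hb : b = some (c.cell (z + 1)) ∨ b = none ∧ c.pos ≠ z + 1) :
    (¬ (c.pos = z ∧ (a = none ∧ (step M c).pos = z - 1 ∨ b = none ∧ (step M c).pos = z + 1)) ∧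
      nextCell M a (some (c.cell z)) b = some (some ((step M c).cell z))) ∨
    (c.pos = z ∧ (a = none ∧ (step M c).pos = z - 1 ∨ b = none ∧ (step M c).pos = z + 1)) ∧
      nextCell M a (some (c.cell z)) b = none := by
  by_cases hz : z = c.pos
  · subst hz
    have h1 : c.pos ≠ c.pos - 1 := by omega
    have h2 : c.pos - 1 ≠ c.pos + 1 := by omega
    simp only [cell, nextCell, if_true, true_and]
    unfold step
    rcases hM : M c.q (c.tape c.pos) with _ | ⟨q', (_ | _) | γ⟩
    · simp [h1]
    · by_cases h : a = none <;> simp [h, h1, h2]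
    · by_cases h : b = none <;> simp [h, h2.symm]
    · simp [h1]
  · left
    refine ⟨fun h => hz h.1.symm, ?_⟩
    have h1 := fun q' => leaving_cell (M := M) (d := Dir.right) ha q'
    have h2 := fun q' => leaving_cell (M := M) (d := Dir.left) hb q'
    have hc : c.cell z = (c.tape z, none) := by simp [cell, hz]
    rw [hc]
    simp only [nextCell]
    congr 2
    have e1 : (step M c).tape z = c.tape z := by
      unfold step
      rcases hM : M c.q (c.tape c.pos) with _ | ⟨q', (_ | _) | γ⟩ <;> simp [hz]
    refine Prod.ext e1.symm ?_
    ext q'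
    simp only [Option.or_eq_some_iff, Option.eq_none_iff_forall_ne_some, ne_eq, h1, h2, cell]
    unfold step
    rcases hM : M c.q (c.tape c.pos) with _ | ⟨q'', (_ | _) | γ⟩
    · simp [hz]
    · simp only [Option.some.injEq, Prod.mk.injEq, TM0.Stmt.move.injEq, reduceCtorEq, and_false,
        false_or, not_false_eq_true, implies_true, true_and, and_true]
      have : z = c.pos - 1 ↔ c.pos = z + 1 := by omega
      by_cases h : c.pos = z + 1 <;> simp [this, h]
    · simp only [Option.some.injEq, Prod.mk.injEq, TM0.Stmt.move.injEq, reduceCtorEq, and_false,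
        or_false, and_true]
      have : z = c.pos + 1 ↔ c.pos = z - 1 := by omega
      by_cases h : c.pos = z - 1 <;> simp [this, h]
    · simp [hz]

/-! ### Rows -/

/-- The machine halts on the cell. -/
def HaltedCell (M : TM0.Machine Γ Λ) : Option (Cell Γ Λ) → Prop
  | some (γ, some q) => M q γ = none
  | _ => False

/-- The content of column `p` of a row that encodes `c`, with the origin of the tape in column
`o` and the border in column `0`. -/
def rowCell (c : AbsCfg Γ Λ) (o p : ℕ) : Option (Cell Γ Λ) :=
  if p = 0 then none else some (c.cell ((p : ℤ) - o))

theorem haltedCell_rowCell {c : AbsCfg Γ Λ} {o p : ℕ} (h : HaltedCell M (rowCell c o p)) :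
    c.Halted M ∧ c.pos = (p : ℤ) - o := by
  unfold rowCell at h
  split_ifs at h with hp
  · exact h.elim
  · by_cases hz : (p : ℤ) - o = c.pos
    · rw [hz] at h
      simp only [cell, if_true, HaltedCell] at h
      exact ⟨h, hz.symm⟩
    · simp [cell, hz, HaltedCell] at h

/-- Within the borders, the local rule computes the next row. -/
theorem nextCell_rowCell {c : AbsCfg Γ Λ} {o N p : ℕ} (hp : 1 ≤ p) (h1 : 1 ≤ c.pos + o)
    (h2 : c.pos + o < N) {a b : Option (Cell Γ Λ)} (hN : p < N) (ha : a = rowCell c o (p - 1))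
    (hb : b = if p + 1 = N then none else rowCell c o (p + 1)) :
    (nextCell M a (rowCell c o p) b = some (rowCell (c.step M) o p) ∧
      (c.pos = (p : ℤ) - o → 1 ≤ (c.step M).pos + o ∧ (c.step M).pos + o < N)) ∨
    nextCell M a (rowCell c o p) b = none ∧ c.pos = (p : ℤ) - o ∧
      ¬ (1 ≤ (c.step M).pos + o ∧ (c.step M).pos + o < N) := by
  have ha' : a = some (c.cell ((p : ℤ) - o - 1)) ∧ 1 < p ∨
      a = none ∧ p = 1 := by
    rw [ha, rowCell]
    split_ifs with h
    · right
      exact ⟨rfl, by omega⟩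
    · left
      refine ⟨?_, by omega⟩
      rw [Nat.cast_sub hp]
      congr 2
      push_cast
      ring
  have hb' : b = some (c.cell ((p : ℤ) - o + 1)) ∧ p + 1 < N ∨ b = none ∧ p + 1 = N := by
    rw [hb]
    split_ifs with h
    · exact Or.inr ⟨rfl, h⟩
    · left
      refine ⟨?_, by omega⟩
      rw [rowCell, if_neg (by omega)]
      congr 2
      push_cast
      ring
  have hrow : ∀ c : AbsCfg Γ Λ, rowCell c o p = some (c.cell ((p : ℤ) - o)) := fun c => by
    rw [rowCell, if_neg (by omega)]
  rw [hrow, hrow]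
  have hpos := step_pos (M := M) c
  rcases nextCell_cell (M := M) (c := c) (z := (p : ℤ) - o) (a := a) (b := b)
    (ha'.imp And.left fun h => ⟨h.1, by omega⟩) (hb'.imp And.left fun h => ⟨h.1, by omega⟩) with
    ⟨h3, h4⟩ | ⟨h3, h4⟩
  · left
    refine ⟨h4, fun h5 => ?_⟩
    simp only [h5, true_and, not_or, not_and] at h3
    obtain ⟨h6, h7⟩ := h3
    rcases ha' with ⟨ha', ha2⟩ | ⟨ha', ha2⟩ <;> rcases hb' with ⟨hb', hb2⟩ | ⟨hb', hb2⟩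
    · omega
    · have := h7 hb'
      omega
    · have := h6 ha'
      omega
    · have := h6 ha'
      have := h7 hb'
      omega
  · right
    refine ⟨h4, h3.1, ?_⟩
    rcases ha' with ⟨ha', ha2⟩ | ⟨ha', ha2⟩ <;> rcases hb' with ⟨hb', hb2⟩ | ⟨hb', hb2⟩ <;>
      rcases h3.2 with h6 | h6
    · simp [ha'] at h6
    · simp [hb'] at h6
    · simp [ha'] at h6
    · omega
    · omega
    · simp [hb'] at h6
    · omega
    · omega

end AbsCfg

end AHLTL

/-! ### The formula for label pairs and the structure of guessed computations -/

namespace AHLTL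

/-! ### State formulas for relations between one-hot labels -/

section relPsi

variable {L : Type} {enc : L → ℕ}

/-- The label of the first trace and the label of the second trace are a pair in `S`, where the
label `x` is represented by the single proposition `enc x`. -/
def relPsi (enc : L → ℕ) (S : List (L × L)) : Psi :=
  Psi.bigOr (S.map fun p => (Psi.atom (enc p.1) 0).and (Psi.atom (enc p.2) 1))

theorem isState_relPsi (S : List (L × L)) : (relPsi enc S).IsState := by
  apply Psi.isState_bigOr
  simp only [List.mem_map, forall_exists_index, and_imp]
  rintro _ p - rfl
  exact ⟨trivial, trivial⟩

theorem vars_relPsi (S : List (L × L)) : (relPsi enc S).vars ⊆ {0, 1} := by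
  apply Psi.vars_bigOr (by simp)
  simp only [List.mem_map, forall_exists_index, and_imp]
  rintro _ p - rfl
  simp [Psi.and, Psi.vars, Set.pair_comm]

/-- The trace of a label sequence. -/
def oneHot (enc : L → ℕ) (x : ℕ → L) : Trace := fun i => {a | a ∈ [enc (x i)]}

theorem sat_relPsi (henc : Function.Injective enc) {S : List (L × L)} {x y : ℕ → L} {i j : ℕ}
    {t : Trajectory} : (relPsi enc S).Sat (pairAssignment (oneHot enc x) (oneHot enc y) i j, t) ↔
      (x i, y j) ∈ S := by
  rw [relPsi, Psi.sat_bigOr]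
  simp only [List.mem_map]
  constructor
  · rintro ⟨_, ⟨p, hp, rfl⟩, hs⟩
    rw [Psi.sat_and, Psi.sat_atom_zero, Psi.sat_atom_one] at hs
    simp only [oneHot, List.mem_singleton, Set.mem_ofPred_eq, henc.eq_iff] at hs
    rwa [← hs.1, ← hs.2]
  · intro h
    refine ⟨_, ⟨_, h, rfl⟩, ?_⟩
    rw [Psi.sat_and, Psi.sat_atom_zero, Psi.sat_atom_one]
    simp [oneHot]

theorem sat_shape_relPsi (henc : Function.Injective enc) {S₁ S₂ : List (L × L)} {x y : ℕ → L}
    {t : Trajectory} :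
    ((Psi.alw (relPsi enc S₁)).and (Psi.ev (relPsi enc S₂))).Sat
        (pairAssignment (oneHot enc x) (oneHot enc y) 0 0, t) ↔
      (∀ n, (x (t.count 0 n), y (t.count 1 n)) ∈ S₁) ∧
        ∃ n, (x (t.count 0 n), y (t.count 1 n)) ∈ S₂ := by
  simp only [Psi.sat_and, Psi.sat_alw, Psi.sat_ev, succ_iterate_pairAssignment, sat_relPsi henc]

variable {TRJ : Set ℕ → Set Trajectory} {c : KripkeCode} {X : Set (ℕ → L)}

/-- One pair of sequences refutes the formula, and all grid paths are excluded, so only an upper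
bound on `TRJ` enters. -/
theorem not_models_shape_relPsi (henc : Function.Injective enc) {S₁ S₂ : List (L × L)}
    (h : c.Total) (hX : (c.toKripke h).traces = oneHot enc '' X)
    (hT : TRJ {0, 1} ⊆ trajectories {0, 1}) {x y : ℕ → L} (hx : x ∈ X) (hy : y ∈ X)
    (hxy : ∀ p q, IsGridPath p q → (∀ n, (x (p n), y (q n)) ∈ S₁) →
      ∀ n, (x (p n), y (q n)) ∉ S₂) :
    ¬ c.Models TRJ (shape (relPsi enc S₁) (relPsi enc S₂)) := by
  intro hm
  rw [shape, KripkeCode.models_all_all h, hX] at hm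
  obtain ⟨t, ht, hs⟩ := hm _ ⟨x, hx, rfl⟩ _ ⟨y, hy, rfl⟩
  rw [sat_shape_relPsi henc] at hs
  obtain ⟨h1, n, h2⟩ := hs
  exact hxy _ _ (isGridPath_count (hT ht)) h1 n h2

/-- The paths are required to be fair, so a lower bound on `TRJ` suffices. -/
theorem models_shape_relPsi (henc : Function.Injective enc) {S₁ S₂ : List (L × L)}
    (h : c.Total) (hX : (c.toKripke h).traces = oneHot enc '' X)
    (hT : fairTrajectories {0, 1} ⊆ TRJ {0, 1})
    (hxy : ∀ x ∈ X, ∀ y ∈ X, ∃ p q, IsGridPath p q ∧ IsFairPath p q ∧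
      (∀ n, (x (p n), y (q n)) ∈ S₁) ∧ ∃ n, (x (p n), y (q n)) ∈ S₂) :
    c.Models TRJ (shape (relPsi enc S₁) (relPsi enc S₂)) := by
  rw [shape, KripkeCode.models_all_all h, hX]
  rintro _ ⟨x, hx, rfl⟩ _ ⟨y, hy, rfl⟩
  obtain ⟨p, q, hg, hf, h1, h2⟩ := hxy x hx y hy
  obtain ⟨t, -, rfl, rfl, ht⟩ := hg.exists_trajectory
  exact ⟨t, hT (ht hf), (sat_shape_relPsi henc).2 ⟨h1, h2⟩⟩

end relPsi

/-! ### The Kripke structure of a Turing machine -/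

open Turing AbsCfg

/-- The states that do not depend on the input: the start, the border at the left end of the
input row, the blanks to the left of the input, the window of a cell and its neighbours in a row
of the computation (`first` marks the border of the first row), and the end. -/
inductive Node (Γ Λ : Type) : Type
  | start : Node Γ Λ
  | edge : Node Γ Λ
  | pad : Node Γ Λ
  | win (first : Bool) (a b c : Option (Cell Γ Λ)) : Node Γ Λ
  | bot : Node Γ Λ

/-- A state: the position modulo `6`, and a node or the rest of the input row. -/
abbrev State (Γ Λ : Type) : Type := Fin 6 × (Node Γ Λ ⊕ List (Cell Γ Λ))

theorem state_eq {Γ Λ : Type} {s : State Γ Λ} {X : Node Γ Λ ⊕ List (Cell Γ Λ)} (h : s.2 = X) :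
    s = (s.1, X) := Prod.ext rfl h

/-- The label of a state: of the rest of the input row only the first cell is visible. -/
abbrev Label (Γ Λ : Type) : Type := Fin 6 × (Node Γ Λ ⊕ Cell Γ Λ)

section graph

variable {Γ Λ : Type} [Inhabited Λ] (M : TM0.Machine Γ Λ)

/-- The cells of the input `l`, the head on the first one. -/
def inputCells [Inhabited Γ] (l : List Γ) : List (Cell Γ Λ) :=
  (l.headI, some default) :: l.tail.map fun a => (a, none)

/-- `inputCells` is non-empty even for the empty input, since the head must be shown; beyond it all
cells are blank and without head. -/
theorem cell_init [Inhabited Γ] (l : List Γ) (z : ℤ) : (AbsCfg.init l : AbsCfg Γ Λ).cell z =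
    if 0 ≤ z then (inputCells l).getD z.toNat (default, none) else (default, none) := by
  rcases z with n | n
  · rcases n with _ | n
    · cases l <;> simp [AbsCfg.init, cell, inputCells]
    · have h1 : ¬ (n : ℤ) + 1 = 0 := by omega
      have h2 : (0 : ℤ) ≤ n + 1 := by omega
      have h3 : ((n : ℤ) + 1).toNat = n + 1 := by omega
      rcases l with _ | ⟨a, l⟩
      · simp [AbsCfg.init, cell, inputCells, h1]
      · by_cases hn : n < l.length <;>
          simp [AbsCfg.init, cell, inputCells, h1, h2, h3, List.getI_eq_getElem?_getD, hn]
  · simp [AbsCfg.init, cell]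

/-- The exhausted input shows a blank, and the length of the rest is hidden. So the set of labels is
finite and independent of the input. -/
def labelOf [Inhabited Γ] : State Γ Λ → Label Γ Λ
  | (k, .inl n) => (k, .inl n)
  | (k, .inr l) => (k, .inr (l.headD (default, none)))

open Classical in
/-- The successors of a node, except those in the input row. -/
noncomputable def nodeSucc [Fintype Γ] [Fintype Λ] : Node Γ Λ → List (Node Γ Λ)
  | .start => [.edge]
  | .edge => [.pad]
  | .pad => [.pad]
  | .win _ _ b c => if HaltedCell M b then [.bot] else
      (Finset.univ : Finset (Option (Cell Γ Λ))).toList.map fun d => .win false b c d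
  | .bot => [.bot]

/-- The windows of the border of the first row of the computation, at position `3`. -/
noncomputable def firstWindows [Fintype Γ] [Fintype Λ] (k : Fin 6) : List (Node Γ Λ) :=
  if k = 3 then (Finset.univ : Finset (Option (Cell Γ Λ) × Option (Cell Γ Λ))).toList.map
    fun x => .win true x.1 none x.2 else []

open Classical in
/-- The successors of a state; `L` is the input. -/
noncomputable def stateSucc [Fintype Γ] [Fintype Λ] (L : List (Cell Γ Λ)) :
    State Γ Λ → List (State Γ Λ)
  | (k, .inl n) => (if n = .pad then [(k + 1, .inr L)] else []) ++
      (nodeSucc M n).map fun n' => (k + 1, .inl n')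
  | (k, .inr []) => (k + 1, .inr []) :: (firstWindows (k + 1)).map fun n' => (k + 1, .inl n')
  | (k, .inr (_ :: r)) => [(k + 1, .inr r)]

/-- The paths of the Kripke structure. -/
def IsRun [Fintype Γ] [Fintype Λ] (L : List (Cell Γ Λ)) (r : ℕ → State Γ Λ) : Prop :=
  r 0 = (0, .inl .start) ∧ ∀ i, r (i + 1) ∈ stateSucc M L (r i)

/-- The content of the row of a window. -/
def curCell : Node Γ Λ ⊕ Cell Γ Λ → Option (Option (Cell Γ Λ))
  | .inl (.win _ _ b _) => some b
  | _ => none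

/-- The content that the next row should have at the same place. -/
def nxtCell [Inhabited Γ] : Node Γ Λ ⊕ Cell Γ Λ → Option (Option (Cell Γ Λ))
  | .inl .edge => some none
  | .inl .pad => some (some (default, none))
  | .inl (.win _ a b c) => nextCell M a b c
  | .inr a => some (some a)
  | _ => none

/-- The pairs of labels that a trajectory may visit. After the start both traces move in every
step, and the distance of their positions modulo `6` is `0` (comparison of equal positions),
`2` (comparison of a row with the next one) or `4` (waiting for the end). -/
def Allowed (x y : Label Γ Λ) : Prop :=
  x.2 = .inl .start ∨
    ((y.1 : ℕ) = x.1 ∧ (x.2 = .inl .edge → y.2 = .inl .edge)) ∨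
    ((y.1 : ℕ) = (x.1 + 2) % 6 ∧ (x.2 = .inl .edge → ∃ a b c, y.2 = .inl (.win true a b c))) ∨
    ((y.1 : ℕ) = (x.1 + 4) % 6 ∧ x.2 ≠ .inl .bot)

/-- The pairs of labels that a trajectory should reach. -/
def Wrong [Inhabited Γ] (x y : Label Γ Λ) : Prop :=
  x.2 ≠ .inl .start ∧
    (((y.1 : ℕ) = x.1 ∧ x ≠ y) ∨
    ((y.1 : ℕ) = (x.1 + 2) % 6 ∧ y.2 ≠ .inl .bot ∧
      ¬ ∃ c, nxtCell M x.2 = some c ∧ curCell y.2 = some c) ∨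
    (y.1 : ℕ) = (x.1 + 4) % 6)

variable {M} [Fintype Γ] [Fintype Λ] {L : List (Cell Γ Λ)} {r : ℕ → State Γ Λ} {k : Fin 6}
  {s : State Γ Λ}

theorem mem_stateSucc_start : s ∈ stateSucc M L (k, .inl .start) ↔ s = (k + 1, .inl .edge) := by
  simp [stateSucc, nodeSucc]

theorem mem_stateSucc_edge : s ∈ stateSucc M L (k, .inl .edge) ↔ s = (k + 1, .inl .pad) := by
  simp [stateSucc, nodeSucc]

theorem mem_stateSucc_pad : s ∈ stateSucc M L (k, .inl .pad) ↔
    s = (k + 1, .inl .pad) ∨ s = (k + 1, .inr L) := by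
  simp [stateSucc, nodeSucc, or_comm]

theorem mem_stateSucc_bot : s ∈ stateSucc M L (k, .inl .bot) ↔ s = (k + 1, .inl .bot) := by
  simp [stateSucc, nodeSucc]

theorem mem_stateSucc_win {f : Bool} {a b c : Option (Cell Γ Λ)} :
    s ∈ stateSucc M L (k, .inl (.win f a b c)) ↔
      HaltedCell M b ∧ s = (k + 1, .inl .bot) ∨
        ¬ HaltedCell M b ∧ ∃ d, s = (k + 1, .inl (.win false b c d)) := by
  by_cases h : HaltedCell M b <;> simp [stateSucc, nodeSucc, h, eq_comm]

theorem mem_stateSucc_cons {a : Cell Γ Λ} {l : List (Cell Γ Λ)} :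
    s ∈ stateSucc M L (k, .inr (a :: l)) ↔ s = (k + 1, .inr l) := by
  simp [stateSucc]

theorem mem_stateSucc_nil : s ∈ stateSucc M L (k, .inr []) ↔ s = (k + 1, .inr []) ∨
    k + 1 = 3 ∧ ∃ a c, s = (k + 1, .inl (.win true a none c)) := by
  by_cases h : k + 1 = 3 <;> simp [stateSucc, firstWindows, h, eq_comm]

theorem fst_of_mem_stateSucc {s' : State Γ Λ} (h : s' ∈ stateSucc M L s) : s'.1 = s.1 + 1 := by
  obtain ⟨k, (_ | _ | _ | ⟨f, a, b, c⟩ | _) | _ | ⟨a, l⟩⟩ := s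
  · rw [mem_stateSucc_start] at h
    rw [h]
  · rw [mem_stateSucc_edge] at h
    rw [h]
  · rw [mem_stateSucc_pad] at h
    rcases h with h | h <;> rw [h]
  · rw [mem_stateSucc_win] at h
    rcases h with ⟨-, h⟩ | ⟨-, d, h⟩ <;> rw [h]
  · rw [mem_stateSucc_bot] at h
    rw [h]
  · rw [mem_stateSucc_nil] at h
    rcases h with h | ⟨-, a, c, h⟩ <;> rw [h]
  · rw [mem_stateSucc_cons] at h
    rw [h]

namespace IsRun

theorem fst_eq (h : IsRun M L r) (i : ℕ) : ((r i).1 : ℕ) = i % 6 := by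
  induction i with
  | zero => simp [h.1]
  | succ i ih =>
    rw [fst_of_mem_stateSucc (h.2 i), Fin.val_add, ih]
    simp

theorem one (h : IsRun M L r) : (r 1).2 = .inl .edge := by
  have h1 := h.2 0
  rw [h.1, mem_stateSucc_start] at h1
  rw [h1]

theorem of_edge (h : IsRun M L r) {i : ℕ} (hi : (r i).2 = .inl .edge) :
    (r (i + 1)).2 = .inl .pad := by
  have h1 := h.2 i
  rw [state_eq hi, mem_stateSucc_edge] at h1
  rw [h1]

theorem of_pad (h : IsRun M L r) {i : ℕ} (hi : (r i).2 = .inl .pad) :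
    (r (i + 1)).2 = .inl .pad ∨ (r (i + 1)).2 = .inr L := by
  have h1 := h.2 i
  rw [state_eq hi, mem_stateSucc_pad] at h1
  rcases h1 with h1 | h1 <;> simp [h1]

theorem of_cons (h : IsRun M L r) {i : ℕ} {a : Cell Γ Λ} {l : List (Cell Γ Λ)}
    (hi : (r i).2 = .inr (a :: l)) : (r (i + 1)).2 = .inr l := by
  have h1 := h.2 i
  rw [state_eq hi, mem_stateSucc_cons] at h1
  rw [h1]

/-- Because the first window is admitted only at counter 3, the input row has a length that is 2
modulo 6, the residue reserved for comparing consecutive rows. -/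
theorem of_nil (h : IsRun M L r) {i : ℕ} (hi : (r i).2 = .inr []) :
    (r (i + 1)).2 = .inr [] ∨
      i % 6 = 2 ∧ ∃ a c, (r (i + 1)).2 = .inl (.win true a none c) := by
  have h1 := h.2 i
  rw [state_eq hi, mem_stateSucc_nil] at h1
  rcases h1 with h1 | ⟨hk, a, c, h1⟩
  · simp [h1]
  · right
    have h2 := h.fst_eq (i + 1)
    rw [h1, hk] at h2
    refine ⟨?_, a, c, by rw [h1]⟩
    change 3 = _ at h2
    omega

theorem of_win (h : IsRun M L r) {i : ℕ} {f : Bool} {a b c : Option (Cell Γ Λ)}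
    (hi : (r i).2 = .inl (.win f a b c)) :
    HaltedCell M b ∨ ∃ d, (r (i + 1)).2 = .inl (.win false b c d) := by
  have h1 := h.2 i
  rw [state_eq hi, mem_stateSucc_win] at h1
  rcases h1 with h1 | ⟨-, d, h1⟩
  · exact Or.inl h1.1
  · exact Or.inr ⟨d, by rw [h1]⟩

/-- A run that reaches the end has an input row, which ends at a position that is `2` modulo `6`
and contains the input. -/
theorem exists_row (h : IsRun M L r) {i : ℕ} (hi : (r i).2 = .inl .bot) :
    ∃ N o, 1 ≤ o ∧ o + L.length < N ∧ N % 6 = 2 ∧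
      (∃ a c, (r (N + 1)).2 = .inl (.win true a none c)) ∧
      (∀ p, 1 ≤ p → p < o → (r (p + 1)).2 = .inl .pad) ∧
      ∀ p, o ≤ p → p < N → (r (p + 1)).2 = .inr (L.drop (p - o)) := by
  by_contra hc
  -- Without such a row the run would never leave the blanks and the input, so `bot` would be out of
  -- reach. The state at position `p + 1` belongs to column `p`.
  have key : ∀ i, 1 ≤ i → (∀ p, 1 ≤ p → p ≤ i → (r (p + 1)).2 = .inl .pad) ∨
      ∃ o, 1 ≤ o ∧ o ≤ i ∧ (∀ p, 1 ≤ p → p < o → (r (p + 1)).2 = .inl .pad) ∧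
        ∀ p, o ≤ p → p ≤ i → (r (p + 1)).2 = .inr (L.drop (p - o)) := by
    intro i hi
    induction i, hi using Nat.le_induction with
    | base =>
      left
      intro p h1 h2
      obtain rfl : p = 1 := by omega
      exact h.of_edge h.one
    | succ i hi ih =>
      rcases ih with ih | ⟨o, ho, hoi, hp, hd⟩
      · rcases h.of_pad (ih i hi le_rfl) with h1 | h1
        · left
          intro p hp1 hp2
          rcases Nat.lt_or_ge i p with hlt | hge
          · obtain rfl : p = i + 1 := by omega
            exact h1
          · exact ih p hp1 hge
        · right
          refine ⟨i + 1, by omega, le_rfl, fun p hp1 hp2 => ih p hp1 (by omega), ?_⟩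
          intro p hp1 hp2
          obtain rfl : p = i + 1 := by omega
          simpa using h1
      · right
        refine ⟨o, ho, by omega, hp, fun p hp1 hp2 => ?_⟩
        rcases Nat.lt_or_ge i p with hlt | hge
        · obtain rfl : p = i + 1 := by omega
          have h1 := hd i hoi le_rfl
          have hsub : i + 1 - o = (i - o) + 1 := by omega
          rcases hl : L.drop (i - o) with _ | ⟨a, l⟩
          · rw [hl] at h1
            rcases h.of_nil h1 with h2 | ⟨hmod, h2⟩
            · rw [h2, List.drop_eq_nil_of_le]
              have := List.drop_eq_nil_iff.1 hl
              omega
            · refine absurd ⟨i + 1, o, ho, ?_, by omega, h2, hp, fun p hp1 hp2 =>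
                hd p hp1 (by omega)⟩ hc
              have := List.drop_eq_nil_iff.1 hl
              omega
          · rw [hl] at h1
            rw [h.of_cons h1, hsub, ← List.drop_drop, hl]
            rfl
        · exact hd p hp1 hge
  rcases i with _ | _ | i
  · rw [h.1] at hi
    cases hi
  · rw [h.one] at hi
    cases hi
  · rcases key (i + 1) (by omega) with h1 | ⟨o, -, ho, -, h1⟩
    · rw [h1 (i + 1) (by omega) le_rfl] at hi
      cases hi
    · rw [h1 (i + 1) ho le_rfl] at hi
      cases hi

end IsRun

end graph

end AHLTL

/-! ### Consistent runs are halting computations, and conversely -/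

namespace AHLTL

open Turing AbsCfg

/-! ### Runs that encode halting computations -/

section encoding

variable {Γ Λ : Type} [Inhabited Γ] [Inhabited Λ] {M : TM0.Machine Γ Λ} {l : List Γ}
  {r : ℕ → State Γ Λ}

/-- In the row of the input, the next row is announced to be the initial configuration. -/
theorem nxtCell_input {N o p : ℕ} (hp : 1 ≤ p) (hpN : p < N)
    (hpad : ∀ p, 1 ≤ p → p < o → (r (p + 1)).2 = .inl .pad)
    (hin : ∀ p, o ≤ p → p < N → (r (p + 1)).2 = .inr ((inputCells l).drop (p - o))) :
    nxtCell M (labelOf (r (p + 1))).2 = some (rowCell (AbsCfg.init l : AbsCfg Γ Λ) o p) := by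
  rw [rowCell, if_neg (by omega), cell_init]
  rcases Nat.lt_or_ge p o with h | h
  · rw [state_eq (hpad p hp h), if_neg (by omega)]
    rfl
  · rw [state_eq (hin p h hpN), if_pos (by omega)]
    have : ((p : ℤ) - o).toNat = p - o := by omega
    simp [labelOf, nxtCell, this, List.headD_eq_head?_getD, List.getD_eq_getElem?_getD]

/-- If the rows of a run that reaches the end are consistent, then the machine halts. -/
theorem exists_halted_of_isRun [Fintype Γ] [Fintype Λ] (h : IsRun M (inputCells l) r) {i : ℕ}
    (hi : (r i).2 = .inl .bot)
    (hc : ∀ N, N % 6 = 2 → (∃ a c, (r (N + 1)).2 = .inl (.win true a none c)) → ∀ i, 1 ≤ i →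
      (r (i + N)).2 = .inl .bot ∨ ∃ c, nxtCell M (labelOf (r i)).2 = some c ∧
        curCell (labelOf (r (i + N))).2 = some c) : ∃ n, (run M l n).Halted M := by
  obtain ⟨N, o, ho, hoN, hN, hfirst, hpad, hin⟩ := h.exists_row hi
  have hlen : 1 ≤ (inputCells l : List (Cell Γ Λ)).length := by simp [inputCells]
  replace hc := hc N hN hfirst
  -- For a machine that never halts, every row is correct and is followed by a further window, so
  -- `bot` would never occur.
  by_contra! hnh
  -- A window of a non-halting configuration is followed by a window, whose content is dictated by
  -- the state one row earlier.
  have hstep : ∀ {i j k p}, (∃ f a d, (r i).2 = .inl (.win f a (rowCell (run M l k) o p) d)) →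
      1 ≤ j → j + N = i + 1 → ∃ b a d, nxtCell M (labelOf (r j)).2 = some b ∧
        (r (i + 1)).2 = .inl (.win false a b d) := by
    rintro i j k p ⟨f, a, d, hw⟩ h1 h2
    rcases h.of_win hw with h4 | ⟨d', h4⟩
    · exact absurd (haltedCell_rowCell h4).1 (hnh k)
    · have h5 := hc j h1
      rw [h2, state_eq h4] at h5
      obtain h5 | ⟨b, h5, h6⟩ := h5
      · cases h5
      · simp only [labelOf, curCell, Option.some.injEq] at h6
        exact ⟨b, _, d', h5, by rw [h4, h6]⟩
  -- Consecutive windows overlap in two cells, so the neighbours that a window records are the true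
  -- ones.
  have hwin : ∀ {i f a d k p f' a' b' d'},
      (r i).2 = .inl (.win f a (rowCell (run M l k) o p) d) →
      (r (i + 1)).2 = .inl (.win f' a' b' d') → a' = rowCell (run M l k) o p ∧ b' = d := by
    intro i f a d k p f' a' b' d' h1 h2
    rcases h.of_win h1 with h4 | ⟨d'', h4⟩
    · exact absurd (haltedCell_rowCell h4).1 (hnh k)
    · rw [h4] at h2
      simp only [Sum.inl.injEq, Node.win.injEq] at h2
      exact ⟨h2.2.1.symm, h2.2.2.1.symm⟩
  -- Configuration `k` fills positions `N * (k + 1) + 1` to `N * (k + 2)`, since positions `1` to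
  -- `N` hold the input row. The head is kept strictly inside the borders.
  have hrow : ∀ k, (∀ p, p < N → ∃ f a d,
      (r (N * (k + 1) + 1 + p)).2 = .inl (.win f a (rowCell (run M l k) o p) d)) ∧
      1 ≤ (run M l k).pos + o ∧ (run M l k).pos + o < N := by
    intro k
    induction k with
    | zero =>
      have h0 : (run M l 0).pos = 0 := rfl
      refine ⟨fun p => ?_, by omega, by omega⟩
      induction p with
      | zero =>
        obtain ⟨a, c, hf⟩ := hfirst
        exact fun _ => ⟨true, a, c, by simpa [rowCell] using hf⟩
      | succ p ih =>
        intro hp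
        obtain ⟨b, a, d, hb, hw⟩ := hstep (j := p + 1 + 1) (ih (by omega)) (by omega) (by ring)
        rw [nxtCell_input (by omega) hp hpad hin, Option.some.injEq] at hb
        exact ⟨false, a, d, by rw [← add_assoc, hw, ← hb]; rfl⟩
    | succ k ih =>
      obtain ⟨ihr, ih1, ih2⟩ := ih
      have hindex : N * (k + 1 + 1) + 1 = N * (k + 1) + 1 + (N - 1) + 1 := by
        rw [mul_add N (k + 1) 1]
        omega
      have hzero : ∃ f a d, (r (N * (k + 1 + 1) + 1)).2 = .inl (.win f a none d) := by
        obtain ⟨b, a, d, hb, hw⟩ := hstep (j := N * (k + 1) + 1) (ihr (N - 1) (by omega))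
          (by omega) (by omega)
        obtain ⟨f, a', d', h0⟩ := ihr 0 (by omega)
        rw [add_zero] at h0
        rw [state_eq h0] at hb
        simp only [labelOf, nxtCell, rowCell, if_true, nextCell, Option.some.injEq] at hb
        exact ⟨false, a, d, by rw [hindex, hw, hb]⟩
      have hall : ∀ p, p < N → (∃ f a d, (r (N * (k + 1 + 1) + 1 + p)).2 =
          .inl (.win f a (rowCell (run M l (k + 1)) o p) d)) ∧
          (1 ≤ p → (run M l k).pos = (p : ℤ) - o →
            1 ≤ (run M l (k + 1)).pos + o ∧ (run M l (k + 1)).pos + o < N) := by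
        intro p
        induction p with
        | zero => exact fun _ => ⟨by simpa [rowCell] using hzero, by omega⟩
        | succ p ih =>
          intro hp
          obtain ⟨b, a, d, hb, hw⟩ := hstep (j := N * (k + 1) + 1 + p + 1) (ih (by omega)).1
            (by omega) (by ring)
          obtain ⟨f₁, a₁, d₁, h₁⟩ := ihr p (by omega)
          obtain ⟨f₂, a₂, d₂, h₂⟩ := ihr (p + 1) hp
          rw [← add_assoc] at h₂
          have ha := (hwin h₁ h₂).1
          -- The right neighbour of the last column is the border that opens the following row.
          have hd : d₂ = if p + 1 + 1 = N then none else rowCell (run M l k) o (p + 1 + 1) := by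
            split_ifs with hpN
            · obtain ⟨f₃, a₃, d₃, h₃⟩ := hzero
              refine (hwin h₂ (f' := f₃) (a' := a₃) (b' := none) (d' := d₃) ?_).2.symm
              rw [← h₃, hindex, ← hpN]
              rfl
            · obtain ⟨f₃, a₃, d₃, h₃⟩ := ihr (p + 1 + 1) (by omega)
              rw [← add_assoc, ← add_assoc] at h₃
              exact (hwin h₂ h₃).2.symm
          rw [state_eq h₂] at hb
          simp only [labelOf, nxtCell] at hb
          rcases nextCell_rowCell (M := M) (p := p + 1) (by omega) ih1 ih2 hp
            (by simpa using ha) hd with ⟨h5, h6⟩ | ⟨h5, -⟩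
          · rw [hb, Option.some.injEq] at h5
            rw [run_succ, ← add_assoc]
            exact ⟨⟨false, a, d, by rw [hw, h5]⟩, fun _ => h6⟩
          · rw [hb] at h5
            cases h5
      refine ⟨fun p hp => (hall p hp).1, ?_⟩
      -- The bounds on the new head position are obtained in the column of the old one: had the head
      -- left the row, `nextCell` would have had no result there.
      exact (hall ((run M l k).pos + o).toNat (by omega)).2 (by omega) (by omega)
  -- every state after the first row is a window
  have hiN : N + 1 ≤ i := by
    by_contra hlt
    rcases Nat.lt_or_ge i 2 with h2 | h2
    · interval_cases i
      · rw [h.1] at hi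
        cases hi
      · rw [h.one] at hi
        cases hi
    · obtain ⟨p, rfl⟩ : ∃ p, i = p + 1 := ⟨i - 1, by omega⟩
      rcases Nat.lt_or_ge p o with hpo | hpo
      · rw [hpad p (by omega) hpo] at hi
        cases hi
      · rw [hin p hpo (by omega)] at hi
        cases hi
  have hdiv := Nat.div_add_mod (i - N - 1) N
  obtain ⟨f, a, d, hw⟩ := (hrow ((i - N - 1) / N)).1 ((i - N - 1) % N) (Nat.mod_lt _ (by omega))
  rw [mul_add, mul_one, show N * ((i - N - 1) / N) + N + 1 + (i - N - 1) % N = i by omega, hi] at hw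
  cases hw

section construction

variable (M l) (o N E : ℕ)

/-- The content at position `i` of the sequence of all rows. -/
def rowsCell (i : ℕ) : Option (Cell Γ Λ) :=
  rowCell (run M l ((i - 1) / N - 1)) o ((i - 1) % N)

/-- The state sequence that encodes the computation up to position `E`. -/
def computationRun (i : ℕ) : State Γ Λ :=
  (Fin.ofNat 6 i,
    if i = 0 then .inl .start else if i = 1 then .inl .edge else if i ≤ o then .inl .pad else
    if i ≤ N then .inr ((inputCells l).drop (i - 1 - o)) else
    if i ≤ E then .inl (.win (i = N + 1) (rowsCell M l o N (i - 1)) (rowsCell M l o N i)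
      (rowsCell M l o N (i + 1))) else .inl .bot)

variable {M l o N E}

theorem rowsCell_eq {i k p : ℕ} (hp : p < N) (hi : i = N * (k + 1) + p + 1) :
    rowsCell M l o N i = rowCell (run M l k) o p := by
  have h1 : i - 1 = p + N * (k + 1) := by omega
  rw [rowsCell, h1, Nat.add_mul_div_left _ _ (by omega), Nat.div_eq_of_lt hp,
    Nat.add_mul_mod_self_left, Nat.mod_eq_of_lt hp]
  simp

theorem isRun_computationRun [Fintype Γ] [Fintype Λ] (ho : 2 ≤ o)
    (hN : o + (inputCells l : List (Cell Γ Λ)).length < N)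
    (hN6 : N % 6 = 2) (hNE : N < E) (hE : HaltedCell M (rowsCell M l o N E))
    (hlt : ∀ i, N < i → i < E → ¬ HaltedCell M (rowsCell M l o N i)) :
    IsRun M (inputCells l) (computationRun M l o N E) := by
  have hk : ∀ i, Fin.ofNat 6 (i + 1) = Fin.ofNat 6 i + 1 := fun i => by
    apply Fin.ext
    simp [Fin.val_add]
  refine ⟨by simp [computationRun], fun i => ?_⟩
  unfold computationRun
  rw [hk]
  have h0 : ¬ i + 1 = 0 := by omega
  rw [if_neg h0]
  by_cases c0 : i = 0
  · subst c0
    simp [mem_stateSucc_start]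
  have h1 : ¬ i + 1 = 1 := by omega
  rw [if_neg c0, if_neg h1]
  by_cases c1 : i = 1
  · subst c1
    simp [mem_stateSucc_edge, ho]
  rw [if_neg c1]
  by_cases c2 : i ≤ o
  · rw [if_pos c2, mem_stateSucc_pad]
    by_cases c3 : i + 1 ≤ o
    · simp [c3]
    · have h3 : i - o = 0 := by omega
      have h4 : i + 1 ≤ N := by omega
      simp [c3, h3, h4]
  have h2 : ¬ i + 1 ≤ o := by omega
  rw [if_neg c2, if_neg h2]
  by_cases c3 : i ≤ N
  · rw [if_pos c3]
    have hsub : i + 1 - 1 - o = (i - 1 - o) + 1 := by omega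
    rcases hl : (inputCells l : List (Cell Γ Λ)).drop (i - 1 - o) with _ | ⟨a, r⟩
    · rw [mem_stateSucc_nil]
      by_cases c4 : i + 1 ≤ N
      · left
        rw [if_pos c4, hsub, ← List.drop_drop, hl]
        rfl
      · right
        obtain rfl : i = N := by omega
        refine ⟨?_, rowsCell M l o i (i + 1 - 1), rowsCell M l o i (i + 1 + 1), ?_⟩
        · rw [← hk]
          apply Fin.ext
          change (i + 1) % 6 = 3
          omega
        · rw [if_neg c4, if_pos (by omega), rowsCell_eq (i := i + 1) (k := 0) (p := 0) (by omega)
            (by omega)]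
          simp [rowCell]
    · have : ¬ (inputCells l : List (Cell Γ Λ)).length ≤ i - 1 - o := by
        rw [← List.drop_eq_nil_iff, hl]
        simp
      rw [mem_stateSucc_cons, if_pos (by omega), hsub, ← List.drop_drop, hl]
      rfl
  have h3 : ¬ i + 1 ≤ N := by omega
  rw [if_neg c3, if_neg h3]
  by_cases c4 : i ≤ E
  · rw [if_pos c4, mem_stateSucc_win]
    rcases Nat.lt_or_eq_of_le c4 with c5 | rfl
    · right
      have h6 : ¬ i = N := by omega
      refine ⟨hlt i (by omega) c5, rowsCell M l o N (i + 1 + 1), ?_⟩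
      rw [if_pos (by omega)]
      simp [h6]
    · left
      refine ⟨hE, ?_⟩
      rw [if_neg (by omega)]
  · have h4 : ¬ i + 1 ≤ E := by omega
    rw [if_neg c4, if_neg h4, mem_stateSucc_bot]

/-- The bound on `E` means that no row after row `T` is shown. Up to there the head stays off the
borders, so the local rule never fails. -/
theorem rows_computationRun {T : ℕ} (ho : 2 ≤ o) (hoN : o < N) (hE : E ≤ N * (T + 2))
    (hpos : ∀ k ≤ T, 1 ≤ (run M l k).pos + o ∧ (run M l k).pos + o < N) {i : ℕ} (hi : 1 ≤ i) :
    (computationRun M l o N E (i + N)).2 = .inl .bot ∨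
      ∃ c, nxtCell M (labelOf (computationRun M l o N E i)).2 = some c ∧
        curCell (labelOf (computationRun M l o N E (i + N))).2 = some c := by
  by_cases hiE : i + N ≤ E
  · right
    refine ⟨rowsCell M l o N (i + N), ?_, ?_⟩
    · by_cases hiN : i ≤ N
      · rw [rowsCell_eq (k := 0) (p := i - 1) (by omega) (by omega)]
        rcases Nat.eq_or_lt_of_le hi with rfl | hi2
        · simp [computationRun, labelOf, nxtCell, rowCell]
        · have := nxtCell_input (M := M) (l := l) (r := computationRun M l o N E) (N := N) (o := o)
            (p := i - 1) (by omega) (by omega) (fun p hp hpo => ?_) (fun p hp hpN => ?_)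
          · rwa [Nat.sub_add_cancel hi] at this
          · have h1 : ¬ p = 0 := by omega
            have h2 : p + 1 ≤ o := by omega
            simp [computationRun, h1, h2]
          · have h1 : ¬ p = 0 := by omega
            have h2 : ¬ p + 1 ≤ o := by omega
            have h3 : p + 1 ≤ N := by omega
            simp [computationRun, h1, h2, h3]
      · obtain ⟨k, p, hp, hik⟩ : ∃ k p, p < N ∧ i = N * (k + 1) + p + 1 := by
          refine ⟨(i - N - 1) / N, (i - N - 1) % N, Nat.mod_lt _ (by omega), ?_⟩
          have := Nat.div_add_mod (i - N - 1) N
          rw [mul_add]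
          omega
        have hkT : k + 1 ≤ T := by
          have h1 : N * (k + 2) < N * (T + 2) := by
            have : N * (k + 2) = N * (k + 1) + N := by ring
            omega
          have := Nat.lt_of_mul_lt_mul_left h1
          omega
        have h0 : ¬ i = 0 := by omega
        have h1 : ¬ i = 1 := by omega
        have h2 : ¬ i ≤ o := by omega
        have h3 : i ≤ E := by omega
        rw [rowsCell_eq (k := k + 1) hp (by rw [hik]; ring)]
        simp only [computationRun, h0, h1, h2, hiN, h3, if_true, if_false, labelOf, nxtCell]
        rw [rowsCell_eq hp hik]
        rcases Nat.eq_zero_or_pos p with rfl | hp1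
        · simp [rowCell, nextCell]
        · have hb : rowsCell M l o N (i + 1) =
              if p + 1 = N then none else rowCell (run M l k) o (p + 1) := by
            split_ifs with hpN
            · rw [rowsCell_eq (k := k + 1) (p := 0) (by omega)
                (by rw [hik, mul_add N (k + 1) 1]; omega)]
              rfl
            · exact rowsCell_eq (by omega) (by omega)
          have ha : rowsCell M l o N (i - 1) = rowCell (run M l k) o (p - 1) :=
            rowsCell_eq (by omega) (by omega)
          rcases nextCell_rowCell (M := M) hp1 (hpos k (by omega)).1 (hpos k (by omega)).2 hp
            ha hb with ⟨h4, -⟩ | ⟨-, -, h4⟩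
          · rw [h4, run_succ]
          · exact absurd (hpos (k + 1) hkT) (by rwa [run_succ])
    · have h0 : ¬ i + N = 0 := by omega
      have h1 : ¬ i + N = 1 := by omega
      have h2 : ¬ i + N ≤ o := by omega
      have h3 : ¬ i + N ≤ N := by omega
      simp only [computationRun, h0, h1, h2, h3, hiE, if_true, if_false, labelOf, curCell]
  · left
    have h0 : ¬ i + N = 0 := by omega
    have h1 : ¬ i + N = 1 := by omega
    have h2 : ¬ i + N ≤ o := by omega
    have h3 : ¬ i + N ≤ N := by omega
    simp only [computationRun, h0, h1, h2, h3, hiE, if_false]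

end construction

end encoding

end AHLTL

/-! ### Delays between two runs and the faults that they expose -/

namespace AHLTL

open Turing AbsCfg

/-! ### Grid paths for the two traces -/

/-- The path that waits for `d` steps with the first coordinate, and then moves both. -/
theorem isGridPath_delay (d : ℕ) : IsGridPath (fun n => n - d) fun n => n := by
  refine ⟨by simp, rfl, fun n => ?_⟩
  rcases Nat.lt_or_ge n d with h | h
  · right; left
    exact ⟨show n + 1 - d = n - d by omega, rfl⟩
  · right; right
    exact ⟨show n + 1 - d = n - d + 1 by omega, rfl⟩

theorem isFairPath_delay (d : ℕ) : IsFairPath (fun n => n - d) fun n => n := fun m =>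
  ⟨⟨m + d, by simp⟩, m, le_rfl⟩

section labels

variable {Γ Λ : Type} [Inhabited Γ]

theorem labelOf_fst (s : State Γ Λ) : (labelOf s).1 = s.1 := by
  rcases s with ⟨k, n | l⟩ <;> rfl

theorem labelOf_snd_eq_inl {s : State Γ Λ} {n : Node Γ Λ} :
    (labelOf s).2 = .inl n ↔ s.2 = .inl n := by
  rcases s with ⟨k, n | l⟩ <;> simp [labelOf]

variable [Inhabited Λ] [Fintype Γ] [Fintype Λ] {M : TM0.Machine Γ Λ} {l : List Γ}

theorem IsRun.fst_labelOf {r : ℕ → State Γ Λ} (h : IsRun M (inputCells l) r) (i : ℕ) :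
    ((labelOf (r i)).1 : ℕ) = i % 6 := by
  rw [labelOf_fst, h.fst_eq]

theorem IsRun.eq_zero {r : ℕ → State Γ Λ} (h : IsRun M (inputCells l) r) {i : ℕ}
    (hi : (r i).2 = .inl .start) : i = 0 := by
  rcases i with _ | i
  · rfl
  · have h1 := h.2 i
    rw [state_eq hi] at h1
    rcases hr : r i with ⟨k, (_ | _ | _ | ⟨f, a, b, c⟩ | _) | _ | ⟨a, r⟩⟩ <;> rw [hr] at h1 <;>
      simp [mem_stateSucc_start, mem_stateSucc_edge, mem_stateSucc_pad, mem_stateSucc_win,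
        mem_stateSucc_bot, mem_stateSucc_nil, mem_stateSucc_cons] at h1

theorem IsRun.eq_one {r : ℕ → State Γ Λ} (h : IsRun M (inputCells l) r) {i : ℕ}
    (hi : (r i).2 = .inl .edge) : i = 1 := by
  rcases i with _ | i
  · rw [h.1] at hi
    cases hi
  · have h1 := h.2 i
    rw [state_eq hi] at h1
    have h2 : (r i).2 = .inl .start := by
      rcases hr : r i with ⟨k, (_ | _ | _ | ⟨f, a, b, c⟩ | _) | _ | ⟨a, r⟩⟩ <;>
        rw [hr] at h1 <;>
        simp_all [mem_stateSucc_edge, mem_stateSucc_pad, mem_stateSucc_win,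
          mem_stateSucc_bot, mem_stateSucc_nil, mem_stateSucc_cons]
    rw [h.eq_zero h2]

/-- If the machine does not halt, then some fair path reaches a wrong pair. -/
theorem exists_path_of_not_halted (hM : ∀ n, ¬ (run M l n).Halted M) {r r' : ℕ → State Γ Λ}
    (h : IsRun M (inputCells l) r) (h' : IsRun M (inputCells l) r') :
    ∃ p q, IsGridPath p q ∧ IsFairPath p q ∧
      (∀ n, Allowed (labelOf (r (p n))) (labelOf (r' (q n)))) ∧
      ∃ n, Wrong M (labelOf (r (p n))) (labelOf (r' (q n))) := by
  by_contra hc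
  -- Every pair is allowed while the first trace waits at its start, so a delay is restricted only
  -- from then on.
  have hdelay : ∀ d, (∀ n, d < n → Allowed (labelOf (r (n - d))) (labelOf (r' n))) →
      ∀ i, 1 ≤ i → ¬ Wrong M (labelOf (r i)) (labelOf (r' (i + d))) := by
    intro d hd i hi hw
    refine hc ⟨_, _, isGridPath_delay d, isFairPath_delay d, fun n => ?_, i + d, by simpa using hw⟩
    rcases Nat.lt_or_ge d n with hn | hn
    · exact hd n hn
    · left
      rw [Nat.sub_eq_zero_of_le hn, h.1]
      rfl
  have hstart : ∀ i, 1 ≤ i → (labelOf (r i)).2 ≠ .inl .start := fun i hi he => by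
    have := h.eq_zero (labelOf_snd_eq_inl.1 he)
    omega
  -- A run without `bot` is exposed by delay 4: that distance is wrong at once and remains allowed
  -- as long as `bot` is not seen.
  obtain ⟨i, hi⟩ : ∃ i, (r i).2 = .inl .bot := by
    by_contra! hbot
    refine hdelay 4 (fun n hn => ?_) 1 le_rfl ⟨hstart 1 le_rfl, ?_⟩
    · right; right; right
      refine ⟨?_, fun he => hbot _ (labelOf_snd_eq_inl.1 he)⟩
      rw [h.fst_labelOf, h'.fst_labelOf]
      omega
    · right; right
      rw [h.fst_labelOf, h'.fst_labelOf]
  -- Delay 0 exposes any difference, so the second run may be replaced by the first from here on.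
  have heq : ∀ i, labelOf (r i) = labelOf (r' i) := by
    intro i
    rcases Nat.eq_zero_or_pos i with rfl | hi
    · rw [h.1, h'.1]
    · by_contra hne
      refine hdelay 0 (fun n hn => ?_) i hi ⟨hstart i hi, Or.inl ⟨?_, hne⟩⟩
      · right; left
        refine ⟨by rw [h.fst_labelOf, h'.fst_labelOf]; rfl, fun he => ?_⟩
        rw [labelOf_snd_eq_inl] at he ⊢
        obtain rfl : n = 1 := h.eq_one he
        exact h'.one
      · rw [h.fst_labelOf, h'.fst_labelOf]
        rfl
  -- Delay `N` exposes any inconsistency between rows. When the first trace is at `edge`, the second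
  -- is at the marked first window, which is what permits this delay.
  obtain ⟨n, hn⟩ := exists_halted_of_isRun h hi fun N hN hfirst i hi => by
    by_contra hne
    refine hdelay N (fun n hn => ?_) i hi ⟨hstart i hi, Or.inr (Or.inl ⟨?_, ?_⟩)⟩
    · right; right; left
      refine ⟨by rw [h.fst_labelOf, h'.fst_labelOf]; omega, fun he => ?_⟩
      obtain ⟨a, c, hw⟩ := hfirst
      have := h.eq_one (labelOf_snd_eq_inl.1 he)
      obtain rfl : n = N + 1 := by omega
      rw [← heq]
      exact ⟨a, none, c, labelOf_snd_eq_inl.2 hw⟩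
    · rw [h.fst_labelOf, h'.fst_labelOf]
      omega
    · rw [← heq, ne_eq, labelOf_snd_eq_inl, ← not_or]
      exact hne
  exact hM n hn

/-- If the machine halts, then for some run no path reaches a wrong pair. -/
theorem exists_run_of_halted (hM : ∃ n, (run M l n).Halted M) :
    ∃ r : ℕ → State Γ Λ, IsRun M (inputCells l) r ∧ ∀ p q, IsGridPath p q →
      (∀ n, Allowed (labelOf (r (p n))) (labelOf (r (q n)))) →
      ∀ n, ¬ Wrong M (labelOf (r (p n))) (labelOf (r (q n))) := by
  classical
  obtain ⟨T, hT, hmin⟩ : ∃ T, (run M l T).Halted M ∧ ∀ k < T, ¬ (run M l k).Halted M :=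
    ⟨Nat.find hM, Nat.find_spec hM, fun k hk => Nat.find_min hM hk⟩
  set m := (inputCells l : List (Cell Γ Λ)).length with hm
  -- The head moves at most `T` cells from the origin, so these values keep it off both borders. The
  -- input also fits, and `N` is 2 modulo 6 as required.
  obtain ⟨o, ho⟩ : ∃ o, o = T + 2 := ⟨_, rfl⟩
  obtain ⟨N, hN⟩ : ∃ N, N = 6 * (T + m + 1) + 2 := ⟨_, rfl⟩
  have hpos : ∀ k ≤ T, 1 ≤ (run M l k).pos + o ∧ (run M l k).pos + o < N := by
    intro k hk
    have := abs_le.1 (abs_run_pos_le (M := M) l k)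
    omega
  obtain ⟨e, he⟩ : ∃ e : ℕ, (e : ℤ) = (run M l T).pos + o :=
    ⟨((run M l T).pos + o).toNat, by have := hpos T le_rfl; omega⟩
  have heN : 1 ≤ e ∧ e < N := by
    have := hpos T le_rfl
    omega
  -- The position of the head, in column `e` of row `T`: the first place where a halting cell is
  -- shown.
  set E := N * (T + 1) + e + 1 with hE
  have hNE : N < E := by
    have : N * 1 ≤ N * (T + 1) := Nat.mul_le_mul_left _ (by omega)
    omega
  have hrun : IsRun M (inputCells l) (computationRun M l o N E) := by
    refine isRun_computationRun (by omega) (by omega) (by omega) hNE ?_ ?_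
    · rw [rowsCell_eq heN.2 hE, rowCell, if_neg (by omega)]
      have hz : (e : ℤ) - o = (run M l T).pos := by omega
      simpa [cell, hz, HaltedCell, Halted] using hT
    · intro i hi hiE hh
      obtain ⟨k, p, hp, hik⟩ : ∃ k p, p < N ∧ i = N * (k + 1) + p + 1 := by
        refine ⟨(i - N - 1) / N, (i - N - 1) % N, Nat.mod_lt _ (by omega), ?_⟩
        have := Nat.div_add_mod (i - N - 1) N
        rw [mul_add]
        omega
      rw [rowsCell_eq hp hik] at hh
      obtain ⟨h1, h2⟩ := haltedCell_rowCell hh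
      rcases Nat.lt_or_ge k T with hkT | hkT
      · exact hmin k hkT h1
      · rcases Nat.eq_or_lt_of_le hkT with rfl | hkT
        · omega
        · have : N * (T + 1 + 1) ≤ N * (k + 1) := Nat.mul_le_mul_left _ (by omega)
          rw [mul_add N (T + 1)] at this
          omega
  have hbot : ∀ i, E < i → (computationRun M l o N E i).2 = .inl .bot := by
    intro i hi
    have h0 : ¬ i = 0 := by omega
    have h1 : ¬ i = 1 := by omega
    have h2 : ¬ i ≤ o := by omega
    have h3 : ¬ i ≤ N := by omega
    have h4 : ¬ i ≤ E := by omega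
    simp [computationRun, h0, h1, h2, h3, h4]
  have hfirst : ∀ i f a b c, (computationRun M l o N E i).2 = .inl (.win f a b c) →
      f = true → i = N + 1 := by
    intro i f a b c hi hf
    simp only [computationRun] at hi
    split_ifs at hi <;> simp only [Sum.inl.injEq, Node.win.injEq, reduceCtorEq] at hi
    rw [hf] at hi
    exact of_decide_eq_true hi.1
  have hrows : ∀ i, 1 ≤ i → (computationRun M l o N E (i + N)).2 = .inl .bot ∨
      ∃ c, nxtCell M (labelOf (computationRun M l o N E i)).2 = some c ∧
        curCell (labelOf (computationRun M l o N E (i + N))).2 = some c := fun i hi =>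
    rows_computationRun (T := T) (by omega) (by omega)
      (by rw [hE, mul_add N T 2, mul_add N T 1]; omega) hpos hi
  refine ⟨_, hrun, ?_⟩
  generalize computationRun M l o N E = r at *
  intro p q hpq hall
  have hne : ∀ n, 1 ≤ p n → (labelOf (r (p n))).2 ≠ .inl .start := fun n hn he => by
    have := hrun.eq_zero (labelOf_snd_eq_inl.1 he)
    omega
  simp only [Allowed, hrun.fst_labelOf] at hall
  -- A step of only one trace would make the distance odd, so distance 4 persists until the first
  -- trace shows `bot`, where it is forbidden.
  have hlock : ∀ n, 1 ≤ p n → ¬ q n % 6 = (p n % 6 + 4) % 6 := by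
    intro n hn hq
    have hj : ∀ j, p (n + j) = p n + j ∧ q (n + j) % 6 = (p (n + j) % 6 + 4) % 6 := by
      intro j
      induction j with
      | zero => exact ⟨rfl, hq⟩
      | succ j ih =>
        rw [← add_assoc]
        have h1 := hpq.step (n + j)
        have h2 := hall (n + j + 1)
        have h3 := hne (n + j + 1) (by omega)
        simp only [h3, false_or] at h2
        omega
    have h1 := hall (n + (E + 1))
    have h2 := hj (E + 1)
    have h3 := hne (n + (E + 1)) (by omega)
    simp only [h3, false_or, labelOf_snd_eq_inl] at h1
    rcases h1 with h1 | h1 | ⟨-, h1⟩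
    · omega
    · omega
    · exact h1 (labelOf_snd_eq_inl.2 (hbot _ (by omega)))
  -- The delay is fixed when the first trace reaches `edge`: the second must be at its own unique
  -- `edge` or at its unique marked window at `N + 1`. Neither kind of delay meets a wrong pair,
  -- since the run equals itself and its rows are correct.
  have hinv : ∀ n, p n = 0 ∨ 1 ≤ p n ∧ (q n = p n ∨ q n = p n + N) := by
    intro n
    induction n with
    | zero => exact Or.inl hpq.fst_zero
    | succ n ih =>
      refine (Nat.eq_zero_or_pos (p (n + 1))).imp_right fun hp => ⟨hp, ?_⟩
      have h1 := hpq.step n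
      have h2 := hall (n + 1)
      simp only [hne (n + 1) hp, false_or, labelOf_snd_eq_inl] at h2
      have h3 := hlock (n + 1) hp
      rcases ih with ih | ⟨-, ih⟩
      · have h4 : p (n + 1) = 1 := by omega
        rw [h4] at h2 h3 ⊢
        rcases h2 with ⟨-, h2⟩ | ⟨-, h2⟩ | ⟨h2, -⟩
        · exact Or.inl (hrun.eq_one (h2 hrun.one))
        · obtain ⟨a, b, c, h2⟩ := h2 hrun.one
          have := hfirst _ _ _ _ _ h2 rfl
          omega
        · omega
      · omega
  intro n hw
  simp only [Wrong, hrun.fst_labelOf] at hw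
  rcases hinv n with h | ⟨h1, h | h⟩
  · rw [h, hrun.1] at hw
    exact hw.1 rfl
  · rw [h] at hw
    rcases hw with ⟨-, ⟨-, hw⟩ | ⟨hw, -⟩ | hw⟩
    · exact hw rfl
    · omega
    · omega
  · rw [h] at hw
    rcases hw with ⟨-, ⟨hw, -⟩ | ⟨-, hw, hw'⟩ | hw⟩
    · omega
    · rw [ne_eq, labelOf_snd_eq_inl] at hw
      exact (hrows _ h1).elim hw hw'
    · omega

end labels

end AHLTL

/-! ### Computability of the reduction from halting and undecidability -/

namespace AHLTL

open Turing AbsCfg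

/-! ### The reduction from the halting problem is computable -/

section codeOf

variable {Γ Λ : Type}

def Node.equiv : Node Γ Λ ≃
    Fin 4 ⊕ Bool × Option (Cell Γ Λ) × Option (Cell Γ Λ) × Option (Cell Γ Λ) where
  toFun
    | .start => .inl 0
    | .edge => .inl 1
    | .pad => .inl 2
    | .bot => .inl 3
    | .win f a b c => .inr (f, a, b, c)
  invFun
    | .inl 0 => .start
    | .inl 1 => .edge
    | .inl 2 => .pad
    | .inl 3 => .bot
    | .inr (f, a, b, c) => .win f a b c
  left_inv n := by cases n <;> rfl
  right_inv x := by
    rcases x with k | ⟨f, a, b, c⟩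
    · fin_cases k <;> rfl
    · rfl

noncomputable instance [Fintype Γ] [Fintype Λ] : Fintype (Node Γ Λ) :=
  Fintype.ofEquiv _ Node.equiv.symm

instance [Primcodable Γ] [Primcodable Λ] : Primcodable (Node Γ Λ) :=
  Primcodable.ofEquiv _ Node.equiv

variable [Inhabited Γ] [Inhabited Λ] [Fintype Γ] [Fintype Λ]

/-- The states that a run on the input `L` may visit. -/
noncomputable def states (L : List (Cell Γ Λ)) : List (State Γ Λ) :=
  ((Finset.univ : Finset (Fin 6 × Node Γ Λ)).toList.map fun x => (x.1, .inl x.2)) ++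
    (List.range (L.length + 1)).flatMap fun j =>
      (List.finRange 6).map fun k => (k, .inr (L.drop j))

theorem mem_states_inl {L : List (Cell Γ Λ)} (k : Fin 6) (n : Node Γ Λ) :
    (k, .inl n) ∈ states L := by
  simp [states]

theorem mem_states_inr {L l : List (Cell Γ Λ)} {k : Fin 6} :
    (k, .inr l) ∈ states L ↔ l <:+ L := by
  simp only [states, List.mem_append, List.mem_map, Finset.mem_toList, Finset.mem_univ, true_and,
    Prod.mk.injEq, reduceCtorEq, and_false, exists_false, false_or, List.mem_flatMap,
    List.mem_range, List.mem_finRange, Sum.inr.injEq, exists_eq_left]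
  constructor
  · rintro ⟨j, -, rfl⟩
    exact List.drop_suffix _ _
  · rintro ⟨l', rfl⟩
    exact ⟨l'.length, by simp, by simp⟩

variable (M : TM0.Machine Γ Λ)

theorem stateSucc_subset_states {L : List (Cell Γ Λ)} {s s' : State Γ Λ} (hs : s ∈ states L)
    (h : s' ∈ stateSucc M L s) : s' ∈ states L := by
  obtain ⟨k, n | (_ | ⟨a, l⟩)⟩ := s
  · simp only [stateSucc, List.mem_append, List.mem_map] at h
    rcases h with h | ⟨n', -, rfl⟩
    · split_ifs at h with hn
      · rw [List.mem_singleton] at h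
        rw [h, mem_states_inr]
      · simp at h
    · exact mem_states_inl _ _
  · rw [mem_stateSucc_nil] at h
    rcases h with rfl | ⟨-, a, c, rfl⟩
    · exact mem_states_inr.2 List.nil_suffix
    · exact mem_states_inl _ _
  · rw [mem_stateSucc_cons] at h
    rw [h, mem_states_inr]
    exact (List.suffix_cons a l).trans (mem_states_inr.1 hs)

theorem stateSucc_ne_nil (L : List (Cell Γ Λ)) (s : State Γ Λ) : stateSucc M L s ≠ [] := by
  obtain ⟨k, n | (_ | ⟨a, l⟩)⟩ := s
  · suffices h : nodeSucc M n ≠ [] by simp [stateSucc, h]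
    rcases n with _ | _ | _ | ⟨f, a, b, c⟩ | _ <;> simp only [nodeSucc, ne_eq, reduceCtorEq,
      not_false_eq_true]
    split_ifs
    · simp
    · simp [Finset.univ_eq_empty_iff]
  · simp [stateSucc]
  · simp [stateSucc]

variable [Primcodable Γ] [Primcodable Λ]

/-- For the fixed machine, everything except the remaining input ranges over finite types, where
every function is primitive recursive; the classical choices in `nodeSucc` do no harm. -/
theorem primrec_stateSucc : Primrec₂ (stateSucc M) := by
  classical
  have hfst : Primrec fun x : List (Cell Γ Λ) × State Γ Λ => x.2.1 + 1 :=
    (Primrec.dom_finite fun k : Fin 6 => k + 1).comp (Primrec.fst.comp Primrec.snd)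
  have hnode : Primrec₂ fun (x : List (Cell Γ Λ) × State Γ Λ) (n : Node Γ Λ) =>
      (if n = .pad then [(x.2.1 + 1, (.inr x.1 : Node Γ Λ ⊕ List (Cell Γ Λ)))] else []) ++
        (nodeSucc M n).map fun n' => (x.2.1 + 1, .inl n') := by
    refine Primrec.list_append.comp (Primrec.ite (Primrec.eq.comp Primrec.snd (Primrec.const _))
      (Primrec.list_cons.comp (Primrec.pair (hfst.comp Primrec.fst)
        (Primrec.sumInr.comp (Primrec.fst.comp Primrec.fst))) (Primrec.const []))
      (Primrec.const [])) (Primrec.list_map ((Primrec.dom_finite (nodeSucc M)).comp Primrec.snd) ?_)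
    exact Primrec.pair (hfst.comp (Primrec.fst.comp Primrec.fst))
      (Primrec.sumInl.comp Primrec.snd)
  have hnil : Primrec fun x : List (Cell Γ Λ) × State Γ Λ =>
      (x.2.1 + 1, (.inr [] : Node Γ Λ ⊕ List (Cell Γ Λ))) ::
        (firstWindows (x.2.1 + 1)).map fun n' => (x.2.1 + 1, .inl n') := by
    refine Primrec.list_cons.comp (Primrec.pair hfst (Primrec.const _))
      (Primrec.list_map ((Primrec.dom_finite _).comp hfst) ?_)
    exact Primrec.pair (hfst.comp Primrec.fst) (Primrec.sumInl.comp Primrec.snd)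
  have hrow : Primrec₂ fun (x : List (Cell Γ Λ) × State Γ Λ) (l : List (Cell Γ Λ)) =>
      (List.casesOn l ((x.2.1 + 1, (.inr [] : Node Γ Λ ⊕ List (Cell Γ Λ))) ::
        (firstWindows (x.2.1 + 1)).map fun n' => (x.2.1 + 1, .inl n'))
        fun _ r => [(x.2.1 + 1, .inr r)] : List (State Γ Λ)) := by
    have hcons : Primrec₂ fun (x : (List (Cell Γ Λ) × State Γ Λ) × List (Cell Γ Λ))
        (y : Cell Γ Λ × List (Cell Γ Λ)) =>
        [(x.1.2.1 + 1, (.inr y.2 : Node Γ Λ ⊕ List (Cell Γ Λ)))] :=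
      Primrec.list_cons.comp (Primrec.pair (hfst.comp (Primrec.fst.comp Primrec.fst))
        (Primrec.sumInr.comp (Primrec.snd.comp Primrec.snd))) (Primrec.const [])
    exact Primrec.list_casesOn Primrec.snd (hnil.comp Primrec.fst) hcons
  refine (Primrec.sumCasesOn (Primrec.snd.comp Primrec.snd) hnode hrow).of_eq ?_
  rintro ⟨L, k, n | (_ | ⟨a, l⟩)⟩
  · simp only [stateSucc]
  · rfl
  · rfl

theorem primrec_states : Primrec (states : List (Cell Γ Λ) → List (State Γ Λ)) := by
  refine Primrec.list_append.comp (Primrec.const _) (Primrec.list_flatMap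
    (Primrec.list_range.comp (Primrec.succ.comp Primrec.list_length))
    (Primrec.list_map (Primrec.const _) (Primrec.pair Primrec.snd (Primrec.sumInr.comp
      (Primrec.list_drop.comp (Primrec.snd.comp Primrec.fst) (Primrec.fst.comp Primrec.fst))))))

theorem primrec_labelOf : Primrec (labelOf : State Γ Λ → Label Γ Λ) := by
  have h : Primrec fun s : State Γ Λ => (s.1, (Sum.casesOn s.2 (fun n => Sum.inl n)
      fun l => Sum.inr (l.head?.getD (default, none)) : Node Γ Λ ⊕ Cell Γ Λ)) :=
    Primrec.pair Primrec.fst (Primrec.sumCasesOn Primrec.snd (Primrec.sumInl.comp Primrec.snd)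
      (Primrec.sumInr.comp (Primrec.option_getD.comp (Primrec.list_head?.comp Primrec.snd)
        (Primrec.const _))))
  refine h.of_eq ?_
  rintro ⟨k, n | (_ | ⟨a, l⟩)⟩ <;> rfl

theorem primrec_inputCells :
    Primrec (inputCells : List Γ → List (Cell Γ Λ)) :=
  Primrec.list_cons.comp (Primrec.pair Primrec.list_headI (Primrec.const _))
    (Primrec.list_map Primrec.list_tail (Primrec.pair Primrec.snd (Primrec.const _)))

open Classical in
/-- The Kripke structure for the input `l`. -/
noncomputable def machineCode (l : List Γ) : KripkeCode :=
  KripkeCode.ofGraph (states (inputCells l)) (fun s => decide (s = (0, .inl .start)))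
    (stateSucc M (inputCells l)) fun s => [Encodable.encode (labelOf s)]

theorem primrec_machineCode : Primrec (machineCode M) := by
  classical
  refine KripkeCode.primrec_ofGraph (primrec_states.comp primrec_inputCells) ?_
    ((primrec_stateSucc M).comp (primrec_inputCells.comp Primrec.fst) Primrec.snd) ?_
  · exact (Primrec.eq.comp Primrec.snd (Primrec.const _)).decide
  · exact Primrec.list_cons.comp (Primrec.encode.comp (primrec_labelOf.comp Primrec.snd))
      (Primrec.const [])

theorem total_machineCode (l : List Γ) : (machineCode M l).Total :=
  open Classical in
  KripkeCode.total_ofGraph (fun _ hs _ h => stateSucc_subset_states M hs h)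
    fun s _ => stateSucc_ne_nil M _ s

theorem traces_machineCode (l : List Γ) :
    (KripkeCode.toKripke _ (total_machineCode M l)).traces =
      oneHot Encodable.encode ''
        {x | ∃ r, IsRun M (inputCells l) r ∧ x = fun i => labelOf (r i)} := by
  classical
  refine (KripkeCode.traces_ofGraph (fun _ hs _ h => stateSucc_subset_states M hs h)
    (total_machineCode M l)).trans ?_
  ext τ
  constructor
  · rintro ⟨r, ⟨-, h0⟩, hs, hτ⟩
    exact ⟨_, ⟨r, ⟨of_decide_eq_true h0, hs⟩, rfl⟩, funext fun i => (hτ i).symm⟩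
  · rintro ⟨_, ⟨r, ⟨h0, hs⟩, rfl⟩, rfl⟩
    exact ⟨r, ⟨h0 ▸ mem_states_inl _ _, decide_eq_true h0⟩, hs, fun _ => rfl⟩

open Classical in
/-- The pairs of labels that satisfy `p`, as a list. -/
noncomputable def pairsOf (p : Label Γ Λ → Label Γ Λ → Prop) : List (Label Γ Λ × Label Γ Λ) :=
  (Finset.univ.filter fun x => p x.1 x.2).toList

theorem mem_pairsOf {p : Label Γ Λ → Label Γ Λ → Prop} {x y : Label Γ Λ} :
    (x, y) ∈ pairsOf p ↔ p x y := by
  simp [pairsOf]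

theorem models_machineCode_iff {TRJ : Set ℕ → Set Trajectory}
    (hT : TRJ = trajectories ∨ TRJ = fairTrajectories) (l : List Γ) :
    (machineCode M l).Models TRJ (shape
      (relPsi Encodable.encode (pairsOf (Allowed : Label Γ Λ → Label Γ Λ → Prop)))
      (relPsi Encodable.encode (pairsOf (Wrong M)))) ↔
      ¬ (StateTransition.eval (TM0.step M) (TM0.init l)).Dom := by
  have hT1 : TRJ {0, 1} ⊆ trajectories {0, 1} := by
    rcases hT with rfl | rfl
    · exact subset_rfl
    · exact fun t ht => ht.1
  have hT2 : fairTrajectories {0, 1} ⊆ TRJ {0, 1} := by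
    rcases hT with rfl | rfl
    · exact fun t ht => ht.1
    · exact subset_rfl
  rw [eval_dom_iff]
  constructor
  · intro hm hh
    obtain ⟨r, hr, h⟩ := exists_run_of_halted hh
    refine not_models_shape_relPsi Encodable.encode_injective (total_machineCode M l)
      (traces_machineCode M l) hT1 ⟨r, hr, rfl⟩ ⟨r, hr, rfl⟩ ?_ hm
    simpa only [mem_pairsOf] using h
  · intro hh
    refine models_shape_relPsi Encodable.encode_injective (total_machineCode M l)
      (traces_machineCode M l) hT2 ?_
    rintro _ ⟨r, hr, rfl⟩ _ ⟨r', hr', rfl⟩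
    simpa only [mem_pairsOf] using exists_path_of_not_halted (not_exists.1 hh) hr hr'

end codeOf

/-- The halting problem reduces to the complement of the model checking problem. -/
theorem exists_reduction : ∃ (p q : Psi) (f : ℕ → KripkeCode) (H : ℕ → Prop),
    (p.IsState ∧ p.vars ⊆ {0, 1}) ∧ (q.IsState ∧ q.vars ⊆ {0, 1}) ∧ Primrec f ∧
    ¬ ComputablePred H ∧ (∀ n, (f n).Total) ∧ ∀ TRJ : Set ℕ → Set Trajectory,
      TRJ = trajectories ∨ TRJ = fairTrajectories →
        ∀ n, (f n).Models TRJ (shape p q) ↔ ¬ H n := by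
  obtain ⟨g, s, M, inp, hinp, hH⟩ := exists_undecidable_machine
  exact ⟨_, _, fun n => machineCode M (inp n), _, ⟨isState_relPsi _, vars_relPsi _⟩,
    ⟨isState_relPsi _, vars_relPsi _⟩, (primrec_machineCode M).comp hinp, hH,
    fun n => total_machineCode M _, fun TRJ hT n => models_machineCode_iff M hT _⟩

theorem computablePred_of_not_iff {H : ℕ → Prop} {f : ℕ → Bool} (hf : Computable f)
    (h : ∀ n, f n = true ↔ ¬ H n) : ComputablePred H := by
  refine ComputablePred.computable_iff.2 ⟨fun n => !f n, Primrec.not.to_comp.comp hf, ?_⟩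
  funext n
  simp [← Bool.not_eq_true, h]

/-- The state formulas come from the machine alone, so the instances vary only in the structure. -/
theorem not_decidableOn_models_shape {TRJ : Set ℕ → Set Trajectory}
    (hT : TRJ = trajectories ∨ TRJ = fairTrajectories) :
    ¬ DecidableOn (fun x : KripkeCode × Psi × Psi => KripkeCode.Total x.1 ∧
        (x.2.1.IsState ∧ x.2.1.vars ⊆ {0, 1}) ∧ (x.2.2.IsState ∧ x.2.2.vars ⊆ {0, 1}))
      (fun x => KripkeCode.Models TRJ x.1 (shape x.2.1 x.2.2)) := by
  rintro ⟨d, hd, h⟩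
  obtain ⟨p, q, f, H, hp, hq, hf, hH, htot, hm⟩ := exists_reduction
  refine hH (computablePred_of_not_iff
    (hd.comp (hf.to_comp.pair (Computable.const (p, q)))) fun n => ?_)
  exact (h _ ⟨htot n, hp, hq⟩).trans (hm TRJ hT n)

theorem not_decidableOn_models {TRJ : Set ℕ → Set Trajectory}
    (hT : TRJ = trajectories ∨ TRJ = fairTrajectories) :
    ¬ DecidableOn (fun x : KripkeCode × Formula => KripkeCode.Total x.1 ∧ x.2.WellFormed)
      (fun x => KripkeCode.Models TRJ x.1 x.2) := by
  rintro ⟨d, hd, h⟩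
  refine not_decidableOn_models_shape hT ⟨fun x => d (x.1, shape x.2.1 x.2.2), ?_, fun x hx => ?_⟩
  · exact hd.comp (Computable.fst.pair (primrec_shape.to_comp.comp
      (Computable.fst.comp Computable.snd) (Computable.snd.comp Computable.snd)))
  · exact h (_, _) ⟨hx.1, wellFormed_shape hx.2.1.2 hx.2.2.2⟩

end AHLTL

/-! ### Matching the marks of two sequences by asynchronous paths -/

namespace AHLTL

/-! ### Paths that synchronize the marked positions of two sequences -/

/-- The positions where a sequence is marked. -/
abbrev IsMarked {β : Type} (X : ℕ → Option β) (i : ℕ) : Prop := (X i).isSome = true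

/-- Infinitely many positions are marked, but not the first one and no two adjacent ones. -/
structure IsSparse {β : Type} (X : ℕ → Option β) : Prop where
  zero : ¬ IsMarked X 0
  succ : ∀ i, IsMarked X i → ¬ IsMarked X (i + 1)
  infinite : {i | IsMarked X i}.Infinite

/-- The path visits marked positions of both sequences at the same time. -/
def IsSynced {β : Type} (X Y : ℕ → Option β) (p q : ℕ → ℕ) : Prop :=
  ∀ n, IsMarked X (p n) ↔ IsMarked Y (q n)

section sync

variable {β : Type} {X Y : ℕ → Option β} {p q : ℕ → ℕ}

/-- If one coordinate alone left a mark, it would reach an unmarked position by sparsity while the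
other remained on a mark. So marks are left jointly and the counts stay equal. -/
theorem IsSynced.count_eq (h : IsSynced X Y p q) (hg : IsGridPath p q) (hX : IsSparse X)
    (hY : IsSparse Y) (n : ℕ) : Nat.count (IsMarked X) (p n) = Nat.count (IsMarked Y) (q n) := by
  induction n with
  | zero => rw [hg.fst_zero, hg.snd_zero, Nat.count_zero, Nat.count_zero]
  | succ n ih =>
    have h0 := h n
    have h1 := h (n + 1)
    rcases hg.step n with ⟨hp, hq⟩ | ⟨hp, hq⟩ | ⟨hp, hq⟩
    · have hn : ¬ IsMarked X (p n) := fun hm => hX.succ _ hm (by rwa [← hp, h1, hq, ← h0])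
      rw [hp, hq, Nat.count_succ, if_neg hn, ih, add_zero]
    · have hn : ¬ IsMarked Y (q n) := fun hm => hY.succ _ hm (by rwa [← hq, ← h1, hp, h0])
      rw [hp, hq, Nat.count_succ, if_neg hn, ih, add_zero]
    · rw [hp, hq, Nat.count_succ, Nat.count_succ, ih]
      simp only [h0]

/-- Every marked position of the first sequence is visited. -/
theorem IsSynced.exists_count_eq (h : IsSynced X Y p q) (hg : IsGridPath p q)
    (hf : IsFairPath p q) (hX : IsSparse X) (hY : IsSparse Y) (k : ℕ) :
    ∃ n, IsMarked X (p n) ∧ IsMarked Y (q n) ∧ Nat.count (IsMarked X) (p n) = k ∧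
      Nat.count (IsMarked Y) (q n) = k := by
  obtain ⟨n, hn⟩ := exists_eq_of_step hg.fst_zero hg.fst_le (fun m => (hf m).1)
    (Nat.nth (IsMarked X) k)
  have h1 : IsMarked X (p n) := hn ▸ Nat.nth_mem_of_infinite hX.infinite k
  have h2 : Nat.count (IsMarked X) (p n) = k := by
    rw [hn, Nat.count_nth_of_infinite hX.infinite]
  exact ⟨n, h1, (h n).1 h1, h2, h.count_eq hg hX hY n ▸ h2⟩

open Classical in
/-- One step of the synchronizing path. -/
noncomputable def syncStep (X Y : ℕ → Option β) (c : ℕ × ℕ) : ℕ × ℕ :=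
  if IsMarked X (c.1 + 1) ∧ ¬ IsMarked Y (c.2 + 1) then (c.1, c.2 + 1)
  else if IsMarked Y (c.2 + 1) ∧ ¬ IsMarked X (c.1 + 1) then (c.1 + 1, c.2)
  else (c.1 + 1, c.2 + 1)

theorem syncStep_swap (c : ℕ × ℕ) : syncStep Y X c.swap = (syncStep X Y c).swap := by
  simp only [syncStep, Prod.fst_swap, Prod.snd_swap]
  split_ifs <;> first | rfl | tauto

theorem exists_le_of_forall_exists_lt {f : ℕ → ℕ} (h : ∀ n, ∃ n', f n < f n') (m : ℕ) :
    ∃ n, m ≤ f n := by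
  induction m with
  | zero => exact ⟨0, Nat.zero_le _⟩
  | succ m ih =>
    obtain ⟨n, hn⟩ := ih
    obtain ⟨n', hn'⟩ := h n
    exact ⟨n', by omega⟩

/-- The first coordinate waits only as long as the next position of the second is unmarked, and `Y`
has marks arbitrarily far out. The other coordinate follows by swapping. -/
theorem exists_fst_lt_of_syncStep (hY : {i | IsMarked Y i}.Infinite) {c : ℕ → ℕ × ℕ}
    (hc : ∀ n, c (n + 1) = syncStep X Y (c n)) (n : ℕ) : ∃ n', (c n).1 < (c n').1 := by
  by_contra! h
  have key : ∀ j, c (n + j) = ((c n).1, (c n).2 + j) ∧ (1 ≤ j → ¬ IsMarked Y ((c n).2 + j)) := by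
    intro j
    induction j with
    | zero => simp
    | succ j ih =>
      have h1 := hc (n + j)
      have h2 := h (n + j + 1)
      rw [ih.1, syncStep] at h1
      split_ifs at h1 with h3 h4
      · exact ⟨h1, fun _ => h3.2⟩
      · rw [h1] at h2
        simp at h2
      · rw [h1] at h2
        simp at h2
  obtain ⟨i, hi, hlt⟩ := hY.exists_gt (c n).2
  obtain ⟨j, rfl⟩ := Nat.exists_eq_add_of_lt hlt
  exact (key (j + 1)).2 (by omega) hi

/-- Two sparse sequences have a fair synchronizing path. -/
theorem exists_isSynced (hX : IsSparse X) (hY : IsSparse Y) :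
    ∃ p q, IsGridPath p q ∧ IsFairPath p q ∧ IsSynced X Y p q := by
  obtain ⟨c, hc0, hc⟩ : ∃ c : ℕ → ℕ × ℕ, c 0 = (0, 0) ∧ ∀ n, c (n + 1) = syncStep X Y (c n) :=
    ⟨fun n => (syncStep X Y)^[n] (0, 0), rfl, fun n => Function.iterate_succ_apply' _ _ _⟩
  have hg : IsGridPath (fun n => (c n).1) fun n => (c n).2 := by
    refine ⟨by rw [hc0], by rw [hc0], fun n => ?_⟩
    simp only [hc n, syncStep]
    split_ifs <;> simp
  refine ⟨_, _, hg, ?_, fun n => ?_⟩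
  · have hswap : ∀ n, (c (n + 1)).swap = syncStep Y X (c n).swap := fun n => by
      rw [syncStep_swap, hc]
    have h1 : ∀ m, ∃ n, m ≤ (c n).1 := exists_le_of_forall_exists_lt
      (exists_fst_lt_of_syncStep hY.infinite hc)
    have h2 : ∀ m, ∃ n, m ≤ (c n).2 := exists_le_of_forall_exists_lt
      (exists_fst_lt_of_syncStep (c := fun n => (c n).swap) hX.infinite hswap)
    exact fun m => ⟨h1 m, h2 m⟩
  · induction n with
    | zero => simp [hc0, hX.zero, hY.zero]
    | succ n ih =>
      change IsMarked X (c (n + 1)).1 ↔ IsMarked Y (c (n + 1)).2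
      rw [hc n, syncStep]
      split_ifs with h1 h2
      -- The waiting coordinate stands directly before a mark, hence not on one.
      · have h3 : ¬ IsMarked X (c n).1 := fun hm => hX.succ _ hm h1.1
        simp only [h3, h1.2]
      · have h3 : ¬ IsMarked Y (c n).2 := fun hm => hY.succ _ hm h2.1
        simp only [h3, h2.2]
      · tauto

end sync

/-! ### The marked sequences of a list of items -/

section items

variable {α β : Type} (π : α → Option β)

/-- The items of the list stand at the odd positions, and are marked if they belong to the
projection `π`. After the list all odd positions are marked with `none`. -/
def marks (s : List α) (i : ℕ) : Option (Option β) :=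
  if i % 2 = 0 then none else
    match s[i / 2]? with
    | none => some none
    | some a => (π a).map some

theorem marks_even (s : List α) {i : ℕ} (hi : i % 2 = 0) : marks π s i = none := if_pos hi

theorem marks_cons (a : α) (s : List α) (i : ℕ) : marks π (a :: s) (2 + i) = marks π s i := by
  have h1 : (2 + i) % 2 = i % 2 := by omega
  have h2 : (2 + i) / 2 = i / 2 + 1 := by omega
  rw [marks, marks, h1, h2, List.getElem?_cons_succ]

theorem isSparse_marks (s : List α) : IsSparse (marks π s) := by
  refine ⟨by simp [marks], fun i hi => ?_, ?_⟩
  · rcases Nat.mod_two_eq_zero_or_one i with h | h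
    · rw [IsMarked, marks_even π s h] at hi
      cases hi
    · rw [IsMarked, marks_even π s (by omega)]
      exact Bool.false_ne_true
  · refine Set.infinite_of_forall_exists_gt fun n => ⟨2 * (n + s.length) + 1, ?_, by omega⟩
    have h1 : (2 * (n + s.length) + 1) / 2 = n + s.length := by omega
    have h2 : (2 * (n + s.length) + 1) % 2 = 1 := by omega
    have h3 : marks π s (2 * (n + s.length) + 1) = some none := by simp [marks, h1, h2]
    exact congrArg Option.isSome h3

/-- The marks enumerate the projection of the list. -/
theorem marks_eq_some {s : List α} {i : ℕ} {c : Option β} (h : marks π s i = some c) :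
    c = (s.filterMap π)[Nat.count (IsMarked (marks π s)) i]? := by
  induction s generalizing i with
  | nil =>
    rw [marks] at h
    split_ifs at h
    simpa using h.symm
  | cons a s ih =>
    rcases i with _ | _ | i
    · simp [marks] at h
    · have h1 : ¬ IsMarked (marks π (a :: s)) 0 := (isSparse_marks π _).zero
      rw [Nat.count_succ, Nat.count_zero, if_neg h1]
      obtain ⟨b, hb, rfl⟩ : ∃ b, π a = some b ∧ some b = c := by simpa [marks] using h
      simp [hb]
    · have h1 : ¬ IsMarked (marks π (a :: s)) 0 := (isSparse_marks π _).zero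
      have h2 : i + 1 + 1 = 2 + i := by omega
      rw [h2] at h ⊢
      rw [marks_cons] at h
      have h3 : marks π (a :: s) 1 = (π a).map some := by simp [marks]
      rw [ih h, Nat.count_add, Nat.count_succ, Nat.count_succ, Nat.count_zero, if_neg h1]
      simp only [IsMarked, marks_cons, zero_add, h3]
      rcases ha : π a with _ | b
      · simp [ha]
      · simp [ha, add_comm 1]

variable {π}

/-- If the projections of two lists agree, then synchronized paths see no difference. -/
theorem IsSynced.marks_eq {s s' : List α} {p q : ℕ → ℕ} (h : IsSynced (marks π s) (marks π s') p q)
    (hg : IsGridPath p q) (hs : s.filterMap π = s'.filterMap π) (n : ℕ) :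
    marks π s (p n) = marks π s' (q n) := by
  have hn := h n
  rcases hx : marks π s (p n) with _ | c <;> rcases hy : marks π s' (q n) with _ | d <;>
    simp only [IsMarked, hx, hy, Option.isSome_none, Option.isSome_some, Bool.false_eq_true,
      false_iff, iff_false, not_true] at hn ⊢
  rw [marks_eq_some π hx, marks_eq_some π hy, hs,
    h.count_eq hg (isSparse_marks π s) (isSparse_marks π s')]

/-- If the projections of two lists differ, then some fair synchronized path sees a difference. -/
theorem exists_isSynced_marks_ne {s s' : List α} (hs : s.filterMap π ≠ s'.filterMap π) :
    ∃ p q, IsGridPath p q ∧ IsFairPath p q ∧ IsSynced (marks π s) (marks π s') p q ∧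
      ∃ n, IsMarked (marks π s) (p n) ∧ marks π s (p n) ≠ marks π s' (q n) := by
  obtain ⟨p, q, hg, hf, h⟩ := exists_isSynced (isSparse_marks π s) (isSparse_marks π s')
  refine ⟨p, q, hg, hf, h, ?_⟩
  by_contra! hc
  refine hs (List.ext_getElem? fun k => ?_)
  -- The k-th marks are visited together, so agreement at all visits forces equal k-th entries, with
  -- `none` beyond the end of a list.
  obtain ⟨n, hx, hy, h1, h2⟩ :=
    h.exists_count_eq hg hf (isSparse_marks π s) (isSparse_marks π s') k
  have he := hc n hx
  obtain ⟨c, hx⟩ := Option.isSome_iff_exists.1 hx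
  have h3 := marks_eq_some π hx
  have h4 := marks_eq_some π (he ▸ hx)
  rw [h1] at h3
  rw [h2] at h4
  rw [← h3, ← h4]

end items

end AHLTL

/-! ### Labels of domino traces and the meaning of the formulas on them -/

namespace AHLTL

/-! ### Traces that spell out a sequence of dominos -/

/-- An item of a trace: the index of a domino or a letter. -/
abbrev Item : Type := ℕ ⊕ ℕ

/-- The proposition of the type of a trace: `true` for the upper words. -/
def apType (ty : Bool) : ℕ := if ty then apW else apV

/-- The label for an item, or for the end of the items; `k` is the number of dominos. -/
def itemLabel (k : ℕ) (ty : Bool) : Option Item → List ℕ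
  | none => apEnd :: apLc :: (List.range k).map apDom
  | some (.inl d) => [apType ty, apDom d]
  | some (.inr a) => [apType ty, apLc, apLetter a]

/-- The trace with the given items at the odd positions. -/
def itemTrace (k : ℕ) (ty : Bool) (e : ℕ → Option Item) : Trace :=
  fun i => {a | a ∈ if i % 2 = 0 then [apType ty] else itemLabel k ty (e (i / 2))}

section itemTrace

variable {k : ℕ} {ty : Bool} {s : List Item} {i : ℕ}

/-- The end label contains all domino propositions, so a single one of them does not separate its
item from the end. -/
theorem apDom_mem_itemTrace {d : ℕ} (hd : d < k) : apDom d ∈ itemTrace k ty (fun m => s[m]?) i ↔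
    marks Sum.getLeft? s i = some (some d) ∨ marks Sum.getLeft? s i = some none := by
  rw [itemTrace, marks, Set.mem_ofPred_eq]
  split_ifs
  · cases ty <;> simp [apType, apDom, apW, apV] <;> omega
  · rcases s[i / 2]? with _ | d' | a
    · simp [itemLabel, apDom, hd]
    · cases ty <;> simp [itemLabel, apType, apDom, apW, apV] <;> omega
    · cases ty <;> simp [itemLabel, apType, apDom, apW, apV, apLc, apLetter] <;> omega

theorem apLc_mem_itemTrace : apLc ∈ itemTrace k ty (fun m => s[m]?) i ↔
    IsMarked (marks Sum.getRight? s) i := by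
  rw [itemTrace, IsMarked, marks, Set.mem_ofPred_eq]
  split_ifs
  · cases ty <;> simp [apType, apLc, apW, apV]
  · rcases s[i / 2]? with _ | d' | a
    · simp [itemLabel]
    · cases ty <;> simp [itemLabel, apType, apDom, apW, apV, apLc] <;> omega
    · cases ty <;> simp [itemLabel]

theorem apLetter_mem_itemTrace {l : ℕ} : apLetter l ∈ itemTrace k ty (fun m => s[m]?) i ↔
    marks Sum.getRight? s i = some (some l) := by
  rw [itemTrace, marks, Set.mem_ofPred_eq]
  split_ifs
  · cases ty <;> simp [apType, apLetter, apW, apV] <;> omega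
  · rcases s[i / 2]? with _ | d' | a
    · simp [itemLabel, apDom, apLetter, apEnd, apLc]
      refine ⟨by omega, by omega, fun x _ => by omega⟩
    · cases ty <;> simp [itemLabel, apType, apDom, apW, apV, apLetter] <;> omega
    · cases ty <;> simp [itemLabel, apType, apW, apV, apLc, apLetter] <;> omega

theorem apEnd_mem_itemTrace {e : ℕ → Option Item} :
    apEnd ∈ itemTrace k ty e i ↔ i % 2 = 1 ∧ e (i / 2) = none := by
  rw [itemTrace, Set.mem_ofPred_eq]
  split_ifs
  · cases ty <;> simp [apType, apEnd, apW, apV] <;> omega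
  · have h : i % 2 = 1 := by omega
    rcases e (i / 2) with _ | d' | a
    · simp [itemLabel, h]
    · cases ty <;> simp [itemLabel, apType, apDom, apW, apV, apEnd] <;> omega
    · cases ty <;> simp [itemLabel, apType, apLetter, apLc, apW, apV, apEnd] <;> omega

theorem apType_mem_itemTrace {e : ℕ → Option Item} (h : apEnd ∉ itemTrace k ty e i) (ty' : Bool) :
    apType ty' ∈ itemTrace k ty e i ↔ ty' = ty := by
  rw [apEnd_mem_itemTrace] at h
  rw [itemTrace, Set.mem_ofPred_eq]
  split_ifs with hi
  · cases ty <;> cases ty' <;> simp [apType, apW, apV]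
  · have h : i % 2 = 1 := by omega
    rcases he : e (i / 2) with _ | d' | a
    · simp_all
    · cases ty <;> cases ty' <;> simp [itemLabel, apType, apDom, apW, apV] <;> omega
    · cases ty <;> cases ty' <;> simp [itemLabel, apType, apLetter, apLc, apW, apV] <;> omega

end itemTrace

section semantics

variable {τ σ : Trace} {t : Trajectory} {I : PCP}

theorem sat_phiType : phiType.Sat (pairAssignment τ σ 0 0, t) ↔
    (∃ i, apEnd ∈ τ (t.count 0 i) ∧ ∀ j < i, apW ∈ τ (t.count 0 j) ∧ apV ∉ τ (t.count 0 j)) ∧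
      ∃ i, apEnd ∈ σ (t.count 1 i) ∧ ∀ j < i, apW ∉ σ (t.count 1 j) ∧ apV ∈ σ (t.count 1 j) := by
  simp only [phiType, Psi.sat_and, Psi.Sat.eq_5, succ_iterate_pairAssignment, Psi.sat_atom_zero,
    Psi.sat_atom_one, Psi.sat_neg]

theorem sat_domAt_zero {i j : ℕ} : (domAt I 0).Sat (pairAssignment τ σ i j, t) ↔
    ∃ d < I.length, apDom d ∈ τ i := by
  simp [domAt, Psi.sat_bigOr, Psi.sat_atom_zero]

theorem sat_domAt_one {i j : ℕ} : (domAt I 1).Sat (pairAssignment τ σ i j, t) ↔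
    ∃ d < I.length, apDom d ∈ σ j := by
  simp [domAt, Psi.sat_bigOr, Psi.sat_atom_one]

theorem sat_phiDomino : (phiDomino I).Sat (pairAssignment τ σ 0 0, t) ↔
    (∀ n, (∃ d < I.length, apDom d ∈ τ (t.count 0 n)) ↔
      ∃ d < I.length, apDom d ∈ σ (t.count 1 n)) ∧
    ∃ n, ∃ d < I.length, ¬ (apDom d ∈ τ (t.count 0 n) ↔ apDom d ∈ σ (t.count 1 n)) := by
  simp [phiDomino, Psi.sat_and, Psi.sat_alw, Psi.sat_ev, Psi.sat_iff, Psi.sat_bigOr, Psi.sat_neg,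
    succ_iterate_pairAssignment, Psi.sat_atom_zero, Psi.sat_atom_one, sat_domAt_zero,
    sat_domAt_one]

theorem sat_phiWord : (phiWord I).Sat (pairAssignment τ σ 0 0, t) ↔
    (∀ n, apLc ∈ τ (t.count 0 n) ↔ apLc ∈ σ (t.count 1 n)) ∧
    ∃ n, ∃ l ∈ I.letters, ¬ (apLetter l ∈ τ (t.count 0 n) ↔ apLetter l ∈ σ (t.count 1 n)) := by
  simp [phiWord, Psi.sat_and, Psi.sat_alw, Psi.sat_ev, Psi.sat_iff, Psi.sat_bigOr, Psi.sat_neg,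
    succ_iterate_pairAssignment, Psi.sat_atom_zero, Psi.sat_atom_one]

variable {ty ty' : Bool} {s s' : List Item}

theorem marks_ne_none {α β : Type} {π : α → Option β} {s : List α} {i : ℕ} {b : β}
    (h : marks π s i = some (some b)) : ∃ a ∈ s, π a = some b := by
  rw [marks] at h
  split_ifs at h
  rcases he : s[i / 2]? with _ | a <;> rw [he] at h
  · simp at h
  · exact ⟨a, List.mem_of_getElem? he, by simpa using h⟩

theorem exists_apDom_mem_itemTrace (hk : 0 < I.length) (hs : ∀ d, .inl d ∈ s → d < I.length)
    {i : ℕ} : (∃ d < I.length, apDom d ∈ itemTrace I.length ty (fun m => s[m]?) i) ↔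
      IsMarked (marks Sum.getLeft? s) i := by
  constructor
  · rintro ⟨d, hd, h⟩
    rw [apDom_mem_itemTrace hd] at h
    rcases h with h | h <;> simp [IsMarked, h]
  · intro h
    obtain ⟨c, h⟩ := Option.isSome_iff_exists.1 h
    rcases c with _ | d
    · exact ⟨0, hk, (apDom_mem_itemTrace hk).2 (Or.inr h)⟩
    · obtain ⟨a, ha, hd⟩ := marks_ne_none h
      have hd' : d < I.length := hs d (by rwa [← Sum.getLeft?_eq_some_iff.1 hd])
      exact ⟨d, hd', (apDom_mem_itemTrace hd').2 (Or.inl h)⟩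

/-- Two dominos are needed: the end label differs from the label of an index only through the
proposition of another index. -/
theorem sat_phiDomino_itemTrace (hk : 1 < I.length) (hs : ∀ d, .inl d ∈ s → d < I.length)
    (hs' : ∀ d, .inl d ∈ s' → d < I.length) :
    (phiDomino I).Sat (pairAssignment (itemTrace I.length ty fun m => s[m]?)
      (itemTrace I.length ty' fun m => s'[m]?) 0 0, t) ↔
    IsSynced (marks Sum.getLeft? s) (marks Sum.getLeft? s') (t.count 0) (t.count 1) ∧
      ∃ n, marks Sum.getLeft? s (t.count 0 n) ≠ marks Sum.getLeft? s' (t.count 1 n) := by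
  rw [sat_phiDomino]
  simp only [exists_apDom_mem_itemTrace (by omega : 0 < I.length) hs,
    exists_apDom_mem_itemTrace (by omega : 0 < I.length) hs']
  refine and_congr_right fun hsync => exists_congr fun n => ?_
  constructor
  · rintro ⟨d, hd, h⟩ he
    rw [apDom_mem_itemTrace hd, apDom_mem_itemTrace hd, he] at h
    exact h Iff.rfl
  · intro hne
    by_contra! hc
    have hn := hsync n
    have hc' : ∀ d < I.length, _ := fun d hd => by
      have := hc d hd
      rwa [apDom_mem_itemTrace hd, apDom_mem_itemTrace hd] at this
    have hother : ∀ d : ℕ, ∃ d' < I.length, d' ≠ d := fun d => by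
      rcases Nat.eq_zero_or_pos d with rfl | h
      · exact ⟨1, hk, by omega⟩
      · exact ⟨0, by omega, by omega⟩
    rcases hx : marks Sum.getLeft? s (t.count 0 n) with _ | _ | d <;>
      rcases hy : marks Sum.getLeft? s' (t.count 1 n) with _ | _ | d' <;>
      simp [IsMarked, hx, hy] at hn hne hc'
    · obtain ⟨d, hd, hne'⟩ := hother d'
      exact hne' (hc' d hd).symm
    · obtain ⟨d', hd, hne'⟩ := hother d
      exact hne' (hc' d' hd).symm
    · obtain ⟨a, ha, hd⟩ := marks_ne_none hx
      have hd' : d < I.length := hs d (by rwa [← Sum.getLeft?_eq_some_iff.1 hd])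
      exact hne ((hc' d hd').1 rfl).symm

/-- The end label shows `apLc` without a letter, so here no condition on the number of dominos is
needed. -/
theorem sat_phiWord_itemTrace (hs : ∀ l, .inr l ∈ s → l ∈ I.letters)
    (hs' : ∀ l, .inr l ∈ s' → l ∈ I.letters) {k : ℕ} :
    (phiWord I).Sat (pairAssignment (itemTrace k ty fun m => s[m]?)
      (itemTrace k ty' fun m => s'[m]?) 0 0, t) ↔
    IsSynced (marks Sum.getRight? s) (marks Sum.getRight? s') (t.count 0) (t.count 1) ∧
      ∃ n, marks Sum.getRight? s (t.count 0 n) ≠ marks Sum.getRight? s' (t.count 1 n) := by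
  rw [sat_phiWord]
  simp only [apLc_mem_itemTrace, apLetter_mem_itemTrace]
  refine and_congr_right fun hsync => exists_congr fun n => ?_
  constructor
  · rintro ⟨l, hl, h⟩ he
    rw [he] at h
    exact h Iff.rfl
  · intro hne
    by_contra! hc
    have hn := hsync n
    have hmem : ∀ l, marks Sum.getRight? s (t.count 0 n) = some (some l) ∨
        marks Sum.getRight? s' (t.count 1 n) = some (some l) → l ∈ I.letters := by
      rintro l (h | h)
      · obtain ⟨a, ha, hd⟩ := marks_ne_none h
        exact hs l (by rwa [← Sum.getRight?_eq_some_iff.1 hd])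
      · obtain ⟨a, ha, hd⟩ := marks_ne_none h
        exact hs' l (by rwa [← Sum.getRight?_eq_some_iff.1 hd])
    rcases hx : marks Sum.getRight? s (t.count 0 n) with _ | _ | l <;>
      rcases hy : marks Sum.getRight? s' (t.count 1 n) with _ | _ | l' <;>
      simp [IsMarked, hx, hy] at hn hne hc hmem
    · exact hc _ hmem rfl
    · exact hc _ hmem rfl
    · exact hne ((hc l (hmem l (Or.inl rfl))).1 rfl).symm

end semantics

end AHLTL

/-! ### The structure whose terminated traces spell domino sequences -/

namespace AHLTL

/-! ### The Kripke structure of an instance of Post's problem -/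

namespace PCP

variable (I : PCP) (ty : Bool)

/-- The upper (`true`) or lower (`false`) word of the domino with index `j`. -/
def word (j : ℕ) : List ℕ := if ty then (I[j]?.getD default).1 else (I[j]?.getD default).2

/-- The items of one domino: its index and its letters. -/
def block (j : ℕ) : List Item := .inl j :: (I.word ty j).map .inr

/-- The items of a sequence of dominos. -/
def spell (js : List ℕ) : List Item := js.flatMap (I.block ty)

theorem filterMap_getLeft_spell (js : List ℕ) : (I.spell ty js).filterMap Sum.getLeft? = js := by
  induction js with
  | nil => rfl
  | cons j js ih =>
    rw [spell, List.flatMap_cons, List.filterMap_append, ← spell, ih]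
    simp [block, Function.comp_def]

theorem filterMap_getRight_spell (js : List ℕ) :
    (I.spell ty js).filterMap Sum.getRight? = js.flatMap (I.word ty) := by
  induction js with
  | nil => rfl
  | cons j js ih =>
    rw [spell, List.flatMap_cons, List.filterMap_append, ← spell, ih]
    rw [block, List.filterMap_cons_none rfl, List.filterMap_map, List.flatMap_cons]
    exact congrArg (· ++ _) List.filterMap_some

variable {I ty}

theorem inl_mem_spell {js : List ℕ} {d : ℕ} : .inl d ∈ I.spell ty js ↔ d ∈ js := by
  simp [spell, block]

theorem inr_mem_spell {js : List ℕ} (hjs : ∀ j ∈ js, j < I.length) {l : ℕ}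
    (h : .inr l ∈ I.spell ty js) : l ∈ I.letters := by
  simp only [spell, block, List.mem_flatMap, List.mem_cons, reduceCtorEq, List.mem_map,
    Sum.inr.injEq, exists_eq_right, false_or] at h
  obtain ⟨j, hj, h⟩ := h
  refine List.mem_flatMap.2 ⟨I[j]'(hjs j hj), List.getElem_mem _, List.mem_append.2 ?_⟩
  rw [word, List.getElem?_eq_getElem (hjs j hj)] at h
  split_ifs at h
  · exact Or.inl h
  · exact Or.inr h

theorem solvable_iff : I.Solvable ↔ ∃ js : List ℕ, js ≠ [] ∧ (∀ j ∈ js, j < I.length) ∧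
    js.flatMap (I.word true) = js.flatMap (I.word false) := by
  have hword : ∀ js : List ℕ, (js.map fun j => I[j]?.getD default).flatMap Prod.fst =
      js.flatMap (I.word true) ∧ (js.map fun j => I[j]?.getD default).flatMap Prod.snd =
      js.flatMap (I.word false) := by
    intro js
    simp only [List.flatMap_map]
    exact ⟨rfl, rfl⟩
  constructor
  · rintro ⟨s, hne, hs, he⟩
    obtain ⟨js, hjs, rfl⟩ : ∃ js : List ℕ, (∀ j ∈ js, j < I.length) ∧
        s = js.map fun j => I[j]?.getD default := by
      clear hne he
      induction s with
      | nil => exact ⟨[], by simp, rfl⟩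
      | cons d s ih =>
        obtain ⟨js, hjs, rfl⟩ := ih fun d hd => hs d (List.mem_cons_of_mem _ hd)
        obtain ⟨j, hj, rfl⟩ := List.mem_iff_getElem.1 (hs d List.mem_cons_self)
        exact ⟨j :: js, by simpa [hj] using hjs, by simp [hj]⟩
    exact ⟨js, by simpa using hne, hjs, by rw [← (hword js).1, ← (hword js).2, he]⟩
  · rintro ⟨js, hne, hjs, he⟩
    refine ⟨js.map fun j => I[j]?.getD default, by simpa using hne, ?_, ?_⟩
    · simp only [List.mem_map, forall_exists_index, and_imp]
      rintro _ j hj rfl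
      simp [hjs j hj]
    · rw [(hword js).1, (hword js).2, he]

variable (I ty)

/-- One step in the list of the items that remain of a domino. -/
def WalkStep (l l' : List Item) : Prop :=
  l' = l.tail ∨ l.length = 1 ∧ ∃ j < I.length, l' = I.block ty j

/-- The sequences of remaining items along a trace. -/
def IsWalk (ρ : ℕ → List Item) : Prop :=
  (∃ j < I.length, ρ 0 = I.block ty j) ∧ ∀ m, I.WalkStep ty (ρ m) (ρ (m + 1))

variable {I ty}

theorem eq_nil_of_walkStep {ρ : ℕ → List Item} (h : ∀ m, I.WalkStep ty (ρ m) (ρ (m + 1)))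
    (h0 : ρ 0 = []) (m : ℕ) : ρ m = [] := by
  induction m with
  | zero => exact h0
  | succ m ih =>
    rcases h m with h1 | ⟨h1, -⟩
    · rw [h1, ih, List.tail_nil]
    · rw [ih] at h1
      cases h1

/-- Induction on a time at which nothing remains; each refill contributes one index. -/
theorem exists_spell_of_walkStep {m : ℕ} {ρ : ℕ → List Item}
    (h : ∀ m, I.WalkStep ty (ρ m) (ρ (m + 1))) (hm : ρ m = []) :
    ∃ js : List ℕ, (∀ j ∈ js, j < I.length) ∧ ∀ i, (ρ i).head? = (ρ 0 ++ I.spell ty js)[i]? := by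
  induction m generalizing ρ with
  | zero => exact ⟨[], by simp, fun i => by simp [hm, eq_nil_of_walkStep h hm i, spell]⟩
  | succ m ih =>
    rcases h0 : ρ 0 with _ | ⟨a, l⟩
    · exact ⟨[], by simp, fun i => by simp [eq_nil_of_walkStep h h0 i, spell]⟩
    · obtain ⟨js, hjs, hi⟩ := ih (ρ := fun i => ρ (i + 1)) (fun m => h (m + 1)) hm
      rcases h 0 with h1 | ⟨h1, j, hj, h2⟩
      · refine ⟨js, hjs, fun i => ?_⟩
        rcases i with _ | i
        · simp [h0]
        · rw [hi, zero_add, h1, h0]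
          rfl
      · obtain rfl : l = [] := by simpa [h0] using h1
        refine ⟨j :: js, by simpa [hj] using hjs, fun i => ?_⟩
        rcases i with _ | i
        · simp [h0]
        · rw [hi, h2]
          rfl

theorem IsWalk.exists_spell {ρ : ℕ → List Item} (h : I.IsWalk ty ρ) {m : ℕ} (hm : ρ m = []) :
    ∃ js : List ℕ, js ≠ [] ∧ (∀ j ∈ js, j < I.length) ∧
      ∀ i, (ρ i).head? = (I.spell ty js)[i]? := by
  obtain ⟨⟨j, hj, h0⟩, hs⟩ := h
  obtain ⟨js, hjs, hi⟩ := exists_spell_of_walkStep hs hm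
  refine ⟨j :: js, by simp, by simpa [hj] using hjs, fun i => ?_⟩
  rw [hi, h0]
  rfl

theorem exists_walk_cons {ρ : ℕ → List Item} (h : ∀ m, I.WalkStep ty (ρ m) (ρ (m + 1))) {a : Item}
    {l e : List Item} (h0 : I.WalkStep ty (a :: l) (ρ 0)) (hc : ∀ i, (ρ i).head? = e[i]?) :
    ∃ ρ : ℕ → List Item, ρ 0 = a :: l ∧ (∀ m, I.WalkStep ty (ρ m) (ρ (m + 1))) ∧
      ∀ i, (ρ i).head? = (a :: e)[i]? := by
  refine ⟨fun i => Nat.casesOn i (a :: l) ρ, rfl, fun m => ?_, fun i => ?_⟩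
  · rcases m with _ | m
    · exact h0
    · exact h m
  · rcases i with _ | i
    · rfl
    · simpa using hc i

/-- Outer induction on the dominos, inner on the rest of the current block. A refill replaces the
last remaining item, so blocks follow each other without interruption. -/
theorem exists_walk (js : List ℕ) (hjs : ∀ j ∈ js, j < I.length) (a : Item) (l : List Item) :
    ∃ ρ : ℕ → List Item, ρ 0 = a :: l ∧ (∀ m, I.WalkStep ty (ρ m) (ρ (m + 1))) ∧
      ∀ i, (ρ i).head? = (a :: (l ++ I.spell ty js))[i]? := by
  induction js generalizing a l with
  | nil =>
    induction l generalizing a with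
    | nil =>
      refine exists_walk_cons (ρ := fun _ => []) (fun m => Or.inl rfl) (Or.inl rfl) fun i => ?_
      simp [spell]
    | cons b l ih =>
      obtain ⟨ρ, h0, hs, hi⟩ := ih b
      exact exists_walk_cons hs (Or.inl h0) hi
  | cons j js ih =>
    induction l generalizing a with
    | nil =>
      obtain ⟨ρ, h0, hs, hi⟩ := ih (fun i hi => hjs i (List.mem_cons_of_mem _ hi)) (.inl j)
        ((I.word ty j).map .inr)
      exact exists_walk_cons hs (.inr ⟨by rfl, j, hjs j List.mem_cons_self, h0⟩) hi
    | cons b l ihl =>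
      obtain ⟨ρ, h0, hs, hi⟩ := ihl b
      exact exists_walk_cons hs (Or.inl h0) hi

theorem exists_isWalk {js : List ℕ} (hne : js ≠ []) (hjs : ∀ j ∈ js, j < I.length) :
    ∃ ρ, I.IsWalk ty ρ ∧ ∀ i, (ρ i).head? = (I.spell ty js)[i]? := by
  rcases js with _ | ⟨j, js⟩
  · exact absurd rfl hne
  · obtain ⟨ρ, h0, hs, hi⟩ := exists_walk (I := I) (ty := ty) js
      (fun i hi => hjs i (List.mem_cons_of_mem _ hi)) (.inl j) ((I.word ty j).map .inr)
    exact ⟨ρ, ⟨⟨j, hjs j List.mem_cons_self, h0⟩, hs⟩, hi⟩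

variable (I)

/-- The states: the type of the trace, whether an item or a gap is shown, and the items that
remain of the current domino. -/
abbrev GState : Type := Bool × Bool × List Item

def gstates : List GState :=
  [true, false].flatMap fun ty => [true, false].flatMap fun g =>
    (List.range I.length).flatMap fun j =>
      (List.range ((I.block ty j).length + 1)).map fun i => (ty, g, (I.block ty j).drop i)

def blocks (ty : Bool) : List (List Item) := (List.range I.length).map (I.block ty)

def ginit (s : GState) : Bool :=
  s.2.1 && decide (∃ l ∈ I.blocks s.1, l = s.2.2)

/-- The flag `true` stands for a gap, after which the first remaining item is shown. With nothing
left, the end label recurs at every odd position. -/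
def gsucc (s : GState) : List GState :=
  if s.2.1 = true then [(s.1, false, s.2.2)] else
    (s.1, true, s.2.2.tail) ::
      if s.2.2.length = 1 then (I.blocks s.1).map fun l => (s.1, true, l) else []

def glabel (s : GState) : List ℕ :=
  if s.2.1 = true then [apType s.1] else itemLabel I.length s.1 s.2.2.head?

variable {I}

theorem mem_blocks {ty : Bool} {l : List Item} :
    l ∈ I.blocks ty ↔ ∃ j < I.length, l = I.block ty j := by
  simp [blocks, eq_comm]

theorem mem_gstates {s : GState} : s ∈ I.gstates ↔ ∃ j < I.length, s.2.2 <:+ I.block s.1 j := by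
  obtain ⟨ty, g, l⟩ := s
  constructor
  · intro h
    simp only [gstates, List.mem_flatMap, List.mem_map, List.mem_range, Prod.mk.injEq] at h
    obtain ⟨ty', -, g', -, j, hj, i, -, rfl, rfl, rfl⟩ := h
    exact ⟨j, hj, List.drop_suffix _ _⟩
  · rintro ⟨j, hj, l', h⟩
    simp only [gstates, List.mem_flatMap, List.mem_map, List.mem_range, Prod.mk.injEq]
    refine ⟨ty, by simp, g, by simp, j, hj, l'.length, ?_, rfl, rfl, ?_⟩
    · rw [← h, List.length_append]
      omega
    · rw [← h, List.drop_left]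

theorem ginit_eq_true {s : GState} : I.ginit s = true ↔
    s.2.1 = true ∧ ∃ j < I.length, s.2.2 = I.block s.1 j := by
  rw [ginit, Bool.and_eq_true, decide_eq_true_iff, exists_eq_right, mem_blocks]

theorem gsucc_subset_gstates {s s' : GState} (hs : s ∈ I.gstates) (h : s' ∈ I.gsucc s) :
    s' ∈ I.gstates := by
  rw [mem_gstates] at hs ⊢
  obtain ⟨j, hj, hs⟩ := hs
  rw [gsucc] at h
  split_ifs at h
  · rw [List.mem_singleton] at h
    exact ⟨j, hj, h ▸ hs⟩
  · rw [List.mem_cons, List.mem_map] at h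
    rcases h with rfl | ⟨l, hl, rfl⟩
    · exact ⟨j, hj, (List.tail_suffix _).trans hs⟩
    · obtain ⟨j, hj, rfl⟩ := mem_blocks.1 hl
      exact ⟨j, hj, List.suffix_rfl⟩
  · rw [List.mem_singleton] at h
    exact ⟨j, hj, h ▸ (List.tail_suffix _).trans hs⟩

theorem gsucc_ne_nil (s : GState) : I.gsucc s ≠ [] := by
  rw [gsucc]
  split_ifs <;> simp

theorem mem_gsucc_item {ty : Bool} {l l' : List Item} :
    (ty, true, l') ∈ I.gsucc (ty, false, l) ↔ I.WalkStep ty l l' := by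
  by_cases h : l.length = 1 <;> simp [gsucc, h, WalkStep, mem_blocks]

variable (I)

def graphCode : KripkeCode := KripkeCode.ofGraph I.gstates I.ginit I.gsucc I.glabel

theorem total_graphCode : I.graphCode.Total :=
  KripkeCode.total_ofGraph (fun _ hs _ h => gsucc_subset_gstates hs h) fun s _ => gsucc_ne_nil s

/-- The type never changes and the flag alternates, so a path is determined by its remaining items
at even positions, which form a walk. -/
theorem traces_graphCode : (KripkeCode.toKripke _ I.total_graphCode).traces =
    {τ | ∃ ty ρ, I.IsWalk ty ρ ∧ τ = itemTrace I.length ty fun m => (ρ m).head?} := by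
  refine (KripkeCode.traces_ofGraph (fun _ hs _ h => gsucc_subset_gstates hs h)
    I.total_graphCode).trans ?_
  ext τ
  constructor
  · rintro ⟨r, ⟨-, h0⟩, hs, hτ⟩
    rw [ginit_eq_true] at h0
    have key : ∀ m, r (2 * m) = ((r 0).1, true, (r (2 * m)).2.2) →
        r (2 * m + 1) = ((r 0).1, false, (r (2 * m)).2.2) ∧
        r (2 * (m + 1)) = ((r 0).1, true, (r (2 * (m + 1))).2.2) ∧
        I.WalkStep (r 0).1 (r (2 * m)).2.2 (r (2 * (m + 1))).2.2 := by
      intro m h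
      have h1 : r (2 * m + 1) = ((r 0).1, false, (r (2 * m)).2.2) := by
        have := hs (2 * m)
        rw [h] at this
        simpa [gsucc] using this
      have h2 : r (2 * (m + 1)) ∈ I.gsucc (r (2 * m + 1)) := hs (2 * m + 1)
      rw [h1] at h2
      have h3 : r (2 * (m + 1)) = ((r 0).1, true, (r (2 * (m + 1))).2.2) := by
        by_cases hl : (r (2 * m)).2.2.length = 1
        · simp only [gsucc, Bool.false_eq_true, if_false, hl, if_true, List.mem_cons,
            List.mem_map] at h2
          rcases h2 with h2 | ⟨l, -, h2⟩
          · rw [h2]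
          · rw [← h2]
        · simp only [gsucc, Bool.false_eq_true, if_false, hl, List.mem_cons,
            List.not_mem_nil, or_false] at h2
          rw [h2]
      rw [h3, mem_gsucc_item] at h2
      exact ⟨h1, h3, h2⟩
    have heven : ∀ m, r (2 * m) = ((r 0).1, true, (r (2 * m)).2.2) := by
      intro m
      induction m with
      | zero => exact Prod.ext rfl (Prod.ext h0.1 rfl)
      | succ m ih => exact (key m ih).2.1
    have h1 := fun m => And.intro (heven m) (And.intro (key m (heven m)).1 (key m (heven m)).2.2)
    refine ⟨(r 0).1, fun m => (r (2 * m)).2.2, ⟨h0.2, fun m => (h1 m).2.2⟩, funext fun i => ?_⟩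
    rw [hτ, itemTrace]
    rcases Nat.even_or_odd' i with ⟨m, rfl | rfl⟩
    · rw [(h1 m).1]
      simp [glabel]
    · have h2 : (2 * m + 1) / 2 = m := by omega
      have h3 : (2 * m + 1) % 2 = 1 := by omega
      rw [(h1 m).2.1]
      simp [glabel, h2, h3]
  · rintro ⟨ty, ρ, ⟨⟨j, hj, h0⟩, hs⟩, rfl⟩
    refine ⟨fun i => (ty, decide (i % 2 = 0), ρ (i / 2)), ⟨?_, ?_⟩, fun i => ?_, fun i => ?_⟩
    · exact mem_gstates.2 ⟨j, hj, by simp [h0]⟩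
    · exact ginit_eq_true.2 ⟨rfl, j, hj, h0⟩
    · rcases Nat.even_or_odd' i with ⟨m, rfl | rfl⟩
      · have h2 : (2 * m + 1) / 2 = m := by omega
        have h3 : (2 * m + 1) % 2 = 1 := by omega
        simp [gsucc, h2, h3]
      · have h2 : (2 * m + 1) / 2 = m := by omega
        have h3 : (2 * m + 1) % 2 = 1 := by omega
        have h4 : (2 * m + 1 + 1) / 2 = m + 1 := by omega
        have h5 : (2 * m + 1 + 1) % 2 = 0 := by omega
        simpa [h2, h3, h4, h5, mem_gsucc_item] using hs m
    · by_cases hi : i % 2 = 0 <;> simp [itemTrace, glabel, hi]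

end PCP

end AHLTL

/-! ### Correctness of the reduction from Post's problem -/

namespace AHLTL

/-! ### Post's problem reduces to model checking -/

/-- Here fairness is essential: an unbounded coordinate meets the end label, and every label before
the first meeting carries the type. -/
theorem exists_apEnd_mem_itemTrace {k : ℕ} {ty : Bool} {s : List Item} {p : ℕ → ℕ} (h0 : p 0 = 0)
    (hs : ∀ n, p (n + 1) ≤ p n + 1) (hu : ∀ m, ∃ n, m ≤ p n) :
    ∃ i, apEnd ∈ itemTrace k ty (fun m => s[m]?) (p i) ∧
      ∀ j < i, apType ty ∈ itemTrace k ty (fun m => s[m]?) (p j) ∧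
        apType (!ty) ∉ itemTrace k ty (fun m => s[m]?) (p j) := by
  classical
  have hex : ∃ i, apEnd ∈ itemTrace k ty (fun m => s[m]?) (p i) := by
    obtain ⟨n, hn⟩ := exists_eq_of_step h0 hs hu (2 * s.length + 1)
    refine ⟨n, apEnd_mem_itemTrace.2 ⟨by omega, List.getElem?_eq_none ?_⟩⟩
    omega
  refine ⟨Nat.find hex, Nat.find_spec hex, fun j hj => ?_⟩
  have h := Nat.find_min hex hj
  rw [apType_mem_itemTrace h, apType_mem_itemTrace h]
  simp

/-- Position 0 is a gap, which never carries `apEnd`, so the until cannot be satisfied at once and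
reveals the type of the trace. -/
theorem exists_eq_nil_of_apEnd_mem {k : ℕ} {ty ty' : Bool} {ρ : ℕ → List Item} {p : ℕ → ℕ}
    (h0 : p 0 = 0) {i : ℕ} (hi : apEnd ∈ itemTrace k ty (fun m => (ρ m).head?) (p i))
    (hj : ∀ j < i, apType ty' ∈ itemTrace k ty (fun m => (ρ m).head?) (p j)) :
    ty' = ty ∧ ∃ m, ρ m = [] := by
  have hi0 : 0 < i := by
    rcases Nat.eq_zero_or_pos i with rfl | h
    · rw [apEnd_mem_itemTrace, h0] at hi
      omega
    · exact h
  have h1 := hj 0 hi0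
  rw [apEnd_mem_itemTrace] at hi
  rw [apType_mem_itemTrace (by rw [apEnd_mem_itemTrace, h0]; omega)] at h1
  exact ⟨h1, _, List.head?_eq_none_iff.1 hi.2⟩

namespace PCP

variable {I : PCP}

theorem not_models_of_solvable (hk : 1 < I.length) (h : I.Solvable) :
    ¬ I.graphCode.Models fairTrajectories (phiPCP I) := by
  intro hm
  rw [phiPCP, KripkeCode.models_all_all I.total_graphCode, traces_graphCode] at hm
  obtain ⟨js, hne, hjs, hw⟩ := solvable_iff.1 h
  obtain ⟨ρ, hρ, he⟩ := exists_isWalk (ty := true) hne hjs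
  obtain ⟨ρ', hρ', he'⟩ := exists_isWalk (ty := false) hne hjs
  obtain ⟨t, ht, hsat⟩ := hm _ ⟨true, ρ, hρ, rfl⟩ _ ⟨false, ρ', hρ', rfl⟩
  rw [funext he, funext he', Psi.sat_imp, Psi.sat_or] at hsat
  have hg := isGridPath_count ht.1
  have hf := isFairPath_count ht
  have htype := sat_phiType.2
    ⟨exists_apEnd_mem_itemTrace (k := I.length) (ty := true) (s := I.spell true js)
      hg.fst_zero hg.fst_le fun m => (hf m).1, by
      obtain ⟨i, h1, h2⟩ := exists_apEnd_mem_itemTrace (k := I.length) (ty := false)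
        (s := I.spell false js) hg.snd_zero hg.snd_le fun m => (hf m).2
      exact ⟨i, h1, fun j hj => (h2 j hj).symm⟩⟩
  rcases hsat htype with hd | hd
  · rw [sat_phiDomino_itemTrace hk (fun d hd => hjs d (inl_mem_spell.1 hd))
      fun d hd => hjs d (inl_mem_spell.1 hd)] at hd
    obtain ⟨hsync, n, hn⟩ := hd
    exact hn (hsync.marks_eq hg (by rw [filterMap_getLeft_spell, filterMap_getLeft_spell]) n)
  · rw [sat_phiWord_itemTrace (fun l hl => inr_mem_spell hjs hl)
      fun l hl => inr_mem_spell hjs hl] at hd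
    obtain ⟨hsync, n, hn⟩ := hd
    exact hn (hsync.marks_eq hg (by rw [filterMap_getRight_spell, filterMap_getRight_spell, hw]) n)

theorem models_of_not_solvable (hk : 1 < I.length) (h : ¬ I.Solvable) :
    I.graphCode.Models fairTrajectories (phiPCP I) := by
  rw [phiPCP, KripkeCode.models_all_all I.total_graphCode, traces_graphCode]
  rintro _ ⟨ty, ρ, hρ, rfl⟩ _ ⟨ty', ρ', hρ', rfl⟩
  -- The lockstep trajectory tests `phiType`: if it fails there, the implication holds; otherwise
  -- both traces terminate and have the right types.
  obtain ⟨t, -, h0, h1, ht⟩ := (isGridPath_delay 0).exists_trajectory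
  replace ht := ht (isFairPath_delay 0)
  by_cases htype : phiType.Sat (pairAssignment (itemTrace I.length ty fun m => (ρ m).head?)
    (itemTrace I.length ty' fun m => (ρ' m).head?) 0 0, t)
  swap
  · exact ⟨t, ht, Psi.sat_imp.2 fun hc => absurd hc htype⟩
  obtain ⟨⟨i, hi, hj⟩, i', hi', hj'⟩ := sat_phiType.1 htype
  obtain ⟨rfl, m, hm⟩ := exists_eq_nil_of_apEnd_mem (ty' := true) (p := t.count 0) rfl hi
    fun j h => (hj j h).1
  obtain ⟨rfl, m', hm'⟩ := exists_eq_nil_of_apEnd_mem (ty' := false) (p := t.count 1) rfl hi'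
    fun j h => (hj' j h).2
  obtain ⟨js, hne, hjs, he⟩ := hρ.exists_spell hm
  obtain ⟨js', -, hjs', he'⟩ := hρ'.exists_spell hm'
  rw [funext he, funext he']
  by_cases hjj : js = js'
  · subst hjj
    obtain ⟨p, q, hg, hf, hsync, n, -, hn⟩ := exists_isSynced_marks_ne (π := Sum.getRight?)
      (s := I.spell true js) (s' := I.spell false js) (by
        rw [filterMap_getRight_spell, filterMap_getRight_spell]
        exact fun hw => h (solvable_iff.2 ⟨js, hne, hjs, hw⟩))
    obtain ⟨t, -, rfl, rfl, ht⟩ := hg.exists_trajectory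
    exact ⟨t, ht hf, Psi.sat_imp.2 fun _ => Psi.sat_or.2 (Or.inr ((sat_phiWord_itemTrace
      (fun l hl => inr_mem_spell hjs hl) fun l hl => inr_mem_spell hjs hl).2 ⟨hsync, n, hn⟩))⟩
  · obtain ⟨p, q, hg, hf, hsync, n, -, hn⟩ := exists_isSynced_marks_ne (π := Sum.getLeft?)
      (s := I.spell true js) (s' := I.spell false js') (by
        rwa [filterMap_getLeft_spell, filterMap_getLeft_spell])
    obtain ⟨t, -, rfl, rfl, ht⟩ := hg.exists_trajectory
    exact ⟨t, ht hf, Psi.sat_imp.2 fun _ => Psi.sat_or.2 (Or.inl ((sat_phiDomino_itemTrace hk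
      (fun d hd => hjs d (inl_mem_spell.1 hd)) fun d hd => hjs' d (inl_mem_spell.1 hd)).2
        ⟨hsync, n, hn⟩))⟩

/-- The structure with one state, which has the label `l`. -/
def loopCode (l : List ℕ) : KripkeCode :=
  KripkeCode.ofGraph [()] (fun _ => true) (fun _ => [()]) fun _ => l

theorem total_loopCode (l : List ℕ) : (loopCode l).Total :=
  KripkeCode.total_ofGraph (by simp) (by simp)

theorem traces_loopCode (l : List ℕ) :
    (KripkeCode.toKripke _ (total_loopCode l)).traces = {fun _ => {a | a ∈ l}} := by
  refine (KripkeCode.traces_ofGraph (by simp) (total_loopCode l)).trans ?_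
  ext τ
  simp [funext_iff]

/-- The only trace is compared with itself, so no difference is ever seen and `phiType` decides; it
holds at once if `apEnd` is in the label. -/
theorem models_loopCode_iff {l : List ℕ} :
    (loopCode l).Models fairTrajectories (phiPCP I) ↔ apEnd ∉ l := by
  rw [phiPCP, KripkeCode.models_all_all (total_loopCode l), traces_loopCode]
  simp only [Set.mem_singleton_iff, forall_eq, Psi.sat_imp, Psi.sat_or, sat_phiType, sat_phiDomino,
    sat_phiWord, not_true, and_false, exists_false, or_false, Set.mem_ofPred_eq]
  constructor
  · rintro ⟨t, -, h⟩ hl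
    exact h ⟨⟨0, hl, by simp⟩, 0, hl, by simp⟩
  · intro hl
    obtain ⟨t, -, -, -, ht⟩ := (isGridPath_delay 0).exists_trajectory
    exact ⟨t, ht (isFairPath_delay 0), fun h => hl h.1.choose_spec.1⟩

/-- A solution repeats the single domino, so its two words have equal length and can be cut off the
front of the equation. -/
theorem solvable_of_length_le_one (hk : ¬ 1 < I.length) :
    I.Solvable ↔ I ≠ [] ∧ I.map Prod.fst = I.map Prod.snd := by
  rcases I with _ | ⟨d, _ | ⟨d', I⟩⟩
  · simp only [Solvable, List.not_mem_nil, ne_eq, not_true, false_and, iff_false]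
    rintro ⟨_ | ⟨d, s⟩, hne, hs, -⟩
    · exact hne rfl
    · exact hs d List.mem_cons_self
  · simp only [List.map_cons, List.map_nil, List.cons.injEq, and_true, ne_eq, reduceCtorEq,
      not_false_eq_true, true_and]
    constructor
    · rintro ⟨s, hne, hs, he⟩
      simp only [List.mem_singleton] at hs
      rcases s with _ | ⟨d', s⟩
      · exact absurd rfl hne
      · obtain rfl : d' = d := hs d' List.mem_cons_self
        have hlen : d'.1.length = d'.2.length := by
          have h := congrArg List.length he
          rw [List.eq_replicate_iff.2 ⟨rfl, hs⟩] at h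
          simpa using h
        exact (List.append_inj he hlen).1
    · intro h
      exact ⟨[d], by simp, by simp, by simp [h]⟩
  · simp at hk

open Classical in
/-- The Kripke structure for an instance of Post's problem. -/
noncomputable def code (I : PCP) : KripkeCode :=
  if 1 < I.length then I.graphCode
  else loopCode (if I ≠ [] ∧ I.map Prod.fst = I.map Prod.snd then [apEnd] else [])

theorem total_code (I : PCP) : I.code.Total := by
  rw [code]
  split_ifs
  · exact I.total_graphCode
  · exact total_loopCode _
  · exact total_loopCode _

theorem models_code_iff (I : PCP) :
    I.code.Models fairTrajectories (phiPCP I) ↔ ¬ I.Solvable := by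
  rw [code]
  split_ifs with hk h
  · exact ⟨fun hm h => not_models_of_solvable hk h hm, models_of_not_solvable hk⟩
  · rw [models_loopCode_iff, solvable_of_length_le_one hk]
    simp [h]
  · rw [models_loopCode_iff, solvable_of_length_le_one hk]
    exact iff_of_true (by simp) h

end PCP

theorem vars_phiPCP (I : PCP) :
    (phiType.imp ((phiDomino I).or (phiWord I))).vars ⊆ {0, 1} := by
  have h1 : ∀ x ∈ ({0, 1} : Set ℕ), (domAt I x).vars ⊆ {0, 1} := fun x hx =>
    Psi.vars_bigOr (by simp) (by simpa [Psi.vars] using fun _ _ => hx)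
  have h2 : ∀ (l : List ℕ) (f : ℕ → ℕ), (Psi.bigOr (l.map fun i =>
      Psi.neg ((Psi.atom (f i) 0).iff (Psi.atom (f i) 1)))).vars ⊆ {0, 1} := fun l f =>
    Psi.vars_bigOr (by simp) (by
      simp [Psi.vars, Psi.iff, Psi.and, Psi.imp, Set.insert_subset_iff])
  simp only [phiType, phiDomino, phiWord, Psi.imp, Psi.and, Psi.alw, Psi.ev, Psi.tru, Psi.iff,
    Psi.vars, Set.union_subset_iff, Set.singleton_subset_iff]
  simp only [Set.mem_insert_iff, Set.mem_singleton_iff, true_or, or_true, true_and, and_true, h1]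
  exact ⟨h2 _ apDom, h2 _ apLetter⟩

theorem wellFormed_phiPCP (I : PCP) : (phiPCP I).WellFormed := by
  refine ⟨by simp, by simp, fun x hx => ?_⟩
  have := vars_phiPCP I hx
  simpa [or_comm] using this

end AHLTL

/-! ### Computability of the reduction from Post's problem -/

namespace AHLTL

/-! ### The reduction of Post's problem is computable -/

theorem primrec_apDom : Primrec apDom :=
  Primrec.nat_add.comp (Primrec.const 4) (Primrec.nat_mul.comp (Primrec.const 2) Primrec.id)

theorem primrec_apLetter : Primrec apLetter :=
  Primrec.nat_add.comp (Primrec.const 5) (Primrec.nat_mul.comp (Primrec.const 2) Primrec.id)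

theorem primrec_itemLabel :
    Primrec fun x : ℕ × Bool × Option Item => itemLabel x.1 x.2.1 x.2.2 := by
  have hty : Primrec fun x : ℕ × Bool × Option Item => apType x.2.1 :=
    (Primrec.dom_finite apType).comp (Primrec.fst.comp Primrec.snd)
  have hnone : Primrec fun x : ℕ × Bool × Option Item =>
      apEnd :: apLc :: (List.range x.1).map apDom :=
    Primrec.list_cons.comp (Primrec.const _) (Primrec.list_cons.comp (Primrec.const _)
      (Primrec.list_map (Primrec.list_range.comp Primrec.fst) (primrec_apDom.comp Primrec.snd)))
  have hsome : Primrec₂ fun (x : ℕ × Bool × Option Item) (y : Item) =>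
      (Sum.casesOn y (fun d => [apType x.2.1, apDom d])
        fun a => [apType x.2.1, apLc, apLetter a] : List ℕ) :=
    Primrec.sumCasesOn Primrec.snd
      (Primrec.list_cons.comp (hty.comp (Primrec.fst.comp Primrec.fst)) (Primrec.list_cons.comp
        (primrec_apDom.comp Primrec.snd) (Primrec.const [])))
      (Primrec.list_cons.comp (hty.comp (Primrec.fst.comp Primrec.fst)) (Primrec.list_cons.comp
        (Primrec.const apLc) (Primrec.list_cons.comp
          (primrec_apLetter.comp Primrec.snd) (Primrec.const []))))
  refine (Primrec.option_casesOn (Primrec.snd.comp Primrec.snd) hnone hsome).of_eq ?_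
  rintro ⟨k, ty, _ | d | a⟩ <;> rfl

namespace PCP

theorem primrec_word : Primrec fun x : PCP × Bool × ℕ => x.1.word x.2.1 x.2.2 := by
  have h : Primrec fun x : PCP × Bool × ℕ => x.1[x.2.2]?.getD default :=
    Primrec.option_getD.comp (Primrec.list_getElem?.comp Primrec.fst
      (Primrec.snd.comp Primrec.snd)) (Primrec.const _)
  exact Primrec.ite (Primrec.eq.comp (Primrec.fst.comp Primrec.snd) (Primrec.const true))
    (Primrec.fst.comp h) (Primrec.snd.comp h)

theorem primrec_block : Primrec fun x : PCP × Bool × ℕ => x.1.block x.2.1 x.2.2 :=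
  Primrec.list_cons.comp (Primrec.sumInl.comp (Primrec.snd.comp Primrec.snd))
    (Primrec.list_map primrec_word (Primrec.sumInr.comp Primrec.snd))

theorem primrec_blocks : Primrec₂ blocks :=
  Primrec.list_map (Primrec.list_range.comp (Primrec.list_length.comp Primrec.fst))
    (primrec_block.comp (Primrec.pair (Primrec.fst.comp Primrec.fst)
      (Primrec.pair (Primrec.snd.comp Primrec.fst) Primrec.snd)))

theorem primrec_gstates : Primrec gstates := by
  refine Primrec.list_flatMap (Primrec.const _) (Primrec.list_flatMap (Primrec.const _)
    (Primrec.list_flatMap (Primrec.list_range.comp (Primrec.list_length.comp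
      (Primrec.fst.comp Primrec.fst))) ?_))
  have hb : Primrec fun x : ((PCP × Bool) × Bool) × ℕ => x.1.1.1.block x.1.1.2 x.2 :=
    primrec_block.comp (Primrec.pair (Primrec.fst.comp (Primrec.fst.comp Primrec.fst))
      (Primrec.pair (Primrec.snd.comp (Primrec.fst.comp Primrec.fst)) Primrec.snd))
  refine Primrec.list_map (Primrec.list_range.comp (Primrec.succ.comp
    (Primrec.list_length.comp hb))) ?_
  exact Primrec.pair (Primrec.snd.comp (Primrec.fst.comp (Primrec.fst.comp Primrec.fst)))
    (Primrec.pair (Primrec.snd.comp (Primrec.fst.comp Primrec.fst))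
      (Primrec.list_drop.comp Primrec.snd (hb.comp Primrec.fst)))

theorem primrec_ginit : Primrec₂ ginit := by
  have h : PrimrecRel fun (L : List (List Item)) (l : List Item) => ∃ l' ∈ L, l' = l :=
    PrimrecRel.exists_mem_list Primrec.eq
  exact Primrec.and.comp (Primrec.fst.comp (Primrec.snd.comp Primrec.snd))
    (PrimrecPred.decide (h.comp (primrec_blocks.comp Primrec.fst (Primrec.fst.comp Primrec.snd))
      (Primrec.snd.comp (Primrec.snd.comp Primrec.snd))))

theorem primrec_gsucc : Primrec₂ gsucc := by
  have hl : Primrec fun x : PCP × GState => x.2.2.2 :=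
    Primrec.snd.comp (Primrec.snd.comp Primrec.snd)
  have hty : Primrec fun x : PCP × GState => x.2.1 := Primrec.fst.comp Primrec.snd
  refine Primrec.ite (Primrec.eq.comp (Primrec.fst.comp (Primrec.snd.comp Primrec.snd))
    (Primrec.const true)) ?_ (Primrec.list_cons.comp (Primrec.pair hty (Primrec.pair
      (Primrec.const true) (Primrec.list_tail.comp hl))) (Primrec.ite (Primrec.eq.comp
        (Primrec.list_length.comp hl) (Primrec.const 1)) (Primrec.list_map
          (primrec_blocks.comp Primrec.fst hty) ?_) (Primrec.const [])))
  · exact Primrec.list_cons.comp (Primrec.pair hty (Primrec.pair (Primrec.const false) hl))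
      (Primrec.const [])
  · exact Primrec.pair (hty.comp Primrec.fst) (Primrec.pair (Primrec.const true) Primrec.snd)

theorem primrec_glabel : Primrec₂ glabel := by
  have hty : Primrec fun x : PCP × GState => x.2.1 := Primrec.fst.comp Primrec.snd
  refine Primrec.ite (Primrec.eq.comp (Primrec.fst.comp (Primrec.snd.comp Primrec.snd))
    (Primrec.const true)) (Primrec.list_cons.comp ((Primrec.dom_finite apType).comp hty)
      (Primrec.const [])) ?_
  exact primrec_itemLabel.comp (Primrec.pair (Primrec.list_length.comp Primrec.fst)
    (Primrec.pair hty (Primrec.list_head?.comp (Primrec.snd.comp (Primrec.snd.comp Primrec.snd)))))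

theorem primrec_code : Primrec code := by
  classical
  have h1 : PrimrecPred fun I : PCP => I ≠ [] := (Primrec.eq.comp Primrec.id (Primrec.const [])).not
  have h2 : PrimrecPred fun I : PCP => I.map Prod.fst = I.map Prod.snd :=
    Primrec.eq.comp (Primrec.list_map Primrec.id (Primrec.fst.comp Primrec.snd))
      (Primrec.list_map Primrec.id (Primrec.snd.comp Primrec.snd))
  have h3 : Primrec fun I : PCP =>
      if I ≠ [] ∧ I.map Prod.fst = I.map Prod.snd then [apEnd] else [] :=
    Primrec.ite (h1.and h2) (Primrec.const _) (Primrec.const _)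
  exact Primrec.ite (Primrec.nat_lt.comp (Primrec.const 1) Primrec.list_length)
    (KripkeCode.primrec_ofGraph primrec_gstates primrec_ginit primrec_gsucc primrec_glabel)
    (KripkeCode.primrec_ofGraph (Primrec.const _) (Primrec.const _) (Primrec.const _)
      (h3.comp Primrec.fst))

theorem primrec_letters : Primrec letters :=
  Primrec.list_flatMap Primrec.id (Primrec.list_append.comp (Primrec.fst.comp Primrec.snd)
    (Primrec.snd.comp Primrec.snd))

end PCP

theorem primrec_domAt (x : ℕ) : Primrec fun I => domAt I x :=
  Psi.primrec_bigOr.comp (Primrec.list_map (Primrec.list_range.comp Primrec.list_length)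
    (Psi.primrec_atom.comp (primrec_apDom.comp Primrec.snd) (Primrec.const x)))

theorem primrec_not_iff {α : Type} [Primcodable α] {f : α → ℕ} (hf : Primrec f) :
    Primrec fun a => Psi.neg ((Psi.atom (f a) 0).iff (Psi.atom (f a) 1)) :=
  Psi.primrec_neg.comp (Psi.primrec_iff.comp (Psi.primrec_atom.comp hf (Primrec.const 0))
    (Psi.primrec_atom.comp hf (Primrec.const 1)))

theorem primrec_phiDomino : Primrec phiDomino :=
  Psi.primrec_and.comp
    (Psi.primrec_alw.comp (Psi.primrec_iff.comp (primrec_domAt 0) (primrec_domAt 1)))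
    (Psi.primrec_ev.comp (Psi.primrec_bigOr.comp (Primrec.list_map
      (Primrec.list_range.comp Primrec.list_length)
      (primrec_not_iff (primrec_apDom.comp Primrec.snd)))))

theorem primrec_phiWord : Primrec phiWord :=
  Psi.primrec_and.comp (Primrec.const _) (Psi.primrec_ev.comp (Psi.primrec_bigOr.comp
    (Primrec.list_map PCP.primrec_letters (primrec_not_iff (primrec_apLetter.comp Primrec.snd)))))

theorem primrec_phiPCP : Primrec phiPCP :=
  Formula.primrec_all_all_someTraj.comp (Psi.primrec_imp.comp (Primrec.const _)
    (Psi.primrec_or.comp primrec_phiDomino primrec_phiWord))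

end AHLTL

theorem mainTheorem3 :
    -- model checking is undecidable, for both classes of trajectories, ...
    (∀ TRJ : Set ℕ → Set AHLTL.Trajectory,
      TRJ = AHLTL.trajectories ∨ TRJ = AHLTL.fairTrajectories →
      ¬ AHLTL.DecidableOn
          (fun x : AHLTL.KripkeCode × AHLTL.Formula =>
            AHLTL.KripkeCode.Total x.1 ∧ x.2.WellFormed)
          (fun x => AHLTL.KripkeCode.Models TRJ x.1 x.2) ∧
      -- ... already for the formulas `∀π. ∀π'. E. (□ ψ₁ ∧ ◇ ψ₂)` with state formulas `ψ₁`, `ψ₂`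
      ¬ AHLTL.DecidableOn
          (fun x : AHLTL.KripkeCode × AHLTL.Psi × AHLTL.Psi =>
            AHLTL.KripkeCode.Total x.1 ∧
              (x.2.1.IsState ∧ x.2.1.vars ⊆ {0, 1}) ∧ (x.2.2.IsState ∧ x.2.2.vars ⊆ {0, 1}))
          (fun x => AHLTL.KripkeCode.Models TRJ x.1 (AHLTL.shape x.2.1 x.2.2))) ∧
    -- the complement of Post's problem reduces to model checking the formulas `phiPCP`
    (∃ F : AHLTL.PCP → AHLTL.KripkeCode,
      Computable (fun I => (F I, AHLTL.phiPCP I)) ∧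
      ∀ I, AHLTL.KripkeCode.Total (F I) ∧ (AHLTL.phiPCP I).WellFormed ∧
        (AHLTL.KripkeCode.Models AHLTL.fairTrajectories (F I) (AHLTL.phiPCP I) ↔
          ¬ AHLTL.PCP.Solvable I)) := by
  refine ⟨fun TRJ hT =>
    ⟨AHLTL.not_decidableOn_models hT, AHLTL.not_decidableOn_models_shape hT⟩, ?_⟩
  exact ⟨AHLTL.PCP.code, AHLTL.PCP.primrec_code.to_comp.pair AHLTL.primrec_phiPCP.to_comp, fun I =>
    ⟨I.total_code, AHLTL.wellFormed_phiPCP I, I.models_code_iff⟩⟩
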